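/- Let $\mathbb K=\mathbb R$ or $\mathbb K=\mathbb C$. For a second order equation $y''=f(x,y,y')$ and a point $(x_0,y_0)$, let $Z$ be the algebra of point symmetries at $(x_0,y_0)$: the $\mathbb K$-vector space of germs at $(x_0,y_0)$ of smooth (for $\mathbb K=\mathbb C$: holomorphic) vector fields $X=\xi(x,y)\,\partial_x+\eta(x,y)\,\partial_y$ whose second prolongation annihilates $y''-f(x,y,y')$ on $y''=f(x,y,y')$. For $a,b,c,d\in\mathbb K$ the Painlevé equations are $$PIII(a,b,c,d):\quad y''=\frac{y'^2}{y}-\frac{y'}{x}+\frac{ay^2+b}{x}+cy^3+\frac dy,$$ $$PV(a,b,c,d):\quad y''=\Big(\frac1{2y}+\frac1{y-1}\Big)y'^2-\frac{y'}{x}+\frac{(y-1)^2}{x^2}\Big(ay+\frac by\Big)+\frac{cy}{x}+\frac{dy(y+1)}{y-1},$$ $$PVI(a,b,c,d):\quad y''=\frac12\Big(\frac1y+\frac1{y-1}+\frac1{y-x}\Big)y'^2-\Big(\frac1x+\frac1{x-1}+\frac1{y-x}\Big)y'+\frac{y(y-1)(y-x)}{x^2(x-1)^2}\Big(a+\frac{bx}{y^2}+\frac{c(x-1)}{(y-1)^2}+\frac{dx(x-1)}{(y-x)^2}\Big).$$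 A point $(x_0,y_0)$ is called regular if $x_0,y_0\ne0$ for $PIII$; $x_0\ne0$, $y_0\ne0,1$ for $PV$; $x_0\ne0,1$, $y_0\ne0,1,x_0$ for $PVI$. Then at every regular point the following holds. 1. $\dim Z=8$ for $PIII(0,0,0,0)$, $PV(0,0,0,0)$ and $PVI(0,0,0,\tfrac12)$. 2. Let $k\in\mathbb K$, $k\neq0$. Then $\dim Z=2$ for each of $PIII(0,k,0,0)$, $PIII(k,0,0,0)$, $PIII(0,0,k,0)$, $PIII(0,0,0,k)$. Let $\ln x$ be a local logarithm near $x_0$, i.e. an antiderivative of $1/x$ near $x_0$ (these exist). For every such choice, $Z$ is spanned by - $x\partial_x+y\partial_y$ and $(x\ln x-2x)\partial_x+y\ln x\,\partial_y$ for $PIII(0,k,0,0)$; - $x\partial_x-y\partial_y$ and $(x\ln x-2x)\partial_x-y\ln x\,\partial_y$ for $PIII(k,0,0,0)$; - $x\partial_x-y\partial_y$ and $(x\ln x-x)\partial_x-y\ln x\,\partial_y$ for $PIII(0,0,k,0)$; - $x\partial_x+y\partial_y$ and $(x\ln x-x)\partial_x+y\ln x\,\partial_y$ for $PIII(0,0,0,k)$.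 3. Let $b,d\in\mathbb K$ with $b\ne0$ and $d\neq0$. Then $\dim Z=1$ for $PIII(0,b,0,d)$, with $Z$ spanned by $x\partial_x+y\partial_y$, and $\dim Z=1$ for $PIII(-b,0,-d,0)$, with $Z$ spanned by $x\partial_x-y\partial_y$. The point transformation $\tilde x=x$, $\tilde y=1/y$ takes $PIII(0,b,0,d)$ to $PIII(-b,0,-d,0)$. Let $a,b\in\mathbb K$ with $(a,b)\ne(0,0)$. Then $\dim Z=1$ for $PV(a,b,0,0)$, with $Z$ spanned by $x\partial_x$. -/

import Mathlib

open scoped ContDiff Topology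

noncomputable section

namespace PointSymmetry

variable {𝕜 : Type*} [RCLike 𝕜]

/-! A scalar second order equation `y'' = f(x, y, y')` is given by `f : 𝕜 → 𝕜 → 𝕜 → 𝕜`, with
`𝕜 = ℝ` or `𝕜 = ℂ`. A vector field `ξ ∂/∂x + η ∂/∂y` on the `(x, y)`-plane is a map
`V : 𝕜 × 𝕜 → 𝕜 × 𝕜` with `V = (ξ, η)`. -/

/-- Total derivative of a function of `(x, y)`, at the point `q = (x, y)` and the slope `p = y'`:
`g_x + p g_y`. -/
def totalDeriv (g : 𝕜 × 𝕜 → 𝕜) (q : 𝕜 × 𝕜) (p : 𝕜) : 𝕜 :=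
  fderiv 𝕜 g q (1, p)

/-- Total derivative of a function `h` of `(x, y)` and `p = y'`, with `s = y''`:
`h_x + p h_y + s h_p`. -/
def totalDerivTwo (h : 𝕜 × 𝕜 → 𝕜 → 𝕜) (q : 𝕜 × 𝕜) (p s : 𝕜) : 𝕜 :=
  fderiv 𝕜 (fun j : (𝕜 × 𝕜) × 𝕜 => h j.1 j.2) (q, p) ((1, p), s)

/-- The coefficient of `∂/∂y'` in the first prolongation of `V = ξ ∂/∂x + η ∂/∂y`:
`η₁ = D η - y' D ξ`. -/
def prolongOne (V : 𝕜 × 𝕜 → 𝕜 × 𝕜) (q : 𝕜 × 𝕜) (p : 𝕜) : 𝕜 :=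
  totalDeriv (fun r => (V r).2) q p - p * totalDeriv (fun r => (V r).1) q p

/-- The coefficient of `∂/∂y''` in the second prolongation of `V = ξ ∂/∂x + η ∂/∂y`:
`η₂ = D η₁ - y'' D ξ`. -/
def prolongTwo (V : 𝕜 × 𝕜 → 𝕜 × 𝕜) (q : 𝕜 × 𝕜) (p s : 𝕜) : 𝕜 :=
  totalDerivTwo (prolongOne V) q p s - s * totalDeriv (fun r => (V r).1) q p

/-- Lie's infinitesimal symmetry condition over the point `q = (x, y)`: the second prolongation
of `V` annihilates `y'' - f(x, y, y')` at all `(x, y, y', y'')` with `y'' = f(x, y, y')`. -/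
def IsSymmetryAt (f : 𝕜 → 𝕜 → 𝕜 → 𝕜) (V : 𝕜 × 𝕜 → 𝕜 × 𝕜) (q : 𝕜 × 𝕜) : Prop :=
  ∀ p : 𝕜, prolongTwo V q p (f q.1 q.2 p) =
    fderiv 𝕜 (fun j : (𝕜 × 𝕜) × 𝕜 => f j.1.1 j.1.2 j.2) (q, p) (V q, prolongOne V q p)

theorem prolongOne_add_smul {V W : 𝕜 × 𝕜 → 𝕜 × 𝕜} {q : 𝕜 × 𝕜}
    (hV : DifferentiableAt 𝕜 V q) (hW : DifferentiableAt 𝕜 W q) (c : 𝕜) (p : 𝕜) :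
    prolongOne (V + c • W) q p = prolongOne V q p + c * prolongOne W q p := by
  have h1 : totalDeriv (fun r => ((V + c • W) r).1) q p =
      totalDeriv (fun r => (V r).1) q p + c * totalDeriv (fun r => (W r).1) q p := by
    have := (hV.fst.hasFDerivAt.add (hW.fst.hasFDerivAt.const_smul c)).fderiv
    unfold totalDeriv
    exact (congrArg (fun L : 𝕜 × 𝕜 →L[𝕜] 𝕜 => L (1, p)) this)
  have h2 : totalDeriv (fun r => ((V + c • W) r).2) q p =
      totalDeriv (fun r => (V r).2) q p + c * totalDeriv (fun r => (W r).2) q p := by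
    have := (hV.snd.hasFDerivAt.add (hW.snd.hasFDerivAt.const_smul c)).fderiv
    unfold totalDeriv
    exact (congrArg (fun L : 𝕜 × 𝕜 →L[𝕜] 𝕜 => L (1, p)) this)
  unfold prolongOne
  rw [h1, h2]
  ring

theorem differentiableAt_prolongOne {V : 𝕜 × 𝕜 → 𝕜 × 𝕜} {q : 𝕜 × 𝕜}
    (hV : ContDiffAt 𝕜 ∞ V q) (p : 𝕜) :
    DifferentiableAt 𝕜 (fun j : (𝕜 × 𝕜) × 𝕜 => prolongOne V j.1 j.2) (q, p) := by
  have key : ∀ g : 𝕜 × 𝕜 → 𝕜, ContDiffAt 𝕜 ∞ g q →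
      DifferentiableAt 𝕜 (fun j : (𝕜 × 𝕜) × 𝕜 => totalDeriv g j.1 j.2) (q, p) := by
    intro g hg
    have h1 : DifferentiableAt 𝕜 (fderiv 𝕜 g) q :=
      (hg.fderiv_right (m := 1)
        (WithTop.coe_le_coe.2 (le_top : ((1 + 1 : ℕ∞)) ≤ ⊤))).differentiableAt (by simp)
    have h2 : DifferentiableAt 𝕜 (fun j : (𝕜 × 𝕜) × 𝕜 => fderiv 𝕜 g j.1) (q, p) :=
      DifferentiableAt.comp (q, p) (f := Prod.fst) (g := fderiv 𝕜 g) h1 differentiableAt_fst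
    exact h2.clm_apply ((differentiableAt_const _).prodMk differentiableAt_snd)
  exact (key _ hV.snd).sub (differentiableAt_snd.mul (key _ hV.fst))

theorem IsSymmetryAt.add_smul {f : 𝕜 → 𝕜 → 𝕜 → 𝕜} {V W : 𝕜 × 𝕜 → 𝕜 × 𝕜} {q : 𝕜 × 𝕜}
    (hV : ∀ᶠ r in 𝓝 q, ContDiffAt 𝕜 ∞ V r) (hW : ∀ᶠ r in 𝓝 q, ContDiffAt 𝕜 ∞ W r)
    (sV : IsSymmetryAt f V q) (sW : IsSymmetryAt f W q) (c : 𝕜) :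
    IsSymmetryAt f (V + c • W) q := by
  intro p
  have dV := hV.self_of_nhds.differentiableAt (by simp)
  have dW := hW.self_of_nhds.differentiableAt (by simp)
  have e : (fun j : (𝕜 × 𝕜) × 𝕜 => prolongOne (V + c • W) j.1 j.2) =ᶠ[𝓝 (q, p)]
      fun j => prolongOne V j.1 j.2 + c * prolongOne W j.1 j.2 := by
    have ht : Filter.Tendsto (Prod.fst : (𝕜 × 𝕜) × 𝕜 → 𝕜 × 𝕜) (𝓝 (q, p)) (𝓝 q) :=
      continuous_fst.tendsto (q, p)
    filter_upwards [ht.eventually (hV.and hW)] with j hj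
    exact prolongOne_add_smul (hj.1.differentiableAt (by simp))
      (hj.2.differentiableAt (by simp)) c j.2
  have e2 := e.fderiv_eq.trans
    ((differentiableAt_prolongOne hV.self_of_nhds p).hasFDerivAt.add
      ((differentiableAt_prolongOne hW.self_of_nhds p).hasFDerivAt.const_mul c)).fderiv
  have h1 : totalDeriv (fun r => ((V + c • W) r).1) q p =
      totalDeriv (fun r => (V r).1) q p + c * totalDeriv (fun r => (W r).1) q p := by
    have := (dV.fst.hasFDerivAt.add (dW.fst.hasFDerivAt.const_smul c)).fderiv
    unfold totalDeriv
    exact (congrArg (fun L : 𝕜 × 𝕜 →L[𝕜] 𝕜 => L (1, p)) this)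
  have h2 : ∀ s, totalDerivTwo (prolongOne (V + c • W)) q p s =
      totalDerivTwo (prolongOne V) q p s + c * totalDerivTwo (prolongOne W) q p s := by
    intro s
    unfold totalDerivTwo
    rw [e2]
    rfl
  have h3 : ((V + c • W) q, prolongOne (V + c • W) q p) =
      (V q, prolongOne V q p) + c • (W q, prolongOne W q p) := by
    rw [prolongOne_add_smul dV dW]
    rfl
  have eV := sV p
  have eW := sW p
  rw [h3, map_add, map_smul, ← eV, ← eW]
  unfold prolongTwo
  rw [h1, h2, smul_eq_mul]
  ring

theorem isSymmetryAt_zero (f : 𝕜 → 𝕜 → 𝕜 → 𝕜) (q : 𝕜 × 𝕜) :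
    IsSymmetryAt f (0 : 𝕜 × 𝕜 → 𝕜 × 𝕜) q := by
  have h : ∀ r p, prolongOne (0 : 𝕜 × 𝕜 → 𝕜 × 𝕜) r p = 0 := by
    intro r p
    simp [prolongOne, totalDeriv]
  intro p
  have h0 : (((0 : 𝕜 × 𝕜 → 𝕜 × 𝕜) q, (0 : 𝕜)) : (𝕜 × 𝕜) × 𝕜) = 0 := rfl
  rw [h, h0, map_zero]
  simp [prolongTwo, totalDerivTwo, h, totalDeriv]

/-- The algebra `Z` of point symmetries of `y'' = f(x, y, y')` at the point `q₀ = (x₀, y₀)`: the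
vector space of germs at `q₀` of smooth (for `𝕜 = ℂ`: holomorphic) vector fields in the
`(x, y)`-plane that are infinitesimal symmetries of the equation near `q₀`. -/
def symmetryAlgebra (f : 𝕜 → 𝕜 → 𝕜 → 𝕜) (q₀ : 𝕜 × 𝕜) :
    Submodule 𝕜 (Filter.Germ (𝓝 q₀) (𝕜 × 𝕜)) where
  carrier := {g | ∃ V : 𝕜 × 𝕜 → 𝕜 × 𝕜, (V : Filter.Germ (𝓝 q₀) (𝕜 × 𝕜)) = g ∧
    ∀ᶠ q in 𝓝 q₀, ContDiffAt 𝕜 ∞ V q ∧ IsSymmetryAt f V q}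
  zero_mem' := ⟨0, rfl, Filter.Eventually.of_forall fun q =>
    ⟨contDiffAt_const, isSymmetryAt_zero f q⟩⟩
  add_mem' := by
    rintro _ _ ⟨V, rfl, hV⟩ ⟨W, rfl, hW⟩
    refine ⟨V + (1 : 𝕜) • W, by rw [one_smul]; rfl, ?_⟩
    filter_upwards [hV.eventually_nhds, hW.eventually_nhds] with q h1 h2
    exact ⟨h1.self_of_nhds.1.add (contDiffAt_const.smul h2.self_of_nhds.1),
      h1.self_of_nhds.2.add_smul (h1.mono fun _ h => h.1) (h2.mono fun _ h => h.1)
        h2.self_of_nhds.2 1⟩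
  smul_mem' := by
    rintro c _ ⟨W, rfl, hW⟩
    refine ⟨0 + c • W, by rw [zero_add]; rfl, ?_⟩
    filter_upwards [hW.eventually_nhds] with q h2
    exact ⟨contDiffAt_const.add (contDiffAt_const.smul h2.self_of_nhds.1),
      (isSymmetryAt_zero f q).add_smul (Filter.Eventually.of_forall fun _ => contDiffAt_const)
        (h2.mono fun _ h => h.1) h2.self_of_nhds.2 c⟩

/-- The germ at `q₀` of the vector field `ξ(x, y) ∂/∂x + η(x, y) ∂/∂y`. -/
def fieldGerm (q₀ : 𝕜 × 𝕜) (ξ η : 𝕜 → 𝕜 → 𝕜) : Filter.Germ (𝓝 q₀) (𝕜 × 𝕜) :=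
  ((fun q : 𝕜 × 𝕜 => (ξ q.1 q.2, η q.1 q.2) : 𝕜 × 𝕜 → 𝕜 × 𝕜) :
    Filter.Germ (𝓝 q₀) (𝕜 × 𝕜))

/-- `ln` is a logarithm near `x₀`: an antiderivative of `1/x`. For `𝕜 = ℂ` this covers all
branches of the logarithm near `x₀`, for `𝕜 = ℝ` it covers `ln |x|`. -/
def IsLocalLog (ln : 𝕜 → 𝕜) (x₀ : 𝕜) : Prop :=
  ∀ᶠ x in 𝓝 x₀, HasDerivAt ln x⁻¹ x

/-- The point transformation `(x̃, ỹ) = Φ(x, y)` is, near `q₀`, a smooth invertible change of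
variables that takes `y'' = f(x, y, y')` to `ỹ'' = g(x̃, ỹ, ỹ')`. Here `ỹ' = D ỹ / D x̃` and
`ỹ'' = D ỹ' / D x̃`. -/
def IsEquivalenceAt (f g : 𝕜 → 𝕜 → 𝕜 → 𝕜) (Φ : 𝕜 × 𝕜 → 𝕜 × 𝕜) (q₀ : 𝕜 × 𝕜) : Prop :=
  (∀ᶠ q in 𝓝 q₀, ContDiffAt 𝕜 ∞ Φ q) ∧ Function.Bijective (fderiv 𝕜 Φ q₀) ∧
  ∀ᶠ q in 𝓝 q₀, ∀ p : 𝕜,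
    let Dx : 𝕜 × 𝕜 → 𝕜 → 𝕜 := totalDeriv fun r => (Φ r).1
    let slope : 𝕜 × 𝕜 → 𝕜 → 𝕜 := fun r s => totalDeriv (fun t => (Φ t).2) r s / Dx r s
    Dx q p ≠ 0 →
      totalDerivTwo slope q p (f q.1 q.2 p) / Dx q p = g (Φ q).1 (Φ q).2 (slope q p)

/-- Right-hand side of `PIII(a,b,c,d)`, with `p = y'`. -/
def PIII (a b c d x y p : 𝕜) : 𝕜 :=
  1 / y * p ^ 2 - 1 / x * p + 1 / x * (a * y ^ 2 + b) + c * y ^ 3 + d / y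

/-- Right-hand side of `PV(a,b,c,d)`, with `p = y'`. -/
def PV (a b c d x y p : 𝕜) : 𝕜 :=
  (1 / (2 * y) + 1 / (y - 1)) * p ^ 2 - 1 / x * p
    + (y - 1) ^ 2 / x ^ 2 * (a * y + b / y) + c * y / x + d * y * (y + 1) / (y - 1)

/-- Right-hand side of `PVI(a,b,c,d)`, with `p = y'`. -/
def PVI (a b c d x y p : 𝕜) : 𝕜 :=
  1 / 2 * (1 / y + 1 / (y - 1) + 1 / (y - x)) * p ^ 2
    - (1 / x + 1 / (x - 1) + 1 / (y - x)) * p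
    + y * (y - 1) * (y - x) / (x ^ 2 * (x - 1) ^ 2) *
      (a + b * x / y ^ 2 + c * (x - 1) / (y - 1) ^ 2 + d * x * (x - 1) / (y - x) ^ 2)

end PointSymmetry

end

noncomputable section

namespace PointSymmetry

variable {𝕜 : Type*} [RCLike 𝕜]

open Filter

/-! All the equations have the form `y'' = B y'² + C y' + D` with `B`, `C`, `D` functions of `(x,
y)`. Lie's condition is then a cubic polynomial in `p = y'`, and its four coefficients give linear
equations for `ξ`, `η`. Read in the ring of germs of smooth functions (`SmoothGerm`), with its
commuting derivations `dx` and `dy`, these are identities of differential algebra; analysis enters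
only through constants, primitives of closed pairs, exponentials, inverses, the local logarithm and
one solution of a hypergeometric equation.

In each case a substitution `T = T(x)`, `U = U(x, y)` brings the equation to `U'' = F(T, U)`. A
`Frame` records only the first derivatives of `T` and `U`, which suffices to define `∂/∂T` and
`∂/∂U`, and `Frame.determining_iff_flat` transports the determining equations. It remains to solve
the equations `Flat` for four kinds of `F`.

If `F = 0`, the solutions are the eight projective fields (`flat_zero_iff`). This covers
`PIII(0,0,0,0)` with `T = ln x`, `U = ln y`; `PV(0,0,0,0)` with `T = ln x`, `U_y` proportional to `1
/ (√y (y - 1))`; and `PVI(0,0,0,1/2)`, where `U` is an elliptic integral divided by a period `f`.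
The period solves the Picard-Fuchs (hypergeometric) equation, so the transformed equation has no
right-hand side.

For `PIII` with one non-zero parameter, `F = k e^(n (T + ε U))` with `n = 1, 2` and `ε = ±1`. Then
`A` is affine in `T` and determines `E` (`flat_exp_iff`), which gives dimension 2. With two
parameters, `F` is a sum of such exponentials for `n = 1` and `n = 2`; they scale differently, so
only the translation along `T + ε U = const` survives (`flat_two_exp_iff`).

For `PV(a,b,0,0)`, `F` depends on `U` alone, so `∂/∂T` is a symmetry. That there is no other one
follows by comparing coefficients of polynomials in `y` made from the second, third and fourth
`U`-derivatives of `F` (`flat_sqrt_iff`). -/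

/-! ### Germs of smooth functions as a differential algebra -/

/-- `Algebra.ofModule` keeps the pointwise scalar action that germs already carry. -/
instance germAlgebra {α : Type*} (l : Filter α) : Algebra 𝕜 (Germ l 𝕜) :=
  Algebra.ofModule
    (fun c f g => by
      induction f using Germ.inductionOn
      induction g using Germ.inductionOn
      exact congrArg _ (funext fun _ => mul_assoc _ _ _))
    (fun c f g => by
      induction f using Germ.inductionOn
      induction g using Germ.inductionOn
      exact congrArg _ (funext fun _ => mul_left_comm _ _ _))

/-- The algebra of germs at `q₀` of smooth functions. -/
def SmoothGerm (q₀ : 𝕜 × 𝕜) : Subalgebra 𝕜 (Germ (𝓝 q₀) 𝕜) where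
  carrier := {g | ∃ f : 𝕜 × 𝕜 → 𝕜, (f : Germ (𝓝 q₀) 𝕜) = g ∧ ∀ᶠ q in 𝓝 q₀, ContDiffAt 𝕜 ∞ f q}
  mul_mem' := by
    rintro _ _ ⟨f, rfl, hf⟩ ⟨g, rfl, hg⟩
    exact ⟨f * g, rfl, by filter_upwards [hf, hg] with q h1 h2 using h1.mul h2⟩
  add_mem' := by
    rintro _ _ ⟨f, rfl, hf⟩ ⟨g, rfl, hg⟩
    exact ⟨f + g, rfl, by filter_upwards [hf, hg] with q h1 h2 using h1.add h2⟩
  algebraMap_mem' c := ⟨fun _ => c, by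
    rw [Algebra.algebraMap_eq_smul_one]
    exact congrArg _ (funext fun _ => (mul_one c).symm), Eventually.of_forall fun _ => contDiffAt_const⟩

namespace SmoothGerm

variable {q₀ : 𝕜 × 𝕜}

/-- The germ of a function that is smooth near `q₀`. -/
def mk (f : 𝕜 × 𝕜 → 𝕜) (hf : ∀ᶠ q in 𝓝 q₀, ContDiffAt 𝕜 ∞ f q) : SmoothGerm q₀ :=
  ⟨(f : Germ (𝓝 q₀) 𝕜), f, rfl, hf⟩

theorem exists_mk (g : SmoothGerm q₀) : ∃ f hf, g = mk f hf := by
  obtain ⟨_, f, rfl, hf⟩ := g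
  exact ⟨f, hf, rfl⟩

theorem mk_eq_mk {f g : 𝕜 × 𝕜 → 𝕜} {hf : ∀ᶠ q in 𝓝 q₀, ContDiffAt 𝕜 ∞ f q}
    {hg : ∀ᶠ q in 𝓝 q₀, ContDiffAt 𝕜 ∞ g q} : mk f hf = mk g hg ↔ f =ᶠ[𝓝 q₀] g :=
  Subtype.ext_iff.trans Germ.coe_eq

theorem mk_eq_zero {f : 𝕜 × 𝕜 → 𝕜} {hf : ∀ᶠ q in 𝓝 q₀, ContDiffAt 𝕜 ∞ f q} :
    mk f hf = 0 ↔ ∀ᶠ q in 𝓝 q₀, f q = 0 :=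
  Subtype.ext_iff.trans Germ.coe_eq

theorem algebraMap_eq_mk (c : 𝕜) : algebraMap 𝕜 (SmoothGerm q₀) c =
    mk (fun _ => c) (Eventually.of_forall fun _ => contDiffAt_const) := by
  apply Subtype.ext
  change algebraMap 𝕜 (Germ (𝓝 q₀) 𝕜) c = _
  rw [Algebra.algebraMap_eq_smul_one]
  exact congrArg _ (funext fun _ => mul_one c)

theorem eventually_contDiffAt_fderiv {f : 𝕜 × 𝕜 → 𝕜} (hf : ∀ᶠ q in 𝓝 q₀, ContDiffAt 𝕜 ∞ f q)
    (v : 𝕜 × 𝕜) : ∀ᶠ q in 𝓝 q₀, ContDiffAt 𝕜 ∞ (fun r => fderiv 𝕜 f r v) q := by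
  filter_upwards [hf] with q h
  exact (h.fderiv_right (m := ∞) (by simp)).clm_apply contDiffAt_const

/-- Differentiation of germs in the direction `v`. -/
def germDeriv (v : 𝕜 × 𝕜) : Germ (𝓝 q₀) 𝕜 → Germ (𝓝 q₀) 𝕜 :=
  Quotient.map' (fun f q => fderiv 𝕜 f q v) fun f g (h : f =ᶠ[𝓝 q₀] g) => by
    change (fun q => fderiv 𝕜 f q v) =ᶠ[𝓝 q₀] fun q => fderiv 𝕜 g q v
    filter_upwards [h.fderiv (𝕜 := 𝕜)] with q hq
    rw [hq]

/-- Differentiation of smooth germs in the direction `v`. -/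
def dir (v : 𝕜 × 𝕜) : Derivation 𝕜 (SmoothGerm q₀) (SmoothGerm q₀) :=
  Derivation.mk'
    { toFun := fun g => ⟨germDeriv v g, by
        obtain ⟨_, f, rfl, hf⟩ := g
        exact ⟨_, rfl, eventually_contDiffAt_fderiv hf v⟩⟩
      map_add' := by
        rintro ⟨_, f, rfl, hf⟩ ⟨_, g, rfl, hg⟩
        apply Subtype.ext
        apply Germ.coe_eq.2
        filter_upwards [hf, hg] with q h1 h2
        have := (h1.differentiableAt (by simp)).hasFDerivAt.add
          (h2.differentiableAt (by simp)).hasFDerivAt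
        exact congrArg (fun L : 𝕜 × 𝕜 →L[𝕜] 𝕜 => L v) this.fderiv
      map_smul' := by
        rintro c ⟨_, f, rfl, hf⟩
        apply Subtype.ext
        apply Germ.coe_eq.2
        filter_upwards [hf] with q h1
        have := (h1.differentiableAt (by simp)).hasFDerivAt.const_smul c
        exact congrArg (fun L : 𝕜 × 𝕜 →L[𝕜] 𝕜 => L v) this.fderiv }
    (by
      rintro ⟨_, f, rfl, hf⟩ ⟨_, g, rfl, hg⟩
      apply Subtype.ext
      apply Germ.coe_eq.2
      filter_upwards [hf, hg] with q h1 h2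
      have := (h1.differentiableAt (by simp)).hasFDerivAt.mul
          (h2.differentiableAt (by simp)).hasFDerivAt
      exact congrArg (fun L : 𝕜 × 𝕜 →L[𝕜] 𝕜 => L v) this.fderiv)

theorem dir_mk (v : 𝕜 × 𝕜) (f : 𝕜 × 𝕜 → 𝕜) (hf : ∀ᶠ q in 𝓝 q₀, ContDiffAt 𝕜 ∞ f q) :
    dir v (mk f hf) = mk (fun q => fderiv 𝕜 f q v) (eventually_contDiffAt_fderiv hf v) := rfl

theorem fderiv_fderiv_apply {f : 𝕜 × 𝕜 → 𝕜} {q : 𝕜 × 𝕜} (hf : ContDiffAt 𝕜 ∞ f q) (v w : 𝕜 × 𝕜) :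
    fderiv 𝕜 (fun r => fderiv 𝕜 f r v) q w = fderiv 𝕜 (fderiv 𝕜 f) q w v := by
  have h : DifferentiableAt 𝕜 (fderiv 𝕜 f) q :=
    (hf.fderiv_right (m := ∞) (by simp)).differentiableAt (by simp)
  have := (h.hasFDerivAt.clm_apply (hasFDerivAt_const v q)).fderiv
  rw [this]
  simp

theorem dir_comm (v w : 𝕜 × 𝕜) (g : SmoothGerm q₀) : dir v (dir w g) = dir w (dir v g) := by
  obtain ⟨f, hf, rfl⟩ := exists_mk g
  simp only [dir_mk]
  rw [mk_eq_mk]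
  filter_upwards [hf] with q h
  rw [fderiv_fderiv_apply h, fderiv_fderiv_apply h]
  exact (h.isSymmSndFDerivAt (by simpa using WithTop.coe_le_coe.2 (le_top : (2 : ℕ∞) ≤ ⊤))).eq v w

/-- The partial derivative in `x`. -/
abbrev dx : Derivation 𝕜 (SmoothGerm q₀) (SmoothGerm q₀) := dir (1, 0)

/-- The partial derivative in `y`. -/
abbrev dy : Derivation 𝕜 (SmoothGerm q₀) (SmoothGerm q₀) := dir (0, 1)

theorem clm_ext {L M : 𝕜 × 𝕜 →L[𝕜] 𝕜} (h1 : L (1, 0) = M (1, 0)) (h2 : L (0, 1) = M (0, 1)) :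
    L = M := by
  ext <;> simpa

theorem exists_eq_algebraMap {g : SmoothGerm q₀} (h1 : dx g = 0) (h2 : dy g = 0) :
    ∃ c : 𝕜, g = algebraMap 𝕜 (SmoothGerm q₀) c := by
  obtain ⟨f, hf, rfl⟩ := exists_mk g
  rw [dir_mk, mk_eq_zero] at h1 h2
  obtain ⟨ε, hε, h⟩ := Metric.eventually_nhds_iff_ball.1 (hf.and (h1.and h2))
  refine ⟨f q₀, ?_⟩
  rw [algebraMap_eq_mk, mk_eq_mk]
  filter_upwards [Metric.ball_mem_nhds q₀ hε] with q hq
  refine Metric.isOpen_ball.is_const_of_fderiv_eq_zero (𝕜 := 𝕜)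
    (convex_ball (E := 𝕜 × 𝕜) q₀ ε).isPreconnected (fun r hr => ?_) (fun r hr => ?_) hq (Metric.mem_ball_self hε)
  · exact ((h r hr).1.differentiableAt (by simp)).differentiableWithinAt
  · exact clm_ext (by simpa using (h r hr).2.1) (by simpa using (h r hr).2.2)

/-- The Poincaré lemma on a small ball. It recovers functions from the derivatives stored in a
frame. -/
theorem exists_primitive {a b : SmoothGerm q₀} (h : dy a = dx b) :
    ∃ g : SmoothGerm q₀, dx g = a ∧ dy g = b := by
  obtain ⟨f, hf, rfl⟩ := exists_mk a
  obtain ⟨g, hg, rfl⟩ := exists_mk b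
  rw [dir_mk, dir_mk, mk_eq_mk] at h
  obtain ⟨ε, hε, H⟩ := Metric.eventually_nhds_iff_ball.1 (hf.and (hg.and h))
  let α : 𝕜 × 𝕜 → 𝕜 × 𝕜 →L[𝕜] 𝕜 := fun q =>
    f q • ContinuousLinearMap.fst 𝕜 𝕜 𝕜 + g q • ContinuousLinearMap.snd 𝕜 𝕜 𝕜
  have hαs : ∀ q ∈ Metric.ball q₀ ε, ContDiffAt 𝕜 ∞ α q := fun q hq =>
    ((H q hq).1.smul contDiffAt_const).add ((H q hq).2.1.smul contDiffAt_const)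
  have hα' : ∀ q ∈ Metric.ball q₀ ε, ∀ u v, fderiv 𝕜 α q u v =
      fderiv 𝕜 f q u * v.1 + fderiv 𝕜 g q u * v.2 := by
    intro q hq u v
    have h1 := ((H q hq).1.differentiableAt (by simp)).hasFDerivAt.smul_const
      (ContinuousLinearMap.fst 𝕜 𝕜 𝕜)
    have h2 := ((H q hq).2.1.differentiableAt (by simp)).hasFDerivAt.smul_const
      (ContinuousLinearMap.snd 𝕜 𝕜 𝕜)
    have := (h1.add h2).fderiv
    have h3 : fderiv 𝕜 α q = _ := this
    rw [h3]
    simp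
  have hsplit : ∀ (L : 𝕜 × 𝕜 →L[𝕜] 𝕜) (u : 𝕜 × 𝕜), L u = u.1 * L (1, 0) + u.2 * L (0, 1) := by
    intro L u
    have : u = u.1 • ((1, 0) : 𝕜 × 𝕜) + u.2 • ((0, 1) : 𝕜 × 𝕜) := by ext <;> simp
    conv_lhs => rw [this]
    rw [map_add, map_smul, map_smul, smul_eq_mul, smul_eq_mul]
  have hsym : ∀ q ∈ Metric.ball q₀ ε, ∀ u v, fderiv 𝕜 α q u v = fderiv 𝕜 α q v u := by
    intro q hq u v
    have e : fderiv 𝕜 f q (0, 1) = fderiv 𝕜 g q (1, 0) := (H q hq).2.2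
    rw [hα' q hq, hα' q hq, hsplit (fderiv 𝕜 f q) u, hsplit (fderiv 𝕜 f q) v,
      hsplit (fderiv 𝕜 g q) u, hsplit (fderiv 𝕜 g q) v, e]
    ring
  -- The Poincaré lemma is applied to the form over `ℝ`. Its values are restrictions of `𝕜`-linear
  -- maps, so the real primitive is differentiable over `𝕜`.
  obtain ⟨F, hF⟩ : ∃ F : 𝕜 × 𝕜 → 𝕜, ∀ q ∈ Metric.ball q₀ ε, HasFDerivAt F (α q) q := by
    let β : 𝕜 × 𝕜 → 𝕜 × 𝕜 →L[ℝ] 𝕜 := fun q =>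
      f q • (ContinuousLinearMap.fst 𝕜 𝕜 𝕜).restrictScalars ℝ +
        g q • (ContinuousLinearMap.snd 𝕜 𝕜 𝕜).restrictScalars ℝ
    have hr : ∀ q ∈ Metric.ball q₀ ε, HasFDerivAt β
        ((((fderiv 𝕜 f q).restrictScalars ℝ).smulRight
            ((ContinuousLinearMap.fst 𝕜 𝕜 𝕜).restrictScalars ℝ)) +
          (((fderiv 𝕜 g q).restrictScalars ℝ).smulRight
            ((ContinuousLinearMap.snd 𝕜 𝕜 𝕜).restrictScalars ℝ))) q := by
      intro q hq
      exact ((((H q hq).1.differentiableAt (by simp)).hasFDerivAt.restrictScalars ℝ).smul_const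
        ((ContinuousLinearMap.fst 𝕜 𝕜 𝕜).restrictScalars ℝ)).add
        ((((H q hq).2.1.differentiableAt (by simp)).hasFDerivAt.restrictScalars ℝ).smul_const
        ((ContinuousLinearMap.snd 𝕜 𝕜 𝕜).restrictScalars ℝ))
    have hd : DifferentiableOn ℝ β (Metric.ball q₀ ε) :=
      fun q hq => (hr q hq).differentiableAt.differentiableWithinAt
    obtain ⟨F, hF⟩ := (convex_ball q₀ ε).exists_forall_hasFDerivAt_of_fderiv_symmetric
      Metric.isOpen_ball hd
      (fun q hq u v => by
        rw [(hr q hq).fderiv]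
        exact (hα' q hq u v).symm.trans ((hsym q hq u v).trans (hα' q hq v u)))
    exact ⟨F, fun q hq => hasFDerivAt_of_restrictScalars ℝ (hF q hq) rfl⟩
  have hFs : ∀ᶠ q in 𝓝 q₀, ContDiffAt 𝕜 ∞ F q := by
    have : ContDiffOn 𝕜 ∞ F (Metric.ball q₀ ε) := by
      rw [contDiffOn_infty_iff_fderiv_of_isOpen Metric.isOpen_ball]
      refine ⟨fun q hq => (hF q hq).differentiableAt.differentiableWithinAt, ?_⟩
      intro q hq
      exact ((hαs q hq).contDiffWithinAt).congr (fun r hr => (hF r hr).fderiv) (hF q hq).fderiv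
    filter_upwards [Metric.ball_mem_nhds q₀ hε] with q hq
    exact this.contDiffAt (Metric.isOpen_ball.mem_nhds hq)
  refine ⟨mk F hFs, ?_, ?_⟩ <;> rw [dir_mk, mk_eq_mk] <;>
    filter_upwards [Metric.ball_mem_nhds q₀ hε] with q hq <;> rw [(hF q hq).fderiv] <;> simp [α]

theorem isUnit_mk {f : 𝕜 × 𝕜 → 𝕜} {hf : ∀ᶠ q in 𝓝 q₀, ContDiffAt 𝕜 ∞ f q} (h0 : f q₀ ≠ 0) :
    IsUnit (mk f hf) := by
  have hc : ∀ᶠ q in 𝓝 q₀, f q ≠ 0 := hf.self_of_nhds.continuousAt.eventually_ne h0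
  refine IsUnit.of_mul_eq_one (mk (fun q => (f q)⁻¹)
    (by filter_upwards [hf, hc] with q h1 h2 using h1.inv h2)) ?_
  apply Subtype.ext
  apply Germ.coe_eq.2
  filter_upwards [hc] with q h using mul_inv_cancel₀ h

/-- Exponentials of primitives replace `y ^ (-1/2)` and `(y (y - 1) (y - x)) ^ (-1/2)`: no branch
has to be chosen, and over `ℝ` the radicand may be negative. -/
theorem exists_exp (g : SmoothGerm q₀) : ∃ e : SmoothGerm q₀, IsUnit e ∧ ∀ v, dir v e = e * dir v g := by
  obtain ⟨f, hf, rfl⟩ := exists_mk g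
  have hexp : ∀ z : 𝕜, ContDiffAt 𝕜 ∞ (NormedSpace.exp : 𝕜 → 𝕜) z := fun z =>
    (NormedSpace.exp_analytic z).contDiffAt
  refine ⟨mk (fun q => NormedSpace.exp (f q)) ?_, isUnit_mk (NormedSpace.isUnit_exp _).ne_zero, ?_⟩
  · filter_upwards [hf] with q h using (hexp _).comp q h
  · intro v
    apply Subtype.ext
    apply Germ.coe_eq.2
    filter_upwards [hf] with q h
    have := (hasDerivAt_exp (x := f q)).comp_hasFDerivAt q (h.differentiableAt (by simp)).hasFDerivAt
    exact congrArg (fun L : 𝕜 × 𝕜 →L[𝕜] 𝕜 => L v) this.fderiv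

/-- The germ of the coordinate `x`. -/
def x : SmoothGerm q₀ := mk (fun q => q.1) (Eventually.of_forall fun _ => contDiffAt_fst)

/-- The germ of the coordinate `y`. -/
def y : SmoothGerm q₀ := mk (fun q => q.2) (Eventually.of_forall fun _ => contDiffAt_snd)

theorem dx_x : dx (x : SmoothGerm q₀) = 1 := by
  apply Subtype.ext
  apply Germ.coe_eq.2
  filter_upwards with q
  simp [fderiv_fst]

theorem dy_x : dy (x : SmoothGerm q₀) = 0 := by
  apply Subtype.ext
  apply Germ.coe_eq.2
  filter_upwards with q
  simp [fderiv_fst]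

theorem dx_y : dx (y : SmoothGerm q₀) = 0 := by
  apply Subtype.ext
  apply Germ.coe_eq.2
  filter_upwards with q
  simp [fderiv_snd]

theorem dy_y : dy (y : SmoothGerm q₀) = 1 := by
  apply Subtype.ext
  apply Germ.coe_eq.2
  filter_upwards with q
  simp [fderiv_snd]

end SmoothGerm

/-! ### Lie's condition and the determining equations -/

theorem fderiv_apply_eq (g : 𝕜 × 𝕜 → 𝕜) (q u : 𝕜 × 𝕜) :
    fderiv 𝕜 g q u = u.1 * fderiv 𝕜 g q (1, 0) + u.2 * fderiv 𝕜 g q (0, 1) := by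
  have : u = u.1 • ((1, 0) : 𝕜 × 𝕜) + u.2 • ((0, 1) : 𝕜 × 𝕜) := by ext <;> simp
  conv_lhs => rw [this]
  rw [map_add, map_smul, map_smul, smul_eq_mul, smul_eq_mul]

theorem fderiv_quadratic {a b c : 𝕜 × 𝕜 → 𝕜} {q : 𝕜 × 𝕜} (ha : DifferentiableAt 𝕜 a q)
    (hb : DifferentiableAt 𝕜 b q) (hc : DifferentiableAt 𝕜 c q) (p : 𝕜) (u : 𝕜 × 𝕜) (s : 𝕜) :
    fderiv 𝕜 (fun j : (𝕜 × 𝕜) × 𝕜 => a j.1 * j.2 ^ 2 + b j.1 * j.2 + c j.1) (q, p) (u, s) =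
      fderiv 𝕜 a q u * p ^ 2 + fderiv 𝕜 b q u * p + fderiv 𝕜 c q u +
        (2 * a q * p + b q) * s := by
  have key : ∀ {g : 𝕜 × 𝕜 → 𝕜}, DifferentiableAt 𝕜 g q →
      HasFDerivAt (fun j : (𝕜 × 𝕜) × 𝕜 => g j.1)
        ((fderiv 𝕜 g q).comp (ContinuousLinearMap.fst 𝕜 (𝕜 × 𝕜) 𝕜)) (q, p) := fun hg =>
    HasFDerivAt.comp (q, p) hg.hasFDerivAt hasFDerivAt_fst
  have hp : HasFDerivAt (fun j : (𝕜 × 𝕜) × 𝕜 => j.2) (ContinuousLinearMap.snd 𝕜 (𝕜 × 𝕜) 𝕜) (q, p) :=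
    hasFDerivAt_snd
  have h := (((key ha).mul (hp.pow 2)).add ((key hb).mul hp)).add (key hc)
  have h2 : fderiv 𝕜 (fun j : (𝕜 × 𝕜) × 𝕜 => a j.1 * j.2 ^ 2 + b j.1 * j.2 + c j.1) (q, p) = _ :=
    h.fderiv
  rw [h2]
  simp
  ring

/-- Four values of `p` determine a cubic; this splits Lie's condition into its coefficients. -/
theorem cubic_eq_zero_iff {a b c d : 𝕜} :
    (∀ p : 𝕜, a * p ^ 3 + b * p ^ 2 + c * p + d = 0) ↔ a = 0 ∧ b = 0 ∧ c = 0 ∧ d = 0 := by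
  refine ⟨fun h => ?_, ?_⟩
  · have h0 := h 0
    have h1 := h 1
    have h2 := h (-1)
    have h3 := h 2
    have hd : d = 0 := by linear_combination h0
    have hb : b = 0 := by linear_combination (1 / 2) * h1 + (1 / 2) * h2 - h0
    have ha : a = 0 := by
      linear_combination (1 / 6) * h3 - (1 / 3) * h1 - (1 / 3) * hb + (1 / 6) * hd
    exact ⟨ha, hb, by linear_combination h1 - ha - hb - hd, hd⟩
  · rintro ⟨rfl, rfl, rfl, rfl⟩ p
    ring

theorem prolongOne_eq (V : 𝕜 × 𝕜 → 𝕜 × 𝕜) (q : 𝕜 × 𝕜) (p : 𝕜) :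
    prolongOne V q p = -fderiv 𝕜 (fun r => (V r).1) q (0, 1) * p ^ 2 +
      (fderiv 𝕜 (fun r => (V r).2) q (0, 1) - fderiv 𝕜 (fun r => (V r).1) q (1, 0)) * p +
      fderiv 𝕜 (fun r => (V r).2) q (1, 0) := by
  unfold prolongOne totalDeriv
  rw [fderiv_apply_eq _ q (1, p), fderiv_apply_eq (fun r => (V r).1) q (1, p)]
  ring

/-- The determining equations of the point symmetries `ξ ∂/∂x + η ∂/∂y` of
`y'' = B y'² + C y' + D`, in a ring of functions with the partial derivatives `dx` and `dy`. -/
structure Determining {R : Type*} [CommRing R] [Algebra 𝕜 R] (dx dy : Derivation 𝕜 R R)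
    (B C D ξ η : R) : Prop where
  cube : dy (dy ξ) + B * dy ξ = 0
  square : dy (dy η) - 2 * dx (dy ξ) - B * dy η - 2 * C * dy ξ - ξ * dx B - η * dy B = 0
  linear : 2 * dx (dy η) - dx (dx ξ) - C * dx ξ - 3 * D * dy ξ - ξ * dx C - η * dy C
    - 2 * B * dx η = 0
  const : dx (dx η) + (dy η - 2 * dx ξ) * D - ξ * dx D - η * dy D - C * dx η = 0

namespace SmoothGerm

variable {q₀ : 𝕜 × 𝕜}

/-- The vector field germ with given components. -/
def pair : SmoothGerm q₀ × SmoothGerm q₀ →ₗ[𝕜] Germ (𝓝 q₀) (𝕜 × 𝕜) where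
  toFun g := Germ.map₂ Prod.mk g.1.1 g.2.1
  map_add' := by
    rintro ⟨⟨_, f, rfl, _⟩, ⟨_, g, rfl, _⟩⟩ ⟨⟨_, f', rfl, _⟩, ⟨_, g', rfl, _⟩⟩
    rfl
  map_smul' := by
    rintro c ⟨⟨_, f, rfl, _⟩, ⟨_, g, rfl, _⟩⟩
    rfl

theorem pair_injective : Function.Injective (pair : SmoothGerm q₀ × SmoothGerm q₀ →ₗ[𝕜] _) := by
  rintro ⟨⟨_, f, rfl, _⟩, ⟨_, g, rfl, _⟩⟩ ⟨⟨_, f', rfl, _⟩, ⟨_, g', rfl, _⟩⟩ h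
  have h' : (fun q => (f q, g q)) =ᶠ[𝓝 q₀] fun q => (f' q, g' q) := Germ.coe_eq.1 h
  refine Prod.ext (Subtype.ext (Germ.coe_eq.2 ?_)) (Subtype.ext (Germ.coe_eq.2 ?_))
  · filter_upwards [h'] with q hq using congrArg Prod.fst hq
  · filter_upwards [h'] with q hq using congrArg Prod.snd hq

theorem isSymmetryAt_iff {f : 𝕜 → 𝕜 → 𝕜 → 𝕜} {B C D : 𝕜 × 𝕜 → 𝕜} {V : 𝕜 × 𝕜 → 𝕜 × 𝕜} {q : 𝕜 × 𝕜}
    (hB : ContDiffAt 𝕜 ∞ B q) (hC : ContDiffAt 𝕜 ∞ C q) (hD : ContDiffAt 𝕜 ∞ D q)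
    (hV : ContDiffAt 𝕜 ∞ V q)
    (h : ∀ᶠ r in 𝓝 q, ∀ p, f r.1 r.2 p = B r * p ^ 2 + C r * p + D r)
    {ξ η : 𝕜 × 𝕜 → 𝕜} (hξ : ξ = fun r => (V r).1) (hη : η = fun r => (V r).2) :
    IsSymmetryAt f V q ↔
      (fderiv 𝕜 (fun r => fderiv 𝕜 ξ r (0, 1)) q (0, 1) + B q * fderiv 𝕜 ξ q (0, 1) = 0) ∧
      (fderiv 𝕜 (fun r => fderiv 𝕜 η r (0, 1)) q (0, 1)
        - 2 * fderiv 𝕜 (fun r => fderiv 𝕜 ξ r (0, 1)) q (1, 0) - B q * fderiv 𝕜 η q (0, 1)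
        - 2 * C q * fderiv 𝕜 ξ q (0, 1) - ξ q * fderiv 𝕜 B q (1, 0) - η q * fderiv 𝕜 B q (0, 1) = 0) ∧
      (2 * fderiv 𝕜 (fun r => fderiv 𝕜 η r (0, 1)) q (1, 0)
        - fderiv 𝕜 (fun r => fderiv 𝕜 ξ r (1, 0)) q (1, 0) - C q * fderiv 𝕜 ξ q (1, 0)
        - 3 * D q * fderiv 𝕜 ξ q (0, 1) - ξ q * fderiv 𝕜 C q (1, 0) - η q * fderiv 𝕜 C q (0, 1)
        - 2 * B q * fderiv 𝕜 η q (1, 0) = 0) ∧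
      (fderiv 𝕜 (fun r => fderiv 𝕜 η r (1, 0)) q (1, 0)
        + (fderiv 𝕜 η q (0, 1) - 2 * fderiv 𝕜 ξ q (1, 0)) * D q
        - ξ q * fderiv 𝕜 D q (1, 0) - η q * fderiv 𝕜 D q (0, 1) - C q * fderiv 𝕜 η q (1, 0) = 0) := by
  subst hξ hη
  set ξ : 𝕜 × 𝕜 → 𝕜 := fun r => (V r).1 with hξ
  set η : 𝕜 × 𝕜 → 𝕜 := fun r => (V r).2 with hη
  have sξ : ContDiffAt 𝕜 ∞ ξ q := hV.fst
  have sη : ContDiffAt 𝕜 ∞ η q := hV.snd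
  have hd : ∀ {g : 𝕜 × 𝕜 → 𝕜}, ContDiffAt 𝕜 ∞ g q → ∀ v : 𝕜 × 𝕜,
      DifferentiableAt 𝕜 (fun r => fderiv 𝕜 g r v) q := fun hg v =>
    ((hg.fderiv_right (m := ∞) (by simp)).clm_apply contDiffAt_const).differentiableAt (by simp)
  have hcomm : ∀ {g : 𝕜 × 𝕜 → 𝕜}, ContDiffAt 𝕜 ∞ g q → ∀ v w : 𝕜 × 𝕜,
      fderiv 𝕜 (fun r => fderiv 𝕜 g r v) q w = fderiv 𝕜 (fun r => fderiv 𝕜 g r w) q v := by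
    intro g hg v w
    rw [fderiv_fderiv_apply hg, fderiv_fderiv_apply hg]
    exact (hg.isSymmSndFDerivAt
      (by simpa using WithTop.coe_le_coe.2 (le_top : (2 : ℕ∞) ≤ ⊤))).eq w v
  have e1 : ∀ p s : 𝕜, ∀ u : 𝕜 × 𝕜,
      fderiv 𝕜 (fun j : (𝕜 × 𝕜) × 𝕜 => prolongOne V j.1 j.2) (q, p) (u, s) =
        -fderiv 𝕜 (fun r => fderiv 𝕜 ξ r (0, 1)) q u * p ^ 2 +
        (fderiv 𝕜 (fun r => fderiv 𝕜 η r (0, 1)) q u -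
          fderiv 𝕜 (fun r => fderiv 𝕜 ξ r (1, 0)) q u) * p +
        fderiv 𝕜 (fun r => fderiv 𝕜 η r (1, 0)) q u +
        (-2 * fderiv 𝕜 ξ q (0, 1) * p + (fderiv 𝕜 η q (0, 1) - fderiv 𝕜 ξ q (1, 0))) * s := by
    intro p s u
    have := fderiv_quadratic (a := fun r => -fderiv 𝕜 ξ r (0, 1))
      (b := fun r => fderiv 𝕜 η r (0, 1) - fderiv 𝕜 ξ r (1, 0))
      (c := fun r => fderiv 𝕜 η r (1, 0)) (hd sξ _).neg ((hd sη _).sub (hd sξ _)) (hd sη _) p u s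
    simp only [prolongOne_eq]
    rw [this, fderiv_fun_neg, fderiv_fun_sub (hd sη _) (hd sξ _)]
    simp only [neg_apply, sub_apply]
    ring
  have e2 : ∀ p s : 𝕜, ∀ u : 𝕜 × 𝕜,
      fderiv 𝕜 (fun j : (𝕜 × 𝕜) × 𝕜 => f j.1.1 j.1.2 j.2) (q, p) (u, s) =
        fderiv 𝕜 B q u * p ^ 2 + fderiv 𝕜 C q u * p + fderiv 𝕜 D q u + (2 * B q * p + C q) * s := by
    intro p s u
    rw [← fderiv_quadratic (hB.differentiableAt (by simp)) (hC.differentiableAt (by simp))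
      (hD.differentiableAt (by simp))]
    have : (fun j : (𝕜 × 𝕜) × 𝕜 => f j.1.1 j.1.2 j.2) =ᶠ[𝓝 (q, p)]
        fun j => B j.1 * j.2 ^ 2 + C j.1 * j.2 + D j.1 := by
      have ht : Tendsto (Prod.fst : (𝕜 × 𝕜) × 𝕜 → 𝕜 × 𝕜) (𝓝 (q, p)) (𝓝 q) :=
        continuous_fst.tendsto (q, p)
      filter_upwards [ht.eventually h] with j hj using hj j.2
    rw [this.fderiv_eq]
  have c1 := hcomm sξ (1, 0) (0, 1)
  have c2 := hcomm sη (1, 0) (0, 1)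
  have hf := h.self_of_nhds
  -- The coefficient of `p ^ 3` in Lie's condition is `-(ξ_yy + B ξ_y)`, hence the change of sign
  -- before the four equations are read as one cubic.
  rw [← neg_eq_zero (a := fderiv 𝕜 (fun r => fderiv 𝕜 ξ r (0, 1)) q (0, 1) + _),
    ← cubic_eq_zero_iff]
  unfold IsSymmetryAt prolongTwo totalDerivTwo totalDeriv
  refine forall_congr' fun p => ?_
  rw [e1, e2, ← sub_eq_zero, prolongOne_eq, hf]
  rw [fderiv_apply_eq (fun r => fderiv 𝕜 ξ r (0, 1)) q (1, p),
    fderiv_apply_eq (fun r => fderiv 𝕜 ξ r (1, 0)) q (1, p),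
    fderiv_apply_eq (fun r => fderiv 𝕜 η r (0, 1)) q (1, p),
    fderiv_apply_eq (fun r => fderiv 𝕜 η r (1, 0)) q (1, p),
    fderiv_apply_eq (fun r => (V r).1) q (1, p),
    fderiv_apply_eq B q (V q), fderiv_apply_eq C q (V q), fderiv_apply_eq D q (V q), c1, c2,
    ← hξ, ← hη]
  have hV1 : (V q).1 = ξ q := rfl
  have hV2 : (V q).2 = η q := rfl
  rw [hV1, hV2]
  dsimp only
  refine Eq.congr ?_ rfl
  ring

/-- `f` is the quadratic polynomial in `p` with coefficients `B`, `C`, `D`. -/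
def IsQuadratic (f : 𝕜 → 𝕜 → 𝕜 → 𝕜) (B C D : SmoothGerm q₀) : Prop :=
  ∃ B' C' D' : 𝕜 × 𝕜 → 𝕜, (B' : Germ (𝓝 q₀) 𝕜) = B ∧ (C' : Germ (𝓝 q₀) 𝕜) = C ∧
    (D' : Germ (𝓝 q₀) 𝕜) = D ∧ ∀ᶠ q in 𝓝 q₀, ∀ p, f q.1 q.2 p = B' q * p ^ 2 + C' q * p + D' q

theorem eventually_contDiffAt {f : 𝕜 × 𝕜 → 𝕜} {g : SmoothGerm q₀} (h : (f : Germ (𝓝 q₀) 𝕜) = g) :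
    ∀ᶠ q in 𝓝 q₀, ContDiffAt 𝕜 ∞ f q := by
  obtain ⟨_, f', rfl, hf'⟩ := g
  filter_upwards [hf', (Germ.coe_eq.1 h).eventually_nhds] with q h1 h2 using h1.congr_of_eventuallyEq h2

/-- Identities at all points near `q₀` are equalities of germs, so from here on the symmetry problem
is algebra in `SmoothGerm q₀`. -/
theorem mem_symmetryAlgebra_iff {f : 𝕜 → 𝕜 → 𝕜 → 𝕜} {B C D : SmoothGerm q₀}
    (h : IsQuadratic f B C D) (g : Germ (𝓝 q₀) (𝕜 × 𝕜)) :
    g ∈ symmetryAlgebra f q₀ ↔ ∃ ξ η : SmoothGerm q₀, Determining dx dy B C D ξ η ∧ pair (ξ, η) = g := by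
  obtain ⟨B', C', D', eB, eC, eD, hf⟩ := h
  have hB := eventually_contDiffAt eB
  have hC := eventually_contDiffAt eC
  have hD := eventually_contDiffAt eD
  obtain rfl : mk B' hB = B := Subtype.ext eB
  obtain rfl : mk C' hC = C := Subtype.ext eC
  obtain rfl : mk D' hD = D := Subtype.ext eD
  have key : ∀ {ξ η : 𝕜 × 𝕜 → 𝕜} (hξ : ∀ᶠ q in 𝓝 q₀, ContDiffAt 𝕜 ∞ ξ q)
      (hη : ∀ᶠ q in 𝓝 q₀, ContDiffAt 𝕜 ∞ η q),
      Determining dx dy (mk B' hB) (mk C' hC) (mk D' hD) (mk ξ hξ) (mk η hη) ↔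
        ∀ᶠ q in 𝓝 q₀, IsSymmetryAt f (fun q => (ξ q, η q)) q := by
    intro ξ η hξ hη
    have hall := hB.and (hC.and (hD.and (hξ.and (hη.and hf.eventually_nhds))))
    have : (∀ᶠ q in 𝓝 q₀, IsSymmetryAt f (fun q => (ξ q, η q)) q) ↔ _ :=
      eventually_congr (hall.mono fun q hq => isSymmetryAt_iff hq.1 hq.2.1 hq.2.2.1
        (hq.2.2.2.1.prodMk hq.2.2.2.2.1) hq.2.2.2.2.2 rfl rfl)
    rw [this, eventually_and, eventually_and, eventually_and]
    constructor
    · rintro ⟨h1, h2, h3, h4⟩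
      exact ⟨Germ.coe_eq.1 (congrArg Subtype.val h1), Germ.coe_eq.1 (congrArg Subtype.val h2),
        Germ.coe_eq.1 (congrArg Subtype.val h3), Germ.coe_eq.1 (congrArg Subtype.val h4)⟩
    · rintro ⟨h1, h2, h3, h4⟩
      exact ⟨Subtype.ext (Germ.coe_eq.2 h1), Subtype.ext (Germ.coe_eq.2 h2),
        Subtype.ext (Germ.coe_eq.2 h3), Subtype.ext (Germ.coe_eq.2 h4)⟩
  constructor
  · rintro ⟨V, rfl, hV⟩
    have h1 : ∀ᶠ q in 𝓝 q₀, ContDiffAt 𝕜 ∞ (fun r => (V r).1) q := hV.mono fun q h => h.1.fst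
    have h2 : ∀ᶠ q in 𝓝 q₀, ContDiffAt 𝕜 ∞ (fun r => (V r).2) q := hV.mono fun q h => h.1.snd
    exact ⟨mk _ h1, mk _ h2, (key h1 h2).2 (hV.mono fun q h => h.2), rfl⟩
  · rintro ⟨ξ, η, hdet, rfl⟩
    obtain ⟨ξ, hξ, rfl⟩ := exists_mk ξ
    obtain ⟨η, hη, rfl⟩ := exists_mk η
    refine ⟨fun q => (ξ q, η q), rfl, ?_⟩
    filter_upwards [hξ, hη, (key hξ hη).1 hdet] with q h1 h2 h3 using ⟨h1.prodMk h2, h3⟩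

end SmoothGerm

/-! ### Change of variables to `U'' = F(T, U)` -/

section

variable {R : Type*} [CommRing R] [Algebra 𝕜 R]

theorem deriv_two (d : Derivation 𝕜 R R) : d 2 = 0 := by
  exact_mod_cast d.map_natCast 2

theorem deriv_inv {d : Derivation 𝕜 R R} {a b c : R} (h : b * a = 1) (h2 : d a = c * a) :
    d b = -(c * b) := by
  have h3 := congrArg d h
  rw [Derivation.leibniz, h2, Derivation.map_one_eq_zero, smul_eq_mul, smul_eq_mul] at h3
  linear_combination b * h3 - (c * b + d b) * h

end

/-- The determining equations of the point symmetries `A ∂/∂T + E ∂/∂U` of `U'' = F(T, U)`, with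
`X = ∂/∂T` and `Y = ∂/∂U`. -/
structure Flat {R : Type*} [CommRing R] [Algebra 𝕜 R] (X Y : Derivation 𝕜 R R)
    (F A E : R) : Prop where
  cube : Y (Y A) = 0
  square : Y (Y E) = 2 * X (Y A)
  linear : 2 * X (Y E) = X (X A) + 3 * F * Y A
  const : X (X E) + (Y E - 2 * X A) * F = A * X F + E * Y F

/-- A change of variables `T = T(x)`, `U = U(x, y)` that takes `y'' = B y'² + C y' + D` to
`U'' = F(T, U)`, given by the derivatives `τ = T_x`, `v = U_x`, `w = U_y` and the inverses `ρ`, `σ`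
of `τ` and `w`. -/
structure Frame {R : Type*} [CommRing R] [Algebra 𝕜 R] (dx dy : Derivation 𝕜 R R)
    (B C D F : R) where
  (τ ρ w σ v κ : R)
  mul_τ : ρ * τ = 1
  mul_w : σ * w = 1
  dx_τ : dx τ = κ * τ
  dy_τ : dy τ = 0
  closed : dx w = dy v
  -- With `κ = T_xx / T_x`, the last three fields are the coefficients of `p ^ 2`, `p` and `1` in
  -- the identity `d²U/dT² = F` along `y'' = B p ^ 2 + C p + D`.
  dy_w : dy w = -(w * B)
  dy_v : 2 * dy v = κ * w - w * C
  dx_v : dx v = κ * v - w * D + τ ^ 2 * F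

namespace Frame

variable {R : Type*} [CommRing R] [Algebra 𝕜 R] {dx dy : Derivation 𝕜 R R} {B C D F : R}
  (φ : Frame dx dy B C D F)

/-- The derivation `∂/∂T`. -/
def X : Derivation 𝕜 R R := φ.ρ • (dx - (φ.v * φ.σ) • dy)

/-- The derivation `∂/∂U`. -/
def Y : Derivation 𝕜 R R := φ.σ • dy

theorem X_apply (g : R) : φ.X g = φ.ρ * (dx g - φ.v * φ.σ * dy g) := rfl

theorem Y_apply (g : R) : φ.Y g = φ.σ * dy g := rfl

theorem dy_κ (hc : ∀ g, dy (dx g) = dx (dy g)) : dy φ.κ = 0 := by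
  have h := hc φ.τ
  rw [φ.dx_τ, φ.dy_τ, map_zero, Derivation.leibniz, φ.dy_τ, smul_zero, zero_add, smul_eq_mul] at h
  linear_combination φ.ρ * h - dy φ.κ * φ.mul_τ

/-- `X` and `Y` are dual to the closed forms `dT = τ dx` and `dU = v dx + w dy`, hence commute. -/
theorem XY_comm (hc : ∀ g, dy (dx g) = dx (dy g)) (g : R) : φ.X (φ.Y g) = φ.Y (φ.X g) := by
  have h1 : dx φ.σ = -(φ.σ * dx φ.w * φ.σ) :=
    deriv_inv φ.mul_w (by linear_combination -dx φ.w * φ.mul_w)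
  have h2 : dy φ.σ = -(-B * φ.σ) := deriv_inv φ.mul_w (by rw [φ.dy_w]; ring)
  have h3 : dy φ.ρ = -(0 * φ.ρ) := deriv_inv φ.mul_τ (by rw [φ.dy_τ]; ring)
  simp only [X_apply, Y_apply, map_sub, Derivation.leibniz, smul_eq_mul, h1, h2, h3, hc, φ.closed]
  ring

/-- Both systems are the coefficients of the same cubic, in `p` on one side and in `p + m` with `m =
v / w` on the other, because the new slope is `dU/dT = (w / τ) (p + m)`. The passage between them is
therefore triangular, up to invertible factors. -/
theorem determining_iff_flat (hc : ∀ g, dy (dx g) = dx (dy g)) (ξ η : R) :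
    Determining dx dy B C D ξ η ↔ Flat φ.X φ.Y F (φ.τ * ξ) (φ.v * ξ + φ.w * η) := by
  -- In terms of `l = w_x / w`, `m = v / w` and `G = τ² F / w` the coefficients are polynomial: `C =
  -- κ - 2 l` and `D = κ m - m l - m_x + G`.
  obtain ⟨l, hl⟩ : ∃ l, l = φ.σ * dx φ.w := ⟨_, rfl⟩
  obtain ⟨m, hm⟩ : ∃ m, m = φ.v * φ.σ := ⟨_, rfl⟩
  obtain ⟨G, hG⟩ : ∃ G, G = φ.τ ^ 2 * F * φ.σ := ⟨_, rfl⟩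
  have hv : φ.v = m * φ.w := by linear_combination -φ.v * φ.mul_w - φ.w * hm
  have hF : F = φ.ρ ^ 2 * φ.w * G := by
    linear_combination -(φ.ρ ^ 2 * φ.w) * hG - φ.ρ ^ 2 * φ.τ ^ 2 * F * φ.mul_w
      - F * (φ.ρ * φ.τ + 1) * φ.mul_τ
  have w_x : dx φ.w = l * φ.w := by linear_combination -φ.w * hl - dx φ.w * φ.mul_w
  have w_y := φ.dy_w
  have κ_y := φ.dy_κ hc
  have τ_x := φ.dx_τ
  have τ_y := φ.dy_τ
  have σ_y : dy φ.σ = -(-B * φ.σ) := deriv_inv φ.mul_w (by rw [w_y]; ring)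
  have ρ_x := deriv_inv φ.mul_τ τ_x
  have ρ_y : dy φ.ρ = 0 := (deriv_inv (c := 0) φ.mul_τ (by rw [τ_y]; ring)).trans (by ring)
  have v_y := φ.closed
  rw [hv, w_x, Derivation.leibniz, w_y, smul_eq_mul, smul_eq_mul] at v_y
  have m_y : dy m = l + m * B := by
    linear_combination -φ.σ * v_y + (l + m * B - dy m) * φ.mul_w
  have hC : C = φ.κ - 2 * l := by
    have h := φ.dy_v
    rw [← φ.closed, w_x] at h
    linear_combination φ.σ * h + (φ.κ - 2 * l - C) * φ.mul_w
  have hD : D = φ.κ * m - m * l - dx m + G := by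
    have h := φ.dx_v
    rw [hv, Derivation.leibniz, w_x, smul_eq_mul, smul_eq_mul] at h
    linear_combination φ.σ * h - hG + (m * φ.κ - m * l - dx m - D) * φ.mul_w
  have l_y : dy l = -dx B := by
    have h := hc φ.w
    rw [w_x, w_y, map_neg, Derivation.leibniz, Derivation.leibniz, w_x, w_y, smul_eq_mul,
      smul_eq_mul, smul_eq_mul, smul_eq_mul] at h
    linear_combination φ.σ * h - (dy l + dx B) * φ.mul_w
  have hX : ∀ g, φ.X g = φ.ρ * (dx g - m * dy g) := fun g => by rw [hm]; rfl
  have hY : ∀ g, φ.Y g = φ.σ * dy g := fun g => rfl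
  have hXY := φ.XY_comm hc
  have hρτ := φ.mul_τ
  have hσw := φ.mul_w
  rw [hv, show m * φ.w * ξ + φ.w * η = φ.w * (η + m * ξ) by ring]
  generalize φ.ρ = ρ, φ.τ = τ, φ.σ = σ, φ.w = w, φ.κ = κ, φ.X = X, φ.Y = Y at *
  clear hv hl hm hG
  have XA : X (τ * ξ) = κ * ξ + dx ξ - m * dy ξ := by
    simp only [hX, Derivation.leibniz, smul_eq_mul, τ_x, τ_y]
    linear_combination (κ * ξ + dx ξ - m * dy ξ) * hρτ
  have YA : Y (τ * ξ) = σ * τ * dy ξ := by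
    simp only [hY, Derivation.leibniz, smul_eq_mul, τ_y]
    ring
  have YE : Y (w * (η + m * ξ)) = dy (η + m * ξ) - B * (η + m * ξ) := by
    simp only [hY, Derivation.leibniz, smul_eq_mul, w_y]
    linear_combination (dy (η + m * ξ) - B * (η + m * ξ)) * hσw
  have XE : X (w * (η + m * ξ)) = ρ * w * (dx (η + m * ξ) + l * (η + m * ξ)
      - m * (dy (η + m * ξ) - B * (η + m * ξ))) := by
    simp only [hX, Derivation.leibniz, smul_eq_mul, w_y, w_x]
    ring
  have YF : Y F = ρ ^ 2 * (dy G - B * G) := by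
    simp only [hF, pow_two, hY, Derivation.leibniz, smul_eq_mul, w_y, ρ_y]
    linear_combination ρ ^ 2 * (dy G - B * G) * hσw
  have XF : X F = ρ ^ 3 * w * (dx G - m * dy G + (l + m * B - 2 * κ) * G) := by
    simp only [hF, pow_two, hX, Derivation.leibniz, smul_eq_mul, w_y, w_x, ρ_x, ρ_y]
    ring
  -- `n3`, …, `n0` are the flat equations without their invertible factors, so that the cubic reads
  -- `-n3 P ^ 3 + n2 P ^ 2 + n1 P + n0` with `P = p + m`.
  obtain ⟨n3, h3⟩ : ∃ n, n = dy (dy ξ) + B * dy ξ := ⟨_, rfl⟩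
  obtain ⟨n2, h2⟩ : ∃ n, n = dy (dy (η + m * ξ) - B * (η + m * ξ))
    - 2 * dy (κ * ξ + dx ξ - m * dy ξ) := ⟨_, rfl⟩
  obtain ⟨n1, h1⟩ : ∃ n, n = 2 * (dx (dy (η + m * ξ) - B * (η + m * ξ))
      - m * dy (dy (η + m * ξ) - B * (η + m * ξ)))
    - (dx (κ * ξ + dx ξ - m * dy ξ) - m * dy (κ * ξ + dx ξ - m * dy ξ)) - 3 * G * dy ξ := ⟨_, rfl⟩
  obtain ⟨e, he⟩ : ∃ e, e = dx (η + m * ξ) + l * (η + m * ξ)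
      - m * (dy (η + m * ξ) - B * (η + m * ξ)) := ⟨_, rfl⟩
  obtain ⟨n0, h0⟩ : ∃ n, n = dx e - m * dy e + (l + m * B - κ) * e
    + (dy (η + m * ξ) - B * (η + m * ξ) - 2 * (κ * ξ + dx ξ - m * dy ξ)) * G
    - ξ * (dx G - m * dy G + (l + m * B - 2 * κ) * G) - (η + m * ξ) * (dy G - B * G) := ⟨_, rfl⟩
  have f3 : Y (Y (τ * ξ)) = σ ^ 2 * τ * n3 := by
    rw [YA]
    simp only [hY, Derivation.leibniz, smul_eq_mul, τ_y, σ_y, h3]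
    ring
  have f2 : Y (Y (w * (η + m * ξ))) - 2 * X (Y (τ * ξ)) = σ * n2 := by
    rw [hXY, XA, YE, h2, hY, hY]
    ring
  have f1 : 2 * X (Y (w * (η + m * ξ))) - X (X (τ * ξ)) - 3 * F * Y (τ * ξ) = ρ * n1 := by
    rw [YE, XA, YA, h1]
    simp only [hX]
    rw [hF]
    linear_combination (- 3 * ρ * G * dy ξ * σ * w) * hρτ - 3 * ρ * G * dy ξ * hσw
  have f0 : X (X (w * (η + m * ξ))) + (Y (w * (η + m * ξ)) - 2 * X (τ * ξ)) * F
      - τ * ξ * X F - w * (η + m * ξ) * Y F = ρ ^ 2 * w * n0 := by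
    rw [XE, ← he, YE, XA, XF, YF, h0]
    simp only [hX, Derivation.leibniz, smul_eq_mul, w_x, w_y, ρ_x, ρ_y]
    rw [hF]
    linear_combination (- ξ * ρ ^ 2 * w * (dx G - m * dy G + (l + m * B - 2 * κ) * G)) * hρτ
  -- `g2`, `g1`, `g0` are the coefficients of `p ^ 2`, `p` and `1` after expanding `P = p + m`.
  have g2 : dy (dy η) - 2 * dx (dy ξ) - B * dy η - 2 * C * dy ξ - ξ * dx B - η * dy B =
      n2 - 3 * m * n3 := by
    rw [h2, h3, hC]
    simp only [map_add, map_sub, Derivation.leibniz, smul_eq_mul, m_y, κ_y, hc, l_y]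
    ring
  have g1 : 2 * dx (dy η) - dx (dx ξ) - C * dx ξ - 3 * D * dy ξ - ξ * dx C - η * dy C
      - 2 * B * dx η = n1 + 2 * m * n2 - 3 * m ^ 2 * n3 := by
    rw [h1, h2, h3, hC, hD]
    simp only [map_add, map_sub, Derivation.leibniz, smul_eq_mul, m_y, κ_y, hc, l_y, deriv_two]
    ring
  have g0 : dx (dx η) + (dy η - 2 * dx ξ) * D - ξ * dx D - η * dy D - C * dx η =
      n0 + m * n1 + m ^ 2 * n2 - m ^ 3 * n3 := by
    rw [h0, h1, h2, h3, he, hC, hD]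
    simp only [map_add, map_sub, Derivation.leibniz, smul_eq_mul, m_y, κ_y, hc, l_y]
    ring
  constructor
  · rintro ⟨r3, r2, r1, r0⟩
    rw [← h3] at r3
    rw [g2, r3] at r2
    have r2' : n2 = 0 := by linear_combination r2
    rw [g1, r3, r2'] at r1
    have r1' : n1 = 0 := by linear_combination r1
    rw [g0, r3, r2', r1'] at r0
    have r0' : n0 = 0 := by linear_combination r0
    rw [r3] at f3
    rw [r2'] at f2
    rw [r1'] at f1
    rw [r0'] at f0
    exact ⟨by linear_combination f3, by linear_combination f2, by linear_combination f1,
      by linear_combination f0⟩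
  · rintro ⟨r3, r2, r1, r0⟩
    have r3' : n3 = 0 := by
      linear_combination ρ * w ^ 2 * (r3 - f3) - n3 * (σ * w + 1) * hσw
        - n3 * σ ^ 2 * w ^ 2 * hρτ
    have r2' : n2 = 0 := by
      linear_combination w * (r2 - f2) - n2 * hσw
    have r1' : n1 = 0 := by
      linear_combination τ * (r1 - f1) - n1 * hρτ
    have r0' : n0 = 0 := by
      linear_combination σ * τ ^ 2 * (r0 - f0) - n0 * (ρ * τ + 1) * hρτ
        - n0 * ρ ^ 2 * τ ^ 2 * hσw
    exact ⟨by rw [← h3, r3'], by rw [g2, r3', r2']; ring, by rw [g1, r3', r2', r1']; ring,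
      by rw [g0, r3', r2', r1', r0']; ring⟩

end Frame

/-! ### Flat equations with zero or exponential right-hand side -/

theorem eq_zero_of_natCast_mul (𝕜 : Type*) [RCLike 𝕜] {R : Type*} [CommRing R] [Algebra 𝕜 R] (n : ℕ)
    (hn : n ≠ 0) {z : R} (h : (n : R) * z = 0) : z = 0 := by
  have h2 : ((n : 𝕜)⁻¹ * n : 𝕜) • z = 0 := by
    rw [mul_smul, Algebra.smul_def (n : 𝕜), map_natCast, h, smul_zero]
  rwa [inv_mul_cancel₀ (Nat.cast_ne_zero.2 hn), one_smul] at h2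

section

variable {R : Type*} [CommRing R] [Algebra 𝕜 R] {X Y : Derivation 𝕜 R R}

/-- The fields `A ∂/∂T + E ∂/∂U` that are symmetries of `U'' = 0`. -/
def projectiveField (T U : R) : (Fin 8 → 𝕜) →ₗ[𝕜] R × R where
  toFun c :=
    (c 0 • 1 + c 1 • T + c 2 • U + c 3 • T ^ 2 + c 4 • (T * U),
      c 5 • 1 + c 6 • T + c 7 • U + c 3 • (T * U) + c 4 • U ^ 2)
  map_add' c d := by
    ext <;> simp only [Pi.add_apply, add_smul, Prod.fst_add, Prod.snd_add] <;> abel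
  map_smul' a c := by
    ext <;> simp [mul_smul]

theorem projectiveField_injective [Nontrivial R] {T U : R} (hXT : X T = 1) (hYT : Y T = 0)
    (hXU : X U = 0) (hYU : Y U = 1) :
    Function.Injective (projectiveField T U : (Fin 8 → 𝕜) →ₗ[𝕜] R × R) := by
  rw [injective_iff_map_eq_zero]
  intro c hc
  have h1 : c 0 • (1 : R) + c 1 • T + c 2 • U + c 3 • T ^ 2 + c 4 • (T * U) = 0 :=
    congrArg Prod.fst hc
  have h2 : c 5 • (1 : R) + c 6 • T + c 7 • U + c 3 • (T * U) + c 4 • U ^ 2 = 0 :=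
    congrArg Prod.snd hc
  have smul_zero_iff : ∀ a : 𝕜, a • (1 : R) = 0 → a = 0 := fun a h => by
    rw [← Algebra.algebraMap_eq_smul_one] at h
    exact (FaithfulSMul.algebraMap_eq_zero_iff 𝕜 R).1 h
  have step : ∀ (d : Derivation 𝕜 R R) {g : R}, g = 0 → d g = 0 := fun d g h => by rw [h, map_zero]
  have hX := step X h1
  have hY := step Y h1
  have hX' := step X h2
  have hY' := step Y h2
  have hXX := step X hX
  have hXY := step X hY
  simp only [map_add, Derivation.map_smul, Derivation.leibniz, Derivation.map_one_eq_zero, hXT, hXU,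
    hYT, hYU, pow_two, smul_eq_mul, mul_one, mul_zero, add_zero, zero_add, smul_zero]
    at h1 h2 hX hY hX' hY' hXX hXY
  have h3 : c 3 = 0 := by
    refine smul_zero_iff _ (eq_zero_of_natCast_mul 𝕜 2 (by norm_num) ?_)
    rw [← hXX, smul_add]
    push_cast
    ring
  have h4 : c 4 = 0 := smul_zero_iff _ hXY
  simp only [h3, h4, zero_smul, add_zero] at h1 h2 hX hY hX' hY'
  have e1 := smul_zero_iff _ hX
  have e2 := smul_zero_iff _ hY
  have e6 := smul_zero_iff _ hX'
  have e7 := smul_zero_iff _ hY'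
  simp only [e1, e2, e6, e7, zero_smul, add_zero] at h1 h2
  have e0 := smul_zero_iff _ h1
  have e5 := smul_zero_iff _ h2
  funext i
  fin_cases i <;> assumption

/-- The `U`-derivative of `2 XYE = XXA`, combined with `YYE = 2 XYA`, gives `4 XXYA = XXYA`. Hence
`XYA` and `XYE` are constants (`c4` and `c3`), and the remaining coefficients appear as constants of
integration from the top degree down. -/
theorem flat_zero_iff (hXY : ∀ g, X (Y g) = Y (X g))
    (hconst : ∀ g, X g = 0 → Y g = 0 → ∃ c : 𝕜, g = c • (1 : R))
    {T U : R} (hXT : X T = 1) (hYT : Y T = 0) (hXU : X U = 0) (hYU : Y U = 1) (A E : R) :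
    Flat X Y 0 A E ↔ ∃ c : Fin 8 → 𝕜, projectiveField T U c = (A, E) := by
  have smulX : ∀ a : 𝕜, X (a • (1 : R)) = 0 := fun a => by simp
  have smulY : ∀ a : 𝕜, Y (a • (1 : R)) = 0 := fun a => by simp
  constructor
  · rintro ⟨c, s, l, k⟩
    rw [mul_zero, zero_mul, add_zero] at l
    rw [mul_zero, map_zero, map_zero, mul_zero, mul_zero, add_zero, add_zero] at k
    have hl := congrArg Y l
    rw [Derivation.leibniz, deriv_two, ← hXY, ← hXY, ← hXY, s, Derivation.leibniz, deriv_two,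
      smul_eq_mul, smul_eq_mul, smul_eq_mul, smul_eq_mul] at hl
    have t1 : X (X (Y A)) = 0 := by
      refine eq_zero_of_natCast_mul 𝕜 3 (by norm_num) ?_
      push_cast
      linear_combination hl
    have t2 : Y (X (Y A)) = 0 := by rw [← hXY, c, map_zero]
    have t3 : X (X (Y E)) = 0 := by rw [hXY, hXY, k, map_zero]
    have t4 : Y (X (Y E)) = 0 := by
      rw [← hXY, s, Derivation.leibniz, t1, deriv_two, smul_zero, smul_zero, add_zero]
    obtain ⟨c4, h4⟩ := hconst _ t1 t2
    obtain ⟨c3, h3⟩ := hconst _ t3 t4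
    obtain ⟨c2, h2⟩ := hconst (Y A - c4 • (1 : R) * T)
      (by rw [map_sub, Derivation.leibniz, smulX, hXT, h4]; simp)
      (by rw [map_sub, Derivation.leibniz, smulY, hYT, c]; simp)
    have l' : X (X A) = 2 * c3 • (1 : R) := by rw [← l, h3]
    have s' : Y (Y E) = 2 * c4 • (1 : R) := by rw [s, h4]
    obtain ⟨c1, h1⟩ := hconst (X A - 2 * (c3 • (1 : R) * T) - c4 • (1 : R) * U)
      (by simp only [map_sub, Derivation.leibniz, smulX, hXT, hXU, deriv_two, smul_eq_mul, l']; ring)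
      (by
        simp only [map_sub, Derivation.leibniz, smulY, hYT, hYU, deriv_two, smul_eq_mul, ← hXY, h4]
        ring)
    obtain ⟨c7, h7⟩ := hconst (Y E - c3 • (1 : R) * T - 2 * (c4 • (1 : R) * U))
      (by simp only [map_sub, Derivation.leibniz, smulX, hXT, hXU, deriv_two, smul_eq_mul, h3]; ring)
      (by simp only [map_sub, Derivation.leibniz, smulY, hYT, hYU, deriv_two, smul_eq_mul, s']; ring)
    obtain ⟨c6, h6⟩ := hconst (X E - c3 • (1 : R) * U)
      (by simp only [map_sub, Derivation.leibniz, smulX, hXU, smul_eq_mul, k]; ring)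
      (by simp only [map_sub, Derivation.leibniz, smulY, hYU, smul_eq_mul, ← hXY, h3]; ring)
    obtain ⟨c0, h0⟩ := hconst (A - c1 • (1 : R) * T - c2 • (1 : R) * U - c3 • (1 : R) * (T * T)
        - c4 • (1 : R) * (T * U))
      (by
        simp only [map_sub, Derivation.leibniz, smulX, hXT, hXU, smul_eq_mul]
        linear_combination h1)
      (by
        simp only [map_sub, Derivation.leibniz, smulY, hYT, hYU, smul_eq_mul]
        linear_combination h2)
    obtain ⟨c5, h5⟩ := hconst (E - c6 • (1 : R) * T - c7 • (1 : R) * U - c3 • (1 : R) * (T * U)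
        - c4 • (1 : R) * (U * U))
      (by
        simp only [map_sub, Derivation.leibniz, smulX, hXT, hXU, smul_eq_mul]
        linear_combination h6)
      (by
        simp only [map_sub, Derivation.leibniz, smulY, hYT, hYU, smul_eq_mul]
        linear_combination h7)
    refine ⟨![c0, c1, c2, c3, c4, c5, c6, c7], Prod.ext ?_ ?_⟩
    · change c0 • (1 : R) + c1 • T + c2 • U + c3 • T ^ 2 + c4 • (T * U) = A
      simp only [smul_mul_assoc, one_mul, pow_two] at *
      linear_combination -h0
    · change c5 • (1 : R) + c6 • T + c7 • U + c3 • (T * U) + c4 • U ^ 2 = E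
      simp only [smul_mul_assoc, one_mul, pow_two] at *
      linear_combination -h5
  · rintro ⟨c, hc⟩
    have hA : c 0 • (1 : R) + c 1 • T + c 2 • U + c 3 • T ^ 2 + c 4 • (T * U) = A :=
      congrArg Prod.fst hc
    have hE : c 5 • (1 : R) + c 6 • T + c 7 • U + c 3 • (T * U) + c 4 • U ^ 2 = E :=
      congrArg Prod.snd hc
    have smulX' : ∀ (a : 𝕜) (g : R), X (a • g) = a • X g := fun a g => X.map_smul a g
    have smulY' : ∀ (a : 𝕜) (g : R), Y (a • g) = a • Y g := fun a g => Y.map_smul a g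
    subst hA hE
    constructor <;>
    simp only [map_add, smulX', smulY', Derivation.leibniz, Derivation.map_one_eq_zero, hXT, hXU,
      hYT, hYU, pow_two, smul_eq_mul, mul_one, mul_zero, zero_mul, add_zero, zero_add, smul_zero,
      map_zero, smul_add] <;> ring

/-- Point symmetries of `U'' = F(T, U)` with `F = k e^(n (T + ε U))`. -/
theorem flat_exp_iff (hXY : ∀ g, X (Y g) = Y (X g)) {F ε : R} {n : ℕ} (hn : n ≠ 0) (hF : IsUnit F)
    (hε : ε ^ 2 = 1) (hYε : Y ε = 0) (hXε : X ε = 0) (hXF : X F = n * F) (hYF : Y F = ε * n * F)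
    (A E : R) :
    Flat X Y F A E ↔ Y A = 0 ∧ X (X A) = 0 ∧ n * E = -(ε * (n * A + 2 * X A)) := by
  have hXn : X (n : R) = 0 := X.map_natCast n
  have hYn : Y (n : R) = 0 := Y.map_natCast n
  have cancel : ∀ {z : R}, (n : R) * z = 0 → z = 0 := fun h => eq_zero_of_natCast_mul 𝕜 n hn h
  constructor
  · rintro ⟨c, s, l, k⟩
    -- Two `U`-derivatives of the linear equation kill everything except `3 F_UU (Y A)`, and `F_UU =
    -- n² F` is invertible up to a non-zero integer.
    have β0 : Y A = 0 := by
      have h1 := congrArg Y (congrArg Y l)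
      simp only [map_add, Derivation.leibniz, ← hXY, s, c, deriv_two, smul_eq_mul, hYF, hYε, hYn,
        map_zero] at h1
      have h3 : Y (3 : R) = 0 := by exact_mod_cast Y.map_natCast 3
      simp only [h3, map_zero] at h1
      have h2 : (3 : ℕ) * (n * (n * (F * Y A))) = 0 := by
        push_cast
        linear_combination -h1 - 3 * n ^ 2 * F * Y A * hε
      exact (hF.mul_right_eq_zero).1 (cancel (cancel (eq_zero_of_natCast_mul 𝕜 3 (by norm_num) h2)))
    rw [β0, map_zero, mul_zero] at s
    rw [β0, mul_zero, add_zero] at l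
    have hYXA : Y (X A) = 0 := by rw [← hXY, β0, map_zero]
    -- The last equation reads `XXE + N F = 0`, where `XXE` and `N` are affine in `U` and `F` is
    -- exponential. Two derivatives remove `XXE`; a further one forces the slope of `N`, hence `Y
    -- E`, to vanish.
    obtain ⟨N, hN⟩ : ∃ N, N = Y E - 2 * X A - n * A - ε * n * E := ⟨_, rfl⟩
    have hYN : Y N = -(ε * n * Y E) := by
      simp only [hN, map_sub, Derivation.leibniz, smul_eq_mul, hYXA, s, β0, deriv_two, hYε, hYn]
      ring
    have k' : X (X E) + N * F = 0 := by rw [hN]; linear_combination k + A * hXF + E * hYF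
    have k1 := congrArg Y k'
    have k2 := congrArg Y k1
    simp only [map_add, Derivation.leibniz, ← hXY, s, smul_eq_mul, hYN, hYF, hYε, hYn,
      map_zero, map_neg] at k2
    have h2 : n * (n * (F * (N - 2 * Y E))) = 0 := by
      linear_combination k2 - n ^ 2 * F * (N - 2 * Y E) * hε
    have h3 : N - 2 * Y E = 0 := (hF.mul_right_eq_zero).1 (cancel (cancel h2))
    have h4 := congrArg Y h3
    simp only [map_sub, Derivation.leibniz, hYN, s, smul_eq_mul, deriv_two, map_zero] at h4
    have γ0 : Y E = 0 := cancel (by linear_combination -ε * h4 - n * Y E * hε)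
    have N0 : N = 0 := by linear_combination h3 + 2 * γ0
    rw [γ0, map_zero, mul_zero] at l
    refine ⟨β0, l.symm, ?_⟩
    linear_combination ε * hN - ε * N0 + ε * γ0 - n * E * hε
  · rintro ⟨β0, hXX, hE⟩
    have hYXA : Y (X A) = 0 := by rw [← hXY, β0, map_zero]
    have h1 := congrArg Y hE
    simp only [map_add, map_neg, Derivation.leibniz, hYε, hYn, hYXA, β0, deriv_two, smul_eq_mul] at h1
    have γ0 : Y E = 0 := cancel (by linear_combination h1)
    have h2 := congrArg X (congrArg X hE)
    simp only [map_add, map_neg, Derivation.leibniz, hXε, hXn, hXX, deriv_two, smul_eq_mul,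
      map_zero] at h2
    have hXXE : X (X E) = 0 := cancel (by linear_combination h2)
    refine ⟨by rw [β0, map_zero], by rw [β0, γ0]; simp, by rw [β0, γ0, hXX]; simp, ?_⟩
    rw [hXXE, γ0, hXF, hYF]
    linear_combination -ε * F * hE + F * (n * A + 2 * X A) * hε

/-- Point symmetries of `U'' = F(T, U)` with `F = k e^(T + ε U) + l e^(2 (T + ε U))`. -/
theorem flat_two_exp_iff (hXY : ∀ g, X (Y g) = Y (X g)) {F₁ F₂ ε : R} (hF₁ : IsUnit F₁)
    (hF₂ : IsUnit F₂) (hε : ε ^ 2 = 1) (hYε : Y ε = 0) (hXε : X ε = 0) (hXF₁ : X F₁ = F₁)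
    (hYF₁ : Y F₁ = ε * F₁) (hXF₂ : X F₂ = 2 * F₂) (hYF₂ : Y F₂ = 2 * ε * F₂) (A E : R) :
    Flat X Y (F₁ + F₂) A E ↔ X A = 0 ∧ Y A = 0 ∧ E = -(ε * A) := by
  have cancel : ∀ (n : ℕ), n ≠ 0 → ∀ {z : R}, (n : R) * z = 0 → z = 0 :=
    fun n hn _ h => eq_zero_of_natCast_mul 𝕜 n hn h
  have hY3 : Y (3 : R) = 0 := by exact_mod_cast Y.map_natCast 3
  have εF : ∀ k : R, ε * (ε * k) = k := fun k => by linear_combination k * hε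
  have unε : ∀ {k : R}, ε * k = 0 → k = 0 := fun {k} h => by rw [← εF k, h, mul_zero]
  constructor
  · rintro ⟨c, s, l, k⟩
    -- Here `F_UU = F₁ + 4 F₂` need not be invertible; one more `U`-derivative of `F_UU (Y A) = 0`
    -- separates the two exponentials.
    have β0 : Y A = 0 := by
      have h1 := congrArg Y (congrArg Y l)
      simp only [map_add, Derivation.leibniz, ← hXY, s, c, deriv_two, smul_eq_mul, hYF₁, hYF₂, hYε,
        hY3, map_zero] at h1
      have h2 : (F₁ + 4 * F₂) * Y A = 0 := by
        refine cancel 3 (by norm_num) ?_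
        push_cast
        linear_combination -h1 - 3 * (F₁ + 4 * F₂) * Y A * hε
      have h3 := congrArg Y h2
      have hY4 : Y (4 : R) = 0 := by exact_mod_cast Y.map_natCast 4
      simp only [map_add, Derivation.leibniz, hYF₁, hYF₂, c, hY4, smul_eq_mul, map_zero] at h3
      have h4 : F₁ * Y A + 8 * (F₂ * Y A) = 0 := unε (by linear_combination h3)
      have h5 : ((4 : ℕ) : R) * (F₂ * Y A) = 0 := by
        push_cast
        linear_combination h4 - h2
      exact hF₂.mul_right_eq_zero.1 (cancel 4 (by norm_num) h5)
    rw [β0, map_zero, mul_zero] at s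
    rw [β0, mul_zero, add_zero] at l
    have hYXA : Y (X A) = 0 := by rw [← hXY, β0, map_zero]
    -- The last equation reads `XXE + N F₁ + M F₂ = 0` with `XXE`, `N`, `M` affine in `U`. Its
    -- `U`-derivatives of orders 2 to 5 are four linear equations for `N F₁`, `M F₂`, `(Y E) F₁`,
    -- `(Y E) F₂`.
    obtain ⟨N, hN⟩ : ∃ N, N = Y E - 2 * X A - A - ε * E := ⟨_, rfl⟩
    obtain ⟨M, hM⟩ : ∃ M, M = Y E - 2 * X A - 2 * A - 2 * (ε * E) := ⟨_, rfl⟩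
    have hYN : Y N = -(ε * Y E) := by
      simp only [hN, map_sub, Derivation.leibniz, smul_eq_mul, hYXA, s, β0, deriv_two, hYε]
      ring
    have hYM : Y M = -(2 * (ε * Y E)) := by
      simp only [hM, map_sub, Derivation.leibniz, smul_eq_mul, hYXA, s, β0, deriv_two, hYε]
      ring
    have hYp : Y (Y E * F₁) = ε * (Y E * F₁) := by
      rw [Derivation.leibniz, s, hYF₁, smul_eq_mul, smul_eq_mul]; ring
    have hYr : Y (Y E * F₂) = 2 * (ε * (Y E * F₂)) := by
      rw [Derivation.leibniz, s, hYF₂, smul_eq_mul, smul_eq_mul]; ring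
    have hYa : Y (N * F₁) = ε * (N * F₁ - Y E * F₁) := by
      rw [Derivation.leibniz, hYN, hYF₁, smul_eq_mul, smul_eq_mul]; ring
    have hYb : Y (M * F₂) = 2 * (ε * (M * F₂ - Y E * F₂)) := by
      rw [Derivation.leibniz, hYM, hYF₂, smul_eq_mul, smul_eq_mul]; ring
    have k' : X (X E) + N * F₁ + M * F₂ = 0 := by
      rw [hN, hM]
      rw [map_add, map_add, hXF₁, hXF₂, hYF₁, hYF₂] at k
      linear_combination k
    have k1 := congrArg Y k'
    have k2 := congrArg Y k1
    have k3 := congrArg Y k2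
    have k4 := congrArg Y k3
    have k5 := congrArg Y k4
    have hYεmul : ∀ g, Y (ε * g) = ε * Y g := fun g => by
      rw [Derivation.leibniz, hYε, smul_zero, add_zero, smul_eq_mul]
    have hYtwo : ∀ g, Y (2 * g) = 2 * Y g := fun g => by
      rw [Derivation.leibniz, deriv_two, smul_zero, add_zero, smul_eq_mul]
    simp only [map_add, map_sub, hYεmul, hYtwo, hYa, hYb, hYp, hYr, ← hXY, s, map_zero]
      at k2 k3 k4 k5
    generalize ha : N * F₁ = a, hb : M * F₂ = b, hp : Y E * F₁ = p, hr : Y E * F₂ = r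
      at k2 k3 k4 k5
    -- The derivative of order `j`, freed from powers of `ε`, is `a - j p + 2 ^ j b - j 2 ^ j r =
    -- 0`.
    have m2 : a - 2 * p + 4 * b - 8 * r = 0 := by
      linear_combination k2 - (a - 2 * p + 4 * b - 8 * r) * hε
    have m3 : a - 3 * p + 8 * b - 24 * r = 0 := by
      linear_combination ε * k3 - (a - 3 * p + 8 * b - 24 * r) * (ε ^ 2 + 1) * hε
    have m4 : a - 4 * p + 16 * b - 64 * r = 0 := by
      linear_combination k4 - (a - 4 * p + 16 * b - 64 * r) * (ε ^ 2 + 1) * hε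
    have m5 : a - 5 * p + 32 * b - 160 * r = 0 := by
      linear_combination ε * k5 - (a - 5 * p + 32 * b - 160 * r) * (ε ^ 4 + ε ^ 2 + 1) * hε
    -- The weights are the coefficients of `-(t - 1)² (t - 2)`. This annihilates the sequences `1`,
    -- `j` and `2 ^ j`, and leaves a multiple of `r`.
    have r0 : r = 0 := by
      refine cancel 8 (by norm_num) ?_
      push_cast
      linear_combination 2 * m2 - 5 * m3 + 4 * m4 - m5
    have γ0 : Y E = 0 := hF₂.mul_left_eq_zero.1 (hr.trans r0)
    have p0 : p = 0 := by rw [← hp, γ0, zero_mul]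
    have b0 : b = 0 := by
      refine cancel 4 (by norm_num) ?_
      push_cast
      linear_combination m3 - m2 + p0 + 16 * r0
    have M0 : M = 0 := hF₂.mul_left_eq_zero.1 (hb.trans b0)
    have N0 : N = 0 := hF₁.mul_left_eq_zero.1 (ha.trans
      (by linear_combination m2 + 2 * p0 - 4 * b0 + 8 * r0))
    have hE : A + ε * E = 0 := by linear_combination hM - hN - M0 + N0
    have hXA : X A = 0 := by
      refine cancel 2 (by norm_num) ?_
      push_cast
      linear_combination hN - N0 + γ0 - hE
    exact ⟨hXA, β0, by linear_combination ε * hE - E * hε⟩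
  · rintro ⟨hXA, hYA, rfl⟩
    constructor <;>
    simp only [map_add, map_neg, Derivation.leibniz, hXA, hYA, hXε, hYε, smul_eq_mul, hXF₁, hXF₂,
      hYF₁, hYF₂, mul_zero, neg_zero, map_zero, add_zero]
    linear_combination A * (F₁ + 2 * F₂) * hε

end

/-! ### The flat equations of `PV(a, b, 0, 0)` -/

section

variable {R : Type*} [CommRing R] [Algebra 𝕜 R] {X Y : Derivation 𝕜 R R}

/-- Applying `Y` acts as `Y y` times the formal derivative, because `Y` kills the coefficients;
induction on the degree then works in a ring with zero divisors. -/
theorem coeff_eq_zero {y : R} (hy : IsUnit (Y y)) (n : ℕ) (c : ℕ → R) (hc : ∀ i, Y (c i) = 0)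
    (h : ∑ i ∈ Finset.range n, c i * y ^ i = 0) : ∀ i < n, c i = 0 := by
  induction n generalizing c with
  | zero => intro i hi; omega
  | succ n ih =>
    have h1 : ∑ i ∈ Finset.range n, ((i + 1 : ℕ) * c (i + 1)) * y ^ i = 0 := by
      have h2 := congrArg Y h
      rw [map_sum, map_zero, Finset.sum_range_succ'] at h2
      simp only [Derivation.leibniz, Derivation.leibniz_pow, hc, pow_zero,
        smul_eq_mul, nsmul_eq_mul, Nat.add_sub_cancel, Derivation.map_one_eq_zero, mul_zero,
        add_zero] at h2
      refine hy.mul_right_eq_zero.1 ?_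
      rw [Finset.mul_sum, ← h2]
      exact Finset.sum_congr rfl fun i _ => by ring
    have h3 := ih (fun i => (i + 1 : ℕ) * c (i + 1))
      (fun i => by rw [Derivation.leibniz, hc, Derivation.map_natCast]; simp) h1
    have h4 : ∀ i < n, c (i + 1) = 0 := fun i hi =>
      eq_zero_of_natCast_mul 𝕜 (i + 1) (by omega) (h3 i hi)
    intro i hi
    cases i with
    | zero =>
      rw [Finset.sum_range_succ', Finset.sum_eq_zero fun i hi => by
        rw [h4 i (Finset.mem_range.1 hi), zero_mul]] at h
      simpa using h
    | succ i => exact h4 i (by omega)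

/-- With `r` a multiple of `y ^ (-1/2)` and `Y = r y (y - 1) d/dy`, every `U`-derivative of `F` is a
power of `r` times a polynomial in `y`. The equations for `A`, `E` thus become comparisons of
coefficients, which needs only that one of `a`, `b` is invertible. -/
theorem flat_sqrt_iff (hXY : ∀ g, X (Y g) = Y (X g)) {r y a b : R} (hr : IsUnit r) (hy : IsUnit y)
    (hy1 : IsUnit (y - 1)) (hXr : X r = 0) (hXy : X y = 0) (hYr : 2 * Y r = r ^ 2 * (1 - y))
    (hYy : Y y = r * y * (y - 1)) (hYa : Y a = 0) (hYb : Y b = 0) (hXa : X a = 0) (hXb : X b = 0)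
    (hab : IsUnit a ∨ a = 0 ∧ IsUnit b) (A E : R) :
    Flat X Y (r ^ 3 * (y - 1) * (a * y ^ 2 + b)) A E ↔ X A = 0 ∧ Y A = 0 ∧ E = 0 := by
  obtain ⟨F, hF⟩ : ∃ F, F = r ^ 3 * (y - 1) * (a * y ^ 2 + b) := ⟨_, rfl⟩
  rw [← hF]
  have hXF : X F = 0 := by
    rw [hF]
    simp only [Derivation.leibniz, Derivation.leibniz_pow, map_add, map_sub, hXr, hXy, hXa, hXb,
      Derivation.map_one_eq_zero, smul_zero, sub_zero, add_zero]
  constructor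
  swap
  · rintro ⟨hXA, hYA, rfl⟩
    constructor <;> simp [hXA, hYA, hXF]
  rintro ⟨c, s, l, k⟩
  have cancel : ∀ (n : ℕ), n ≠ 0 → ∀ {z : R}, (n : R) * z = 0 → z = 0 :=
    fun n hn _ h => eq_zero_of_natCast_mul 𝕜 n hn h
  have huY : IsUnit (Y y) := by rw [hYy]; exact (hr.mul hy).mul hy1
  -- Doubling `Y` avoids the factor `1/2` in the derivative of `r`.
  obtain ⟨Z, hZ⟩ : ∃ Z : Derivation 𝕜 R R, Z = (2 : R) • Y := ⟨_, rfl⟩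
  have Z_apply : ∀ g, Z g = 2 * Y g := fun g => by rw [hZ]; rfl
  have Zr : Z r = r ^ 2 * (1 - y) := (Z_apply r).trans hYr
  have Zy : Z y = 2 * (r * y * (y - 1)) := by rw [Z_apply, hYy]
  have Za : Z a = 0 := by rw [Z_apply, hYa, mul_zero]
  have Zb : Z b = 0 := by rw [Z_apply, hYb, mul_zero]
  have Zn : ∀ n : ℕ, Z (n : R) = 0 := Z.map_natCast
  have Yn : ∀ n : ℕ, Y (n : R) = 0 := Y.map_natCast
  have hZF : Z F = r ^ 4 * (3 * a * y ^ 4 - 4 * a * y ^ 3 + a * y ^ 2 - b * y ^ 2 + 4 * b * y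
      - 3 * b) := by
    rw [hF]
    simp only [Derivation.leibniz, Derivation.leibniz_pow, map_add, map_sub, Za, Zb, Zr, Zy,
      smul_eq_mul, nsmul_eq_mul, Derivation.map_one_eq_zero]
    push_cast
    ring
  -- `H`, `H₁`, `H₂` are the second, third and fourth `Z`-derivatives of `F`. The numerals are casts
  -- from `ℕ` so that `Zn` and `Yn` differentiate them to zero.
  obtain ⟨H, hH⟩ : ∃ H, H = r ^ 5 * ((12 : ℕ) * a * y ^ 5 - (20 : ℕ) * a * y ^ 4
      + (8 : ℕ) * a * y ^ 3 - (8 : ℕ) * b * y ^ 2 + (20 : ℕ) * b * y - (12 : ℕ) * b) := ⟨_, rfl⟩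
  have hZZF : Z (Z F) = H := by
    rw [hZF, hH]
    have Z3 := Zn 3
    have Z4 := Zn 4
    push_cast at Z3 Z4
    simp only [Derivation.leibniz, Derivation.leibniz_pow, map_add, map_sub, Za, Zb, Zr, Zy,
      smul_eq_mul, nsmul_eq_mul, Z3, Z4]
    push_cast
    ring
  obtain ⟨H₁, hH₁⟩ : ∃ H, H = r ^ 6 * ((60 : ℕ) * a * y ^ 6 - (120 : ℕ) * a * y ^ 5
      + (68 : ℕ) * a * y ^ 4 + (8 : ℕ) * (b - a) * y ^ 3 - (68 : ℕ) * b * y ^ 2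
      + (120 : ℕ) * b * y - (60 : ℕ) * b) := ⟨_, rfl⟩
  have hZH : Z H = H₁ := by
    rw [hH, hH₁]
    simp only [Derivation.leibniz, Derivation.leibniz_pow, map_add, map_sub, Za, Zb, Zr, Zy,
      smul_eq_mul, nsmul_eq_mul, Zn]
    push_cast
    ring
  obtain ⟨H₂, hH₂⟩ : ∃ H, H = r ^ 7 * ((360 : ℕ) * a * y ^ 7 - (840 : ℕ) * a * y ^ 6
      + (616 : ℕ) * a * y ^ 5 - (136 : ℕ) * a * y ^ 4 + (136 : ℕ) * b * y ^ 3
      - (616 : ℕ) * b * y ^ 2 + (840 : ℕ) * b * y - (360 : ℕ) * b) := ⟨_, rfl⟩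
  have hZH₁ : Z H₁ = H₂ := by
    rw [hH₁, hH₂]
    simp only [Derivation.leibniz, Derivation.leibniz_pow, map_add, map_sub, Za, Zb, Zr, Zy,
      smul_eq_mul, nsmul_eq_mul, Zn]
    push_cast
    ring
  have hH_zero : ∀ z, Y z = 0 → H * z = 0 → z = 0 := by
    intro z hz h
    have h1 := coeff_eq_zero huY 6 (fun i => match i with
      | 0 => -(12 : ℕ) * (b * z) | 1 => (20 : ℕ) * (b * z) | 2 => -(8 : ℕ) * (b * z)
      | 3 => (8 : ℕ) * (a * z) | 4 => -(20 : ℕ) * (a * z) | 5 => (12 : ℕ) * (a * z) | _ => 0)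
      (by
        intro i
        match i with
        | 0 | 1 | 2 | 3 | 4 | 5 | n + 6 =>
          simp only [Derivation.leibniz, map_neg, map_zero, hYa, hYb, hz, Yn, smul_zero, add_zero,
            neg_zero])
      (by
        refine (hr.pow 5).mul_right_eq_zero.1 ?_
        rw [← h, hH]
        simp only [Finset.sum_range_succ, Finset.sum_range_zero]
        ring)
    rcases hab with ha | ⟨-, hb⟩
    · exact ha.mul_right_eq_zero.1 (cancel 12 (by norm_num) (h1 5 (by norm_num)))
    · refine hb.mul_right_eq_zero.1 (cancel 12 (by norm_num) ?_)
      have := h1 0 (by norm_num)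
      simp only at this
      linear_combination -this
  have hH₁_zero : ∀ z, Y z = 0 → H₁ * z = 0 → z = 0 := by
    intro z hz h
    have h1 := coeff_eq_zero huY 7 (fun i => match i with
      | 0 => -(60 : ℕ) * (b * z) | 1 => (120 : ℕ) * (b * z) | 2 => -(68 : ℕ) * (b * z)
      | 3 => (8 : ℕ) * ((b - a) * z) | 4 => (68 : ℕ) * (a * z) | 5 => -(120 : ℕ) * (a * z)
      | 6 => (60 : ℕ) * (a * z) | _ => 0)
      (by
        intro i
        match i with
        | 0 | 1 | 2 | 3 | 4 | 5 | 6 | n + 7 =>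
          simp only [Derivation.leibniz, map_neg, map_zero, map_sub, hYa, hYb, hz, Yn, smul_zero,
            add_zero, sub_zero, neg_zero])
      (by
        refine (hr.pow 6).mul_right_eq_zero.1 ?_
        rw [← h, hH₁]
        simp only [Finset.sum_range_succ, Finset.sum_range_zero]
        ring)
    rcases hab with ha | ⟨-, hb⟩
    · exact ha.mul_right_eq_zero.1 (cancel 60 (by norm_num) (h1 6 (by norm_num)))
    · refine hb.mul_right_eq_zero.1 (cancel 60 (by norm_num) ?_)
      have := h1 0 (by norm_num)
      simp only at this
      linear_combination -this
  -- After division by `r ^ 12` both `H H₂ - H₁²` and `H₁²` are polynomials of degree at most 12 in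
  -- `y`; the list contains the coefficients of their combination.
  have hH_indep : ∀ d g, Y d = 0 → Y g = 0 → d * (H * H₂ - H₁ ^ 2) + g * H₁ ^ 2 = 0 →
      d = 0 ∧ g = 0 := by
    intro d g hd hg h
    have h1 := coeff_eq_zero huY 13 (fun i => match i with
      | 0 => ((720 : ℕ) * (b * b)) * d
          + ((3600 : ℕ) * (b * b)) * g
      | 1 => (-((2880 : ℕ) * (b * b))) * d
          + (-((14400 : ℕ) * (b * b))) * g
      | 2 => ((4512 : ℕ) * (b * b)) * d
          + ((22560 : ℕ) * (b * b)) * g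
      | 3 => (-((3392 : ℕ) * (b * b)) - (3840 : ℕ) * (a * b)) * d
          + (-((17280 : ℕ) * (b * b)) + (960 : ℕ) * (a * b)) * g
      | 4 => ((1104 : ℕ) * (b * b) + (25632 : ℕ) * (a * b)) * d
          + ((6544 : ℕ) * (b * b) - (10080 : ℕ) * (a * b)) * g
      | 5 => (-((67968 : ℕ) * (a * b))) * d
          + (-((1088 : ℕ) * (b * b)) + (31808 : ℕ) * (a * b)) * g
      | 6 => (-((64 : ℕ) * (b * b)) + (92352 : ℕ) * (a * b) - (64 : ℕ) * (a * a)) * d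
          + ((64 : ℕ) * (b * b) - (45376 : ℕ) * (a * b) + (64 : ℕ) * (a * a)) * g
      | 7 => (-((67968 : ℕ) * (a * b))) * d
          + ((31808 : ℕ) * (a * b) - (1088 : ℕ) * (a * a)) * g
      | 8 => ((25632 : ℕ) * (a * b) + (1104 : ℕ) * (a * a)) * d
          + (-((10080 : ℕ) * (a * b)) + (6544 : ℕ) * (a * a)) * g
      | 9 => (-((3840 : ℕ) * (a * b)) - (3392 : ℕ) * (a * a)) * d
          + ((960 : ℕ) * (a * b) - (17280 : ℕ) * (a * a)) * g
      | 10 => ((4512 : ℕ) * (a * a)) * d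
          + ((22560 : ℕ) * (a * a)) * g
      | 11 => (-((2880 : ℕ) * (a * a))) * d
          + (-((14400 : ℕ) * (a * a))) * g
      | 12 => ((720 : ℕ) * (a * a)) * d
          + ((3600 : ℕ) * (a * a)) * g
      | _ => 0)
      (by
        intro i
        match i with
        | 0 | 1 | 2 | 3 | 4 | 5 | 6 | 7 | 8 | 9 | 10 | 11 | 12 | n + 13 =>
          simp only [Derivation.leibniz, map_neg, map_zero, map_sub, map_add, hYa, hYb, hd, hg, Yn,
            smul_zero, add_zero, sub_zero, neg_zero])
      (by
        refine (hr.pow 12).mul_right_eq_zero.1 ?_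
        rw [← h, hH, hH₁, hH₂]
        simp only [Finset.sum_range_succ, Finset.sum_range_zero]
        push_cast
        ring)
    rcases hab with ha | ⟨ha, hb⟩
    · have h12 := h1 12 (by norm_num)
      have h9 := h1 9 (by norm_num)
      have h8 := h1 8 (by norm_num)
      simp only at h12 h9 h8
      push_cast at h12 h9 h8
      -- The extreme coefficients give only `d = -5 g`. With this, the coefficients of `y ^ 9` and
      -- `y ^ 8` become `320 a g (63 b - a)` and `1024 a g (a - 135 b)`, and these force `g = 0`.
      have e1 : d + 5 * g = 0 := by
        refine (ha.mul ha).mul_right_eq_zero.1 (cancel 720 (by norm_num) ?_)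
        push_cast
        linear_combination h12
      have e2 : g * (63 * b - a) = 0 := by
        refine ha.mul_right_eq_zero.1 (cancel 320 (by norm_num) ?_)
        push_cast
        linear_combination h9 - (-3840 * (a * b) - 3392 * (a * a)) * e1
      have e3 : g * (a - 135 * b) = 0 := by
        refine ha.mul_right_eq_zero.1 (cancel 1024 (by norm_num) ?_)
        push_cast
        linear_combination h8 - (25632 * (a * b) + 1104 * (a * a)) * e1
      have e4 : b * g = 0 := by
        refine cancel 72 (by norm_num) ?_
        push_cast
        linear_combination -e2 - e3
      have e5 : g = 0 := ha.mul_right_eq_zero.1 (by linear_combination e3 + 135 * e4)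
      exact ⟨by linear_combination e1 - 5 * e5, e5⟩
    · have h0 := h1 0 (by norm_num)
      have h3 := h1 3 (by norm_num)
      simp only [ha] at h0 h3
      push_cast at h0 h3
      have e1 : d + 5 * g = 0 := by
        refine (hb.mul hb).mul_right_eq_zero.1 (cancel 720 (by norm_num) ?_)
        push_cast
        linear_combination h0
      have e5 : g = 0 := by
        refine (hb.mul hb).mul_right_eq_zero.1 (cancel 320 (by norm_num) ?_)
        push_cast
        linear_combination -h3 - 3392 * (b * b) * e1
      exact ⟨by linear_combination e1 - 5 * e5, e5⟩
  have hXZ : ∀ g, Z (X g) = X (Z g) := fun g => by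
    rw [Z_apply, Z_apply, Derivation.leibniz, deriv_two, ← hXY, smul_zero, add_zero, smul_eq_mul]
  -- Two `Z`-derivatives of the linear equation leave `3 H (Y A) = 0`.
  have β0 : Y A = 0 := by
    refine hH_zero _ c (cancel 3 (by norm_num) ?_)
    have h1 := congrArg Z (congrArg Z l)
    have Zc : Z (Y A) = 0 := by rw [Z_apply, c, mul_zero]
    have ZZA : Z (Z A) = 0 := by
      rw [Z_apply A, Derivation.leibniz, Zc, deriv_two, smul_zero, smul_zero, add_zero]
    have Zs : Z (Y E) = 4 * X (Y A) := by rw [Z_apply, s]; ring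
    have Z3 := Zn 3
    have Z4 := Zn 4
    push_cast at Z3 Z4 ⊢
    simp only [map_add, Derivation.leibniz, hXZ, Zc, Zs, ZZA, deriv_two, Z3, Z4, hZZF, smul_eq_mul,
      map_zero, mul_zero, add_zero, zero_add] at h1
    linear_combination -h1
  rw [β0, map_zero, mul_zero] at s
  have hYXA : Y (X A) = 0 := by rw [← hXY, β0, map_zero]
  have ZA : Z A = 0 := by rw [Z_apply, β0, mul_zero]
  have ZYE : Z (Y E) = 0 := by rw [Z_apply, s, mul_zero]
  have ZE : Z E = 2 * Y E := Z_apply E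
  -- `E` and `XXE` are now affine in `U`, so two more derivatives remove `XXE`. The resulting `k2`
  -- and its derivative `k3` contain `E` without derivatives in `T`, and eliminating `E` gives the
  -- relation treated by `hH_indep`.
  have k1 : 2 * X (X E) + 2 * ((Y E - 2 * X A) * F) = E * Z F := by
    rw [Z_apply]
    linear_combination 2 * k + 2 * A * hXF
  have k2 : -(2 * Y E + 4 * X A) * H = E * H₁ := by
    have h1 := congrArg Z (congrArg Z k1)
    simp only [map_add, map_sub, Derivation.leibniz, hXZ, ZE, ZYE, ZA, deriv_two, hZZF, hZH,
      smul_eq_mul, map_zero, mul_zero, add_zero, zero_add, sub_zero] at h1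
    linear_combination h1
  have k3 : -(2 * Y E + 4 * X A) * H₁ = E * H₂ + 2 * Y E * H₁ := by
    have h1 := congrArg Z k2
    have Z4 := Zn 4
    push_cast at Z4
    simp only [map_add, map_neg, Derivation.leibniz, hXZ, ZE, ZYE, ZA, deriv_two, Z4, hZH, hZH₁,
      smul_eq_mul, map_zero, mul_zero, add_zero, neg_zero] at h1
    linear_combination h1
  obtain ⟨e1, e2⟩ := hH_indep (-(2 * Y E + 4 * X A)) (2 * Y E)
    (by
      have Y4 := Yn 4
      push_cast at Y4
      simp only [map_neg, map_add, Derivation.leibniz, s, hYXA, deriv_two, Y4, smul_zero, add_zero,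
        neg_zero])
    (by simp only [Derivation.leibniz, s, deriv_two, smul_zero, add_zero])
    (by linear_combination H₂ * k2 - H₁ * k3)
  have γ0 : Y E = 0 := cancel 2 (by norm_num) (by push_cast; exact e2)
  refine ⟨cancel 4 (by norm_num) ?_, β0, hH₁_zero E γ0 ?_⟩
  · push_cast
    linear_combination -e1 - 2 * γ0
  · linear_combination H * e1 - k2

end

/-! ### Power series solution of the hypergeometric equation -/

/-- The radius `1 / (4 r)` is not sharp; it makes the differentiated terms bounded by a multiple of
`n (1/4) ^ n`. -/
theorem hasDerivAt_tsum_pow {c : ℕ → 𝕜} {C r : ℝ} (hr : 0 < r) (hc : ∀ n, ‖c n‖ ≤ C * r ^ n) {z : 𝕜}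
    (hz : ‖z‖ < (4 * r)⁻¹) :
    HasDerivAt (fun z => ∑' n, c n * z ^ n) (∑' n, ((n + 1 : ℕ) * c (n + 1)) * z ^ n) z := by
  have hC : 0 ≤ C := by simpa using (norm_nonneg _).trans (hc 0)
  have hu : Summable fun n : ℕ => 4 * C * r * ((n : ℝ) ^ 1 * (1 / 4 : ℝ) ^ n) := by
    have h14 : ‖(1 / 4 : ℝ)‖ < 1 := by
      rw [Real.norm_eq_abs, abs_of_pos] <;> norm_num
    exact (summable_pow_mul_geometric_of_norm_lt_one 1 h14).mul_left (4 * C * r)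
  have hbound : ∀ (n : ℕ) (y : 𝕜), y ∈ Metric.ball (0 : 𝕜) (4 * r)⁻¹ →
      ‖c n * (n * y ^ (n - 1))‖ ≤ 4 * C * r * ((n : ℝ) ^ 1 * (1 / 4 : ℝ) ^ n) := by
    intro n y hy
    rw [mem_ball_zero_iff] at hy
    cases n with
    | zero => simp
    | succ n =>
      rw [norm_mul, norm_mul, norm_pow, RCLike.norm_natCast, Nat.add_sub_cancel]
      calc ‖c (n + 1)‖ * ((n + 1 : ℕ) * ‖y‖ ^ n)
          ≤ C * r ^ (n + 1) * ((n + 1 : ℕ) * (4 * r)⁻¹ ^ n) := by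
            gcongr
            exact hc (n + 1)
        _ = _ := by
            have h4 : r ^ n * (4 * r)⁻¹ ^ n = (1 / 4) ^ n := by
              rw [← mul_pow]
              congr 1
              field_simp
            rw [pow_succ, pow_succ (1 / 4 : ℝ), pow_one, ← h4]
            ring
  have h := hasDerivAt_tsum_of_isPreconnected (g := fun n z => c n * z ^ n)
    (g' := fun n z => c n * (n * z ^ (n - 1))) hu Metric.isOpen_ball
    ((convex_ball (E := 𝕜) 0 (4 * r)⁻¹).isPreconnected)
    (fun n y _ => (hasDerivAt_pow n y).const_mul _) hbound
    (Metric.mem_ball_self (by positivity))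
    -- Convergence of the series itself is required at one point only; at `0` just the constant term
    -- survives.
    (summable_of_ne_finset_zero (s := {0}) (fun n hn => by
      rw [Finset.mem_singleton] at hn
      simp [hn])) (mem_ball_zero_iff.2 hz)
  refine h.congr_deriv ?_
  have hs : Summable fun n => c n * (n * z ^ (n - 1)) :=
    Summable.of_norm_bounded hu fun n => hbound n z (mem_ball_zero_iff.2 hz)
  rw [hs.tsum_eq_zero_add]
  simp only [Nat.cast_zero, zero_mul, mul_zero, zero_add, Nat.add_sub_cancel]
  exact tsum_congr fun n => by ring

theorem summable_mul_pow {c : ℕ → 𝕜} {C r : ℝ} (hr : 0 < r) (hc : ∀ n, ‖c n‖ ≤ C * r ^ n) {z : 𝕜}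
    (hz : ‖z‖ < (4 * r)⁻¹) : Summable fun n => c n * z ^ n := by
  have hC : 0 ≤ C := by simpa using (norm_nonneg _).trans (hc 0)
  refine Summable.of_norm_bounded (g := fun n : ℕ => C * (1 / 4 : ℝ) ^ n)
    ((summable_geometric_of_lt_one (by norm_num) (by norm_num)).mul_left _) fun n => ?_
  rw [norm_mul, norm_pow]
  calc ‖c n‖ * ‖z‖ ^ n ≤ C * r ^ n * (4 * r)⁻¹ ^ n := by
        gcongr
        exact hc n
    _ = _ := by
        rw [mul_assoc, ← mul_pow]
        congr 2
        field_simp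

theorem hasSum_mul_pow_of_succ {a : ℕ → 𝕜} {z s : 𝕜} (h0 : a 0 = 0)
    (h : HasSum (fun n => a (n + 1) * z ^ n) s) : HasSum (fun n => a n * z ^ n) (z * s) := by
  refine (hasSum_nat_add_iff' 1).1 ?_
  simp only [Finset.sum_range_one, h0, zero_mul, sub_zero]
  have h2 := h.mul_left z
  rwa [show (fun n => z * (a (n + 1) * z ^ n)) = fun n => a (n + 1) * z ^ (n + 1) from
    funext fun n => by ring] at h2

theorem analyticAt_tsum_pow {c : ℕ → 𝕜} {r : ℝ} (hr : 0 < r) (hc : ∀ n, ‖c n‖ ≤ r ^ n) :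
    AnalyticAt 𝕜 (fun z => ∑' n, c n * z ^ n) 0 := by
  have hrad : 0 < (FormalMultilinearSeries.ofScalars 𝕜 c).radius := by
    refine lt_of_lt_of_le ?_
      (FormalMultilinearSeries.le_radius_of_bound _ (r := ⟨r⁻¹, by positivity⟩) 1 fun n => ?_)
    · exact ENNReal.coe_pos.2 (inv_pos.2 hr : (0 : ℝ) < r⁻¹)
    · rw [FormalMultilinearSeries.ofScalars_norm]
      change ‖c n‖ * r⁻¹ ^ n ≤ 1
      rw [inv_pow]
      exact mul_inv_le_one_of_le₀ (hc n) (by positivity)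
  have h := (FormalMultilinearSeries.ofScalars 𝕜 c).hasFPowerSeriesOnBall hrad
  have h2 : (FormalMultilinearSeries.ofScalars 𝕜 c).sum = fun z => ∑' n, c n * z ^ n := by
    funext z
    simp [FormalMultilinearSeries.sum, mul_comm]
  rw [← h2]
  exact h.analyticAt

/-- Taylor coefficients of a solution of the hypergeometric equation
`4 x (1 - x) u'' + 4 (1 - 2 x) u' - u = 0` at a point `x₀` with `A = x₀ (1 - x₀)`,
`B = 1 - 2 x₀`. -/
def periodCoeff (A B : 𝕜) : ℕ → 𝕜
  | 0 => 1
  | 1 => 0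
  | n + 2 => ((2 * n + 1) ^ 2 * periodCoeff A B n - 4 * B * (n + 1) ^ 2 * periodCoeff A B (n + 1)) /
      (4 * A * (n + 2) * (n + 1))

theorem periodCoeff_rec {A : 𝕜} (hA : A ≠ 0) (B : 𝕜) (n : ℕ) :
    4 * A * (n + 2) * (n + 1) * periodCoeff A B (n + 2) =
      (2 * n + 1) ^ 2 * periodCoeff A B n - 4 * B * (n + 1) ^ 2 * periodCoeff A B (n + 1) := by
  rw [periodCoeff]
  have h1 : (n : 𝕜) + 2 ≠ 0 := by exact_mod_cast (Nat.succ_ne_zero (n + 1))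
  have h2 : (n : 𝕜) + 1 ≠ 0 := by exact_mod_cast (Nat.succ_ne_zero n)
  field_simp

/-- The rate `M` satisfies `M ≥ 1` and `‖A‖ M ≥ 1 + ‖B‖`. This is what the recursion needs, as `(2 n
+ 1)²` and `4 (n + 1)²` are both at most `4 (n + 2) (n + 1)`. -/
theorem norm_periodCoeff_le {A : 𝕜} (hA : A ≠ 0) (B : 𝕜) (n : ℕ) :
    ‖periodCoeff A B n‖ ≤ (1 + (1 + ‖B‖) / ‖A‖) ^ n := by
  have hA' : 0 < ‖A‖ := norm_pos_iff.2 hA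
  set M := 1 + (1 + ‖B‖) / ‖A‖ with hM
  have hM1 : 1 ≤ M := by
    have : 0 ≤ (1 + ‖B‖) / ‖A‖ := by positivity
    linarith
  have hM0 : 0 < M := by linarith
  have hAM : 1 + ‖B‖ ≤ ‖A‖ * M := by
    rw [hM, mul_add, mul_div_cancel₀ _ hA'.ne']
    linarith
  induction n using Nat.twoStepInduction with
  | zero => simp [periodCoeff]
  | one => simpa [periodCoeff] using hM0.le
  | more n h0 h1 =>
    have hK : 0 < (4 * ((n : ℝ) + 2) * (n + 1)) := by positivity
    have h := congrArg norm (periodCoeff_rec hA B n)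
    have e1 : ‖(n : 𝕜) + 2‖ = n + 2 := by
      have := RCLike.norm_natCast (K := 𝕜) (n + 2)
      push_cast at this
      exact this
    have e2 : ‖(n : 𝕜) + 1‖ = n + 1 := by
      have := RCLike.norm_natCast (K := 𝕜) (n + 1)
      push_cast at this
      exact this
    have e3 : ‖2 * (n : 𝕜) + 1‖ = 2 * n + 1 := by
      have := RCLike.norm_natCast (K := 𝕜) (2 * n + 1)
      push_cast at this
      exact this
    have e4 : ‖(4 : 𝕜)‖ = 4 := by
      have := RCLike.norm_natCast (K := 𝕜) 4
      push_cast at this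
      exact this
    have h2 : 4 * ((n : ℝ) + 2) * (n + 1) * (‖A‖ * ‖periodCoeff A B (n + 2)‖) ≤
        4 * ((n : ℝ) + 2) * (n + 1) * (‖A‖ * M ^ (n + 2)) := by
      calc 4 * ((n : ℝ) + 2) * (n + 1) * (‖A‖ * ‖periodCoeff A B (n + 2)‖)
          = ‖4 * A * (n + 2) * (n + 1) * periodCoeff A B (n + 2)‖ := by
            rw [norm_mul, norm_mul, norm_mul, norm_mul, e1, e2, e4]
            ring
        _ ≤ ‖(2 * (n : 𝕜) + 1) ^ 2 * periodCoeff A B n‖ +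
            ‖4 * B * ((n : 𝕜) + 1) ^ 2 * periodCoeff A B (n + 1)‖ := by
            rw [h]
            exact norm_sub_le _ _
        _ = (2 * n + 1) ^ 2 * ‖periodCoeff A B n‖ +
            4 * ‖B‖ * (n + 1) ^ 2 * ‖periodCoeff A B (n + 1)‖ := by
            rw [norm_mul, norm_mul, norm_mul, norm_mul, norm_pow, norm_pow, e2, e3, e4]
        _ ≤ (2 * n + 1) ^ 2 * M ^ (n + 1) + 4 * ‖B‖ * (n + 1) ^ 2 * M ^ (n + 1) := by
            gcongr
            exact h0.trans (pow_le_pow_right₀ hM1 (Nat.le_succ n))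
        _ ≤ 4 * ((n : ℝ) + 2) * (n + 1) * M ^ (n + 1)
            + ‖B‖ * (4 * ((n : ℝ) + 2) * (n + 1)) * M ^ (n + 1) := by
            have hn : (0 : ℝ) ≤ n := Nat.cast_nonneg n
            have hB := norm_nonneg B
            have i1 : (2 * (n : ℝ) + 1) ^ 2 ≤ 4 * ((n : ℝ) + 2) * (n + 1) := by nlinarith
            have i2 : 4 * ((n : ℝ) + 1) ^ 2 ≤ 4 * ((n : ℝ) + 2) * (n + 1) := by nlinarith
            have i3 : 4 * ‖B‖ * ((n : ℝ) + 1) ^ 2 ≤ ‖B‖ * (4 * ((n : ℝ) + 2) * (n + 1)) := by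
              calc 4 * ‖B‖ * ((n : ℝ) + 1) ^ 2 = ‖B‖ * (4 * ((n : ℝ) + 1) ^ 2) := by ring
                _ ≤ _ := mul_le_mul_of_nonneg_left i2 hB
            gcongr
        _ = 4 * ((n : ℝ) + 2) * (n + 1) * ((1 + ‖B‖) * M ^ (n + 1)) := by ring
        _ ≤ 4 * ((n : ℝ) + 2) * (n + 1) * (‖A‖ * M * M ^ (n + 1)) := by gcongr
        _ = _ := by ring
    exact le_of_mul_le_mul_left (le_of_mul_le_mul_left h2 hK) hA'

/-- The singular points `0` and `1` are excluded, so the Taylor series with initial values `1`, `0`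
converges near `x₀`. Any solution that does not vanish at `x₀` would serve. -/
theorem exists_hypergeometric {x₀ : 𝕜} (h0 : x₀ ≠ 0) (h1 : x₀ ≠ 1) :
    ∃ f f₁ f₂ : 𝕜 → 𝕜, f x₀ ≠ 0 ∧ ∀ᶠ x in 𝓝 x₀, ContDiffAt 𝕜 ∞ f x ∧ HasDerivAt f (f₁ x) x ∧
      HasDerivAt f₁ (f₂ x) x ∧ 4 * x * (1 - x) * f₂ x + 4 * (1 - 2 * x) * f₁ x - f x = 0 := by
  have hA : x₀ * (1 - x₀) ≠ 0 := mul_ne_zero h0 (sub_ne_zero.2 h1.symm)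
  set A := x₀ * (1 - x₀) with hAdef
  set B := 1 - 2 * x₀ with hBdef
  set c := periodCoeff A B with hc
  set r := 1 + (1 + ‖B‖) / ‖A‖ with hr
  have hr0 : 0 < r := by positivity
  have hr1 : 0 < 2 * r := by positivity
  have hr2 : 0 < 2 * (2 * r) := by positivity
  have b0 : ∀ n, ‖c n‖ ≤ 1 * r ^ n := fun n => by rw [one_mul]; exact norm_periodCoeff_le hA B n
  -- Since `n + 1 ≤ 2 ^ n`, each differentiation at most doubles the geometric rate.
  have step : ∀ {d : ℕ → 𝕜} {C s : ℝ}, 0 < s → (∀ n, ‖d n‖ ≤ C * s ^ n) →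
      ∀ n, ‖((n + 1 : ℕ) : 𝕜) * d (n + 1)‖ ≤ C * s * (2 * s) ^ n := by
    intro d C s hs h n
    have hC : 0 ≤ C := by simpa using (norm_nonneg _).trans (h 0)
    rw [norm_mul, RCLike.norm_natCast]
    have hn : ((n + 1 : ℕ) : ℝ) ≤ 2 ^ n := by exact_mod_cast Nat.lt_two_pow_self
    calc ((n + 1 : ℕ) : ℝ) * ‖d (n + 1)‖ ≤ 2 ^ n * (C * s ^ (n + 1)) := by
          gcongr
          exact h (n + 1)
      _ = _ := by rw [mul_pow, pow_succ]; ring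
  have b1 := step hr0 b0
  have b2 := step hr1 b1
  have hball : ∀ᶠ x in 𝓝 x₀, ‖x - x₀‖ < (4 * (2 * (2 * r)))⁻¹ := by
    filter_upwards [Metric.ball_mem_nhds x₀ (inv_pos.2 (by positivity : 0 < 4 * (2 * (2 * r))))]
      with x hx using mem_ball_iff_norm.1 hx
  have han : AnalyticAt 𝕜 (fun x => ∑' n, c n * (x - x₀) ^ n) x₀ := by
    have := analyticAt_tsum_pow hr0 (norm_periodCoeff_le hA B)
    have h2 : AnalyticAt 𝕜 (fun x => x - x₀) x₀ := analyticAt_id.sub analyticAt_const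
    exact AnalyticAt.comp_of_eq (f := fun x => x - x₀) this h2 (sub_self x₀)
  have hsub : ∀ {g : 𝕜 → 𝕜} {g' x : 𝕜}, HasDerivAt g g' (x - x₀) →
      HasDerivAt (fun x => g (x - x₀)) g' x := fun h => h.comp_sub_const _ x₀
  refine ⟨fun x => ∑' n, c n * (x - x₀) ^ n, fun x => ∑' n, ((n + 1 : ℕ) * c (n + 1)) * (x - x₀) ^ n,
    fun x => ∑' n, ((n + 1 : ℕ) * ((n + 1 + 1 : ℕ) * c (n + 1 + 1))) * (x - x₀) ^ n, ?_, ?_⟩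
  · have : ∑' n, c n * (x₀ - x₀) ^ n = 1 := by
      rw [tsum_eq_single 0 fun n hn => by simp [hn]]
      simp [hc, periodCoeff]
    exact ne_of_eq_of_ne this one_ne_zero
  · filter_upwards [hball, han.eventually_analyticAt] with x hx hxa
    have hle1 : (4 * (2 * (2 * r)))⁻¹ ≤ (4 * (2 * r))⁻¹ := by gcongr; linarith
    have hle2 : (4 * (2 * r))⁻¹ ≤ (4 * r)⁻¹ := by gcongr; linarith
    have hx1 := hx.trans_le hle1
    have hx0 := hx1.trans_le hle2
    refine ⟨hxa.contDiffAt, hsub (hasDerivAt_tsum_pow hr0 b0 hx0),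
      hsub (hasDerivAt_tsum_pow hr1 b1 hx1), ?_⟩
    have s0 := (summable_mul_pow hr0 b0 hx0).hasSum
    have s1 := (summable_mul_pow hr1 b1 hx1).hasSum
    have s2 := (summable_mul_pow hr2 b2 hx).hasSum
    generalize ∑' n, c n * (x - x₀) ^ n = S0 at *
    generalize ∑' n, ((n + 1 : ℕ) * c (n + 1)) * (x - x₀) ^ n = S1 at *
    generalize ∑' n, ((n + 1 : ℕ) * ((n + 1 + 1 : ℕ) * c (n + 1 + 1))) * (x - x₀) ^ n = S2 at *
    obtain ⟨z, hz⟩ : ∃ z, z = x - x₀ := ⟨_, rfl⟩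
    rw [← hz] at s0 s1 s2
    have t1 : HasSum (fun n : ℕ => (n * c n) * z ^ n) (z * S1) :=
      hasSum_mul_pow_of_succ (a := fun n => n * c n) (by simp) s1
    have t2 : HasSum (fun n : ℕ => (n * ((n + 1 : ℕ) * c (n + 1))) * z ^ n) (z * S2) :=
      hasSum_mul_pow_of_succ (a := fun n => n * ((n + 1 : ℕ) * c (n + 1))) (by simp) s2
    have t3 : HasSum (fun n : ℕ => (((n : 𝕜) - 1) * (n * c n)) * z ^ n) (z * (z * S2)) :=
      hasSum_mul_pow_of_succ (a := fun n => ((n : 𝕜) - 1) * (n * c n)) (by simp)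
        (by convert t2 using 3; push_cast; ring)
    -- With `z = x - x₀` one has `x (1 - x) = A + B z - z²` and `1 - 2 x = B - 2 z`. The terms of
    -- this series are the left side of the differential equation, and they vanish by the recursion.
    have total := ((((s2.mul_left (4 * A)).add (t2.mul_left (4 * B))).sub (t3.mul_left 4)).add
      ((s1.mul_left (4 * B)).sub (t1.mul_left 8))).sub s0
    have hzero : ∀ n : ℕ, 4 * A * (((n + 1 : ℕ) * ((n + 1 + 1 : ℕ) * c (n + 1 + 1))) * z ^ n)
        + 4 * B * ((n * ((n + 1 : ℕ) * c (n + 1))) * z ^ n)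
        - 4 * ((((n : 𝕜) - 1) * (n * c n)) * z ^ n)
        + (4 * B * (((n + 1 : ℕ) * c (n + 1)) * z ^ n) - 8 * ((n * c n) * z ^ n))
        - c n * z ^ n = 0 := fun n => by
      have := periodCoeff_rec hA B n
      rw [← hc] at this
      push_cast
      linear_combination (z ^ n) * this
    simp only [hzero] at total
    have := total.unique hasSum_zero
    rw [hAdef, hBdef, hz] at this
    linear_combination this

/-! ### From flat solutions to the symmetry algebra -/

namespace SmoothGerm

variable {q₀ : 𝕜 × 𝕜}

/-- The germ of a constant function. -/
def const (c : 𝕜) : SmoothGerm q₀ := mk (fun _ => c) (Eventually.of_forall fun _ => contDiffAt_const)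

theorem dir_const (v : 𝕜 × 𝕜) (c : 𝕜) : dir v (const c : SmoothGerm q₀) = 0 := by
  rw [const, ← algebraMap_eq_mk, Derivation.map_algebraMap]

theorem smul_eq_smul_one_mul (c : 𝕜) (g : SmoothGerm q₀) :
    c • g = (c • (1 : SmoothGerm q₀)) * g := by rw [smul_mul_assoc, one_mul]

theorem isUnit_const {c : 𝕜} (hc : c ≠ 0) : IsUnit (const c : SmoothGerm q₀) := isUnit_mk hc

theorem const_ofNat (n : ℕ) [n.AtLeastTwo] :
    (const (OfNat.ofNat n) : SmoothGerm q₀) = OfNat.ofNat n := by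
  rw [const, ← algebraMap_eq_mk, map_ofNat]

theorem const_zero : (const 0 : SmoothGerm q₀) = 0 := by
  rw [const, ← algebraMap_eq_mk, map_zero]

theorem const_neg_one : (const (-1) : SmoothGerm q₀) = -1 := by
  rw [const, ← algebraMap_eq_mk, map_neg, map_one]

theorem const_one : (const 1 : SmoothGerm q₀) = 1 := by
  rw [const, ← algebraMap_eq_mk, map_one]

theorem dy_dx (g : SmoothGerm q₀) : dy (dx g) = dx (dy g) := dir_comm _ _ g

instance : Nontrivial (SmoothGerm q₀) := by
  refine ⟨⟨1, 0, fun h => ?_⟩⟩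
  have h2 : ∀ᶠ q in 𝓝 q₀, (1 : 𝕜) = 0 := Germ.coe_eq.1 (congrArg Subtype.val h)
  exact one_ne_zero h2.self_of_nhds

theorem eventually_contDiffAt_comp_fst {f : 𝕜 → 𝕜} (hf : ∀ᶠ x in 𝓝 q₀.1, ContDiffAt 𝕜 ∞ f x) :
    ∀ᶠ q in 𝓝 q₀, ContDiffAt 𝕜 ∞ (fun q : 𝕜 × 𝕜 => f q.1) q := by
  filter_upwards [continuous_fst.continuousAt.eventually hf] with q hq
  exact hq.comp q contDiffAt_fst

/-- The germ of a function of `x`. -/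
def ofX (f : 𝕜 → 𝕜) (hf : ∀ᶠ x in 𝓝 q₀.1, ContDiffAt 𝕜 ∞ f x) : SmoothGerm q₀ :=
  mk (fun q => f q.1) (eventually_contDiffAt_comp_fst hf)

theorem dir_ofX {f f' : 𝕜 → 𝕜} {hf : ∀ᶠ x in 𝓝 q₀.1, ContDiffAt 𝕜 ∞ f x}
    (h : ∀ᶠ x in 𝓝 q₀.1, HasDerivAt f (f' x) x) (hf' : ∀ᶠ x in 𝓝 q₀.1, ContDiffAt 𝕜 ∞ f' x) :
    dx (ofX f hf) = ofX f' hf' ∧ dy (ofX f hf) = 0 := by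
  have key : ∀ᶠ q in 𝓝 q₀, HasFDerivAt (fun q : 𝕜 × 𝕜 => f q.1)
      (f' q.1 • ContinuousLinearMap.fst 𝕜 𝕜 𝕜) q := by
    filter_upwards [continuous_fst.continuousAt.eventually h] with q hq
    exact hq.comp_hasFDerivAt q hasFDerivAt_fst
  constructor
  · rw [ofX, dir_mk]
    refine mk_eq_mk.2 ?_
    filter_upwards [key] with q hq
    rw [hq.fderiv]
    simp
  · rw [ofX, dir_mk]
    refine mk_eq_zero.2 ?_
    filter_upwards [key] with q hq
    rw [hq.fderiv]
    simp

theorem eventually_contDiffAt_inv {f : 𝕜 × 𝕜 → 𝕜} (hf : ∀ᶠ q in 𝓝 q₀, ContDiffAt 𝕜 ∞ f q)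
    (h0 : f q₀ ≠ 0) : ∀ᶠ q in 𝓝 q₀, ContDiffAt 𝕜 ∞ (fun q => (f q)⁻¹) q := by
  filter_upwards [hf, hf.self_of_nhds.continuousAt.eventually_ne h0] with q h1 h2 using h1.inv h2

/-- The germ of the inverse of a function that does not vanish at `q₀`. -/
def invMk (f : 𝕜 × 𝕜 → 𝕜) (hf : ∀ᶠ q in 𝓝 q₀, ContDiffAt 𝕜 ∞ f q) (h0 : f q₀ ≠ 0) :
    SmoothGerm q₀ :=
  mk (fun q => (f q)⁻¹) (eventually_contDiffAt_inv hf h0)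

theorem invMk_mul (f : 𝕜 × 𝕜 → 𝕜) (hf : ∀ᶠ q in 𝓝 q₀, ContDiffAt 𝕜 ∞ f q) (h0 : f q₀ ≠ 0) :
    invMk f hf h0 * mk f hf = 1 := by
  apply Subtype.ext
  apply Germ.coe_eq.2
  filter_upwards [hf.self_of_nhds.continuousAt.eventually_ne h0] with q h using inv_mul_cancel₀ h

end SmoothGerm

open SmoothGerm

namespace Frame

variable {q₀ : 𝕜 × 𝕜} {B C D F : SmoothGerm q₀} (φ : Frame dx dy B C D F)

/-- The components in the coordinates `x`, `y` of the field with components `A`, `E` in the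
coordinates `T`, `U`. -/
def toField : SmoothGerm q₀ × SmoothGerm q₀ →ₗ[𝕜] SmoothGerm q₀ × SmoothGerm q₀ where
  toFun g := (φ.ρ * g.1, φ.σ * (g.2 - φ.v * (φ.ρ * g.1)))
  map_add' g h := by ext1 <;> dsimp only [Prod.fst_add, Prod.snd_add] <;> ring
  map_smul' c g := by
    rw [RingHom.id_apply]
    ext1
    · exact mul_smul_comm c φ.ρ g.1
    · dsimp only [Prod.smul_fst, Prod.smul_snd]
      rw [smul_eq_smul_one_mul c g.1, smul_eq_smul_one_mul c g.2, smul_eq_smul_one_mul c (φ.σ * _)]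
      ring

theorem toField_apply (A E : SmoothGerm q₀) :
    φ.toField (A, E) = (φ.ρ * A, φ.σ * (E - φ.v * (φ.ρ * A))) := rfl

theorem smul_pair_add_smul_pair (a b : 𝕜) (g h : SmoothGerm q₀ × SmoothGerm q₀) :
    a • pair (φ.toField g) + b • pair (φ.toField h) = pair (φ.toField (a • g + b • h)) := by
  simp only [map_add, map_smul]

theorem toField_injective : Function.Injective φ.toField := by
  rw [injective_iff_map_eq_zero]
  rintro ⟨A, E⟩ h
  rw [toField_apply, Prod.mk_eq_zero] at h
  obtain ⟨h1, h2⟩ := h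
  have hA : A = 0 := by linear_combination φ.τ * h1 - A * φ.mul_τ
  have hE : E = 0 := by
    linear_combination φ.w * h2 + φ.v * h1 - (E - φ.v * (φ.ρ * A)) * φ.mul_w
  rw [hA, hE]
  rfl

theorem mem_symmetryAlgebra_iff {f : 𝕜 → 𝕜 → 𝕜 → 𝕜} (hf : IsQuadratic f B C D)
    (g : Germ (𝓝 q₀) (𝕜 × 𝕜)) :
    g ∈ symmetryAlgebra f q₀ ↔
      ∃ A E : SmoothGerm q₀, Flat φ.X φ.Y F A E ∧ pair (φ.toField (A, E)) = g := by
  rw [SmoothGerm.mem_symmetryAlgebra_iff hf]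
  constructor
  · rintro ⟨ξ, η, hd, rfl⟩
    refine ⟨φ.τ * ξ, φ.v * ξ + φ.w * η, (φ.determining_iff_flat dy_dx ξ η).1 hd, ?_⟩
    congr 1
    rw [toField_apply]
    ext1
    · linear_combination ξ * φ.mul_τ
    · linear_combination η * φ.mul_w - φ.σ * φ.v * ξ * φ.mul_τ
  · rintro ⟨A, E, hfl, rfl⟩
    refine ⟨_, _, (φ.determining_iff_flat dy_dx _ _).2 ?_, rfl⟩
    rw [show φ.τ * (φ.ρ * A) = A by linear_combination A * φ.mul_τ,
      show φ.v * (φ.ρ * A) + φ.w * (φ.σ * (E - φ.v * (φ.ρ * A))) = E by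
        linear_combination (E - φ.v * (φ.ρ * A)) * φ.mul_w]
    exact hfl

theorem exists_eq_smul_one {g : SmoothGerm q₀} (hX : φ.X g = 0) (hY : φ.Y g = 0) :
    ∃ c : 𝕜, g = c • (1 : SmoothGerm q₀) := by
  rw [Y_apply] at hY
  have h2 : dy g = 0 := by linear_combination φ.w * hY - dy g * φ.mul_w
  rw [X_apply, h2] at hX
  have h1 : dx g = 0 := by linear_combination φ.τ * hX - dx g * φ.mul_τ
  obtain ⟨c, hc⟩ := exists_eq_algebraMap h1 h2
  exact ⟨c, hc.trans (Algebra.algebraMap_eq_smul_one c)⟩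

/-- Only here are `T` and `U` themselves needed, as primitives of `(τ, 0)` and `(v, w)`. The algebra
is then the injective image of the eight parameters of a projective field. -/
theorem finrank_eq_eight {B C D : SmoothGerm q₀} (φ : Frame dx dy B C D 0)
    {f : 𝕜 → 𝕜 → 𝕜 → 𝕜} (hf : IsQuadratic f B C D) :
    Module.finrank 𝕜 (symmetryAlgebra f q₀) = 8 := by
  obtain ⟨T, hT1, hT2⟩ := exists_primitive (a := φ.τ) (b := 0) (by rw [φ.dy_τ, map_zero])
  obtain ⟨U, hU1, hU2⟩ := exists_primitive (a := φ.v) (b := φ.w) φ.closed.symm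
  have hXT : φ.X T = 1 := by
    rw [X_apply, hT1, hT2]
    linear_combination φ.mul_τ
  have hYT : φ.Y T = 0 := by rw [Y_apply, hT2, mul_zero]
  have hXU : φ.X U = 0 := by
    rw [X_apply, hU1, hU2]
    linear_combination -φ.ρ * φ.v * φ.mul_w
  have hYU : φ.Y U = 1 := by
    rw [Y_apply, hU2]
    exact φ.mul_w
  let Ψ : (Fin 8 → 𝕜) →ₗ[𝕜] Germ (𝓝 q₀) (𝕜 × 𝕜) := pair ∘ₗ φ.toField ∘ₗ projectiveField T U
  have hΨ : Function.Injective Ψ := pair_injective.comp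
    (φ.toField_injective.comp (projectiveField_injective hXT hYT hXU hYU))
  have hrange : symmetryAlgebra f q₀ = LinearMap.range Ψ := by
    ext g
    rw [φ.mem_symmetryAlgebra_iff hf, LinearMap.mem_range]
    constructor
    · rintro ⟨A, E, h, rfl⟩
      obtain ⟨c, hc⟩ := (flat_zero_iff (φ.XY_comm dy_dx) (fun g => φ.exists_eq_smul_one)
        hXT hYT hXU hYU A E).1 h
      exact ⟨c, by rw [← hc]; rfl⟩
    · rintro ⟨c, rfl⟩
      exact ⟨_, _, (flat_zero_iff (φ.XY_comm dy_dx) (fun g => φ.exists_eq_smul_one)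
        hXT hYT hXU hYU _ _).2 ⟨c, rfl⟩, rfl⟩
  rw [hrange, LinearMap.finrank_range_of_inj hΨ, Module.finrank_fin_fun]

/-- The symmetries of `U'' = k e^(n (T + ε U))`. -/
theorem symmetryAlgebra_eq_span_pair {f : 𝕜 → 𝕜 → 𝕜 → 𝕜} (hf : IsQuadratic f B C D) {ε T : SmoothGerm q₀}
    {n : ℕ} (hn : n ≠ 0) {m : SmoothGerm q₀} (hm : n * m = 2) (hXm : φ.X m = 0) (hYm : φ.Y m = 0)
    (hF : IsUnit F) (hε : ε ^ 2 = 1) (hYε : φ.Y ε = 0)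
    (hXε : φ.X ε = 0) (hXF : φ.X F = n * F) (hYF : φ.Y F = ε * n * F) (hXT : φ.X T = 1)
    (hYT : φ.Y T = 0) :
    symmetryAlgebra f q₀ = Submodule.span 𝕜
      {pair (φ.toField (1, -ε)), pair (φ.toField (T - m, -(ε * T)))} := by
  have hnm : ∀ {z : SmoothGerm q₀}, (n : SmoothGerm q₀) * z = 0 → z = 0 :=
    fun h => eq_zero_of_natCast_mul 𝕜 n hn h
  ext g
  rw [φ.mem_symmetryAlgebra_iff hf, Submodule.mem_span_pair]
  simp only [flat_exp_iff (φ.XY_comm dy_dx) hn hF hε hYε hXε hXF hYF]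
  constructor
  · rintro ⟨A, E, ⟨hYA, hXXA, hE⟩, rfl⟩
    obtain ⟨b, hb⟩ := φ.exists_eq_smul_one hXXA (by rw [← φ.XY_comm dy_dx, hYA, map_zero])
    have hXb : φ.X (b • (1 : SmoothGerm q₀)) = 0 := by simp
    have hYb : φ.Y (b • (1 : SmoothGerm q₀)) = 0 := by simp
    -- `A` is affine in `T`. Writing it as `a + b (T - m)` with `m = 2 / n` turns `E = -ε (A + m b)`
    -- into `-ε (a + b T)`.
    obtain ⟨a, ha⟩ := φ.exists_eq_smul_one (g := A - (b • (1 : SmoothGerm q₀)) * (T - m))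
      (by simp only [map_sub, Derivation.leibniz, hXb, hXm, hXT, smul_eq_mul, hb]; ring)
      (by simp only [map_sub, Derivation.leibniz, hYb, hYm, hYT, smul_eq_mul, hYA]; ring)
    refine ⟨a, b, ?_⟩
    rw [smul_pair_add_smul_pair]
    congr 2
    have hEE : E = -(ε * (A + m * (b • (1 : SmoothGerm q₀)))) := by
      refine sub_eq_zero.1 (hnm ?_)
      rw [hb] at hE
      linear_combination hE + ε * (b • (1 : SmoothGerm q₀)) * hm
    have e := smul_eq_smul_one_mul (q₀ := q₀)
    ext1
    · simp only [Prod.fst_add, Prod.smul_fst]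
      rw [e b, e a]
      linear_combination -ha
    · simp only [Prod.snd_add, Prod.smul_snd]
      rw [e b, e a, hEE]
      linear_combination ε * ha
  · rintro ⟨a, b, rfl⟩
    have e := smul_eq_smul_one_mul (q₀ := q₀)
    have hXb : ∀ b : 𝕜, φ.X (b • (1 : SmoothGerm q₀)) = 0 := by simp
    have hYb : ∀ b : 𝕜, φ.Y (b • (1 : SmoothGerm q₀)) = 0 := by simp
    have hXA : φ.X ((a • ((1 : SmoothGerm q₀), -ε) + b • (T - m, -(ε * T))).1) =
        b • (1 : SmoothGerm q₀) := by
      simp only [Prod.fst_add, Prod.smul_fst]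
      rw [e a 1, e b]
      simp only [map_add, map_sub, Derivation.leibniz, hXb, hXT, hXm, smul_eq_mul,
        Derivation.map_one_eq_zero]
      ring
    refine ⟨(a • ((1 : SmoothGerm q₀), -ε) + b • (T - m, -(ε * T))).1,
      (a • ((1 : SmoothGerm q₀), -ε) + b • (T - m, -(ε * T))).2, ⟨?_, ?_, ?_⟩, ?_⟩
    · simp only [Prod.fst_add, Prod.smul_fst]
      rw [e a 1, e b]
      simp only [map_add, map_sub, Derivation.leibniz, hYb, hYT, hYm, smul_eq_mul,
        Derivation.map_one_eq_zero]
      ring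
    · rw [hXA, hXb]
    · rw [hXA]
      simp only [Prod.fst_add, Prod.smul_fst, Prod.snd_add, Prod.smul_snd]
      rw [e a 1, e b (T - m), e a (-ε), e b (-(ε * T))]
      linear_combination (-ε * (b • (1 : SmoothGerm q₀))) * hm
    · rw [smul_pair_add_smul_pair]

theorem finrank_span_pair {ε T m : SmoothGerm q₀} (hXm : φ.X m = 0) (hXT : φ.X T = 1) :
    Module.finrank 𝕜 (Submodule.span 𝕜
      {pair (φ.toField (1, -ε)), pair (φ.toField (T - m, -(ε * T)))}) = 2 := by
  have hli : LinearIndependent 𝕜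
      ![pair (φ.toField (1, -ε)), pair (φ.toField (T - m, -(ε * T)))] := by
    rw [LinearIndependent.pair_iff]
    intro a b h
    rw [smul_pair_add_smul_pair] at h
    have h1 := (injective_iff_map_eq_zero _).1 φ.toField_injective _
      ((injective_iff_map_eq_zero _).1 pair_injective _ h)
    have h2 : a • (1 : SmoothGerm q₀) + b • (T - m) = 0 := congrArg Prod.fst h1
    have h3 := congrArg φ.X h2
    have hs : ∀ c : 𝕜, c • (1 : SmoothGerm q₀) = 0 → c = 0 := fun c hc => by
      rw [← Algebra.algebraMap_eq_smul_one] at hc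
      exact (FaithfulSMul.algebraMap_eq_zero_iff 𝕜 _).1 hc
    have hb : b = 0 := by
      refine hs b ?_
      rw [map_add, Derivation.map_smul, Derivation.map_smul, map_sub, hXm, hXT,
        Derivation.map_one_eq_zero, map_zero] at h3
      simpa using h3
    rw [hb, zero_smul, add_zero] at h2
    exact ⟨hs a h2, hb⟩
  have := finrank_span_eq_card hli
  rwa [Matrix.range_cons_cons_empty, Fintype.card_fin] at this

theorem finrank_span_singleton {g : SmoothGerm q₀ × SmoothGerm q₀} (hg : g ≠ 0) :
    Module.finrank 𝕜 (Submodule.span 𝕜 {pair (φ.toField g)}) = 1 :=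
  _root_.finrank_span_singleton fun h => hg
    ((injective_iff_map_eq_zero _).1 φ.toField_injective _
      ((injective_iff_map_eq_zero _).1 pair_injective _ h))

theorem symmetryAlgebra_eq_span_singleton {f : 𝕜 → 𝕜 → 𝕜 → 𝕜} (hf : IsQuadratic f B C D)
    {ε : SmoothGerm q₀}
    (h : ∀ A E, Flat φ.X φ.Y F A E ↔ φ.X A = 0 ∧ φ.Y A = 0 ∧ E = -(ε * A)) :
    symmetryAlgebra f q₀ = Submodule.span 𝕜 {pair (φ.toField (1, -ε))} := by
  ext g
  rw [φ.mem_symmetryAlgebra_iff hf, Submodule.mem_span_singleton]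
  simp only [h]
  constructor
  · rintro ⟨A, E, ⟨h1, h2, rfl⟩, rfl⟩
    obtain ⟨c, rfl⟩ := φ.exists_eq_smul_one h1 h2
    refine ⟨c, ?_⟩
    rw [← map_smul, ← map_smul, Prod.smul_mk, smul_neg, mul_smul_comm, mul_one]
  · rintro ⟨c, rfl⟩
    refine ⟨c • 1, c • -ε, ⟨by simp, by simp, ?_⟩, ?_⟩
    · rw [smul_neg, mul_smul_comm, mul_one]
    · rw [← map_smul, ← map_smul, Prod.smul_mk]

end Frame

/-! ### The equations `PIII` -/

section

variable {R : Type*} [CommRing R] [Algebra 𝕜 R]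

/-- Coordinates `x`, `y` with the partial derivatives `dx`, `dy`, and their inverses. -/
structure IsCoordinates (dx dy : Derivation 𝕜 R R) (x y ix iy : R) : Prop where
  mul_x : x * ix = 1
  mul_y : y * iy = 1
  dx_x : dx x = 1
  dy_x : dy x = 0
  dx_y : dx y = 0
  dy_y : dy y = 1

namespace IsCoordinates

variable {dx dy : Derivation 𝕜 R R} {x y ix iy : R}

theorem dx_ix (h : IsCoordinates dx dy x y ix iy) : dx ix = -(ix * ix) :=
  deriv_inv (by rw [mul_comm]; exact h.mul_x) (by rw [h.dx_x, mul_comm]; exact h.mul_x.symm)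

theorem dy_ix (h : IsCoordinates dx dy x y ix iy) : dy ix = 0 :=
  (deriv_inv (c := 0) (by rw [mul_comm]; exact h.mul_x) (by rw [h.dy_x, zero_mul])).trans (by ring)

theorem dx_iy (h : IsCoordinates dx dy x y ix iy) : dx iy = 0 :=
  (deriv_inv (c := 0) (by rw [mul_comm]; exact h.mul_y) (by rw [h.dx_y, zero_mul])).trans (by ring)

theorem dy_iy (h : IsCoordinates dx dy x y ix iy) : dy iy = -(iy * iy) :=
  deriv_inv (by rw [mul_comm]; exact h.mul_y) (by rw [h.dy_y, mul_comm]; exact h.mul_y.symm)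

/-- The change of variables `T = ln x`, `U = ln y`. -/
def logFrame (h : IsCoordinates dx dy x y ix iy) {D F : R} (hF : F = x ^ 2 * iy * D) :
    Frame dx dy iy (-ix) D F where
  τ := ix
  ρ := x
  w := iy
  σ := y
  v := 0
  κ := -ix
  mul_τ := h.mul_x
  mul_w := h.mul_y
  dx_τ := by rw [h.dx_ix]; ring
  dy_τ := h.dy_ix
  closed := by rw [h.dx_iy, map_zero]
  dy_w := h.dy_iy
  dy_v := by rw [map_zero]; ring
  dx_v := by
    rw [map_zero, hF]
    linear_combination -iy * D * (x * ix + 1) * h.mul_x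

theorem logFrame_X (h : IsCoordinates dx dy x y ix iy) {D F : R} (hF : F = x ^ 2 * iy * D) (g : R) :
    (h.logFrame hF).X g = x * dx g := by
  rw [Frame.X_apply]
  change x * (dx g - 0 * y * dy g) = _
  ring

theorem logFrame_Y (h : IsCoordinates dx dy x y ix iy) {D F : R} (hF : F = x ^ 2 * iy * D) (g : R) :
    (h.logFrame hF).Y g = y * dy g := rfl

end IsCoordinates

end

namespace SmoothGerm

variable {q₀ : 𝕜 × 𝕜}

/-- The germ of `1/x`. -/
def invX (hx : q₀.1 ≠ 0) : SmoothGerm q₀ :=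
  invMk (fun q => q.1) (Eventually.of_forall fun _ => contDiffAt_fst) hx

/-- The germ of `1/y`. -/
def invY (hy : q₀.2 ≠ 0) : SmoothGerm q₀ :=
  invMk (fun q => q.2) (Eventually.of_forall fun _ => contDiffAt_snd) hy

theorem isCoordinates (hx : q₀.1 ≠ 0) (hy : q₀.2 ≠ 0) :
    IsCoordinates (dx : Derivation 𝕜 (SmoothGerm q₀) _) dy x y (invX hx) (invY hy) where
  mul_x := by rw [mul_comm]; exact invMk_mul _ _ _
  mul_y := by rw [mul_comm]; exact invMk_mul _ _ _
  dx_x := dx_x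
  dy_x := dy_x
  dx_y := dx_y
  dy_y := dy_y

/-- The part of `PIII(a, b, c, d)` that does not depend on `y'`. -/
def constPIII (hx : q₀.1 ≠ 0) (hy : q₀.2 ≠ 0) (a b c d : 𝕜) : SmoothGerm q₀ :=
  invX hx * (const a * (y * y) + const b) + const c * (y * y * y) + const d * invY hy

theorem isQuadratic_PIII (hx : q₀.1 ≠ 0) (hy : q₀.2 ≠ 0) (a b c d : 𝕜) :
    IsQuadratic (PIII a b c d) (invY hy) (-invX hx) (constPIII hx hy a b c d) :=
  ⟨fun q => q.2⁻¹, fun q => -q.1⁻¹,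
    fun q => q.1⁻¹ * (a * (q.2 * q.2) + b) + c * (q.2 * q.2 * q.2) + d * q.2⁻¹, rfl, rfl, rfl,
    Eventually.of_forall fun q p => by simp only [PIII]; ring⟩

theorem finrank_PIII (hx : q₀.1 ≠ 0) (hy : q₀.2 ≠ 0) :
    Module.finrank 𝕜 (symmetryAlgebra (PIII 0 0 0 0) q₀) = 8 := by
  refine ((isCoordinates hx hy).logFrame ?_).finrank_eq_eight (isQuadratic_PIII hx hy 0 0 0 0)
  rw [constPIII, const_zero]
  ring

/-- The germ of a logarithm is smooth. -/
theorem eventually_contDiffAt_log {ln : 𝕜 → 𝕜} {x₀ : 𝕜} (hx : x₀ ≠ 0) (h : IsLocalLog ln x₀) :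
    ∀ᶠ x in 𝓝 x₀, ContDiffAt 𝕜 ∞ ln x := by
  obtain ⟨ε, hε, H⟩ := Metric.eventually_nhds_iff_ball.1 (h.and (isOpen_ne.eventually_mem hx))
  have : ContDiffOn 𝕜 ∞ ln (Metric.ball x₀ ε) := by
    rw [contDiffOn_infty_iff_deriv_of_isOpen Metric.isOpen_ball]
    refine ⟨fun z hz => (H z hz).1.differentiableAt.differentiableWithinAt, fun z hz => ?_⟩
    exact (contDiffAt_inv 𝕜 (H z hz).2).contDiffWithinAt.congr (fun r hr => (H r hr).1.deriv)
      (H z hz).1.deriv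
  filter_upwards [Metric.ball_mem_nhds x₀ hε] with z hz
  exact this.contDiffAt (Metric.isOpen_ball.mem_nhds hz)

theorem exists_isLocalLog {x₀ : 𝕜} (hx : x₀ ≠ 0) : ∃ ln : 𝕜 → 𝕜, IsLocalLog ln x₀ := by
  obtain ⟨ε, hε, H⟩ := Metric.eventually_nhds_iff_ball.1 (isOpen_ne.eventually_mem hx)
  obtain ⟨f, hf⟩ := (convex_ball x₀ ε).exists_forall_hasDerivWithinAt (𝕜 := 𝕜) (f := fun z => z⁻¹)
    (fun z hz => (differentiableAt_inv (H z hz)).differentiableWithinAt)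
  exact ⟨f, Metric.eventually_nhds_iff_ball.2 ⟨ε, hε, fun z hz =>
    (hf z hz).hasDerivAt (Metric.isOpen_ball.mem_nhds hz)⟩⟩

theorem const_eq_algebraMap (c : 𝕜) : (const c : SmoothGerm q₀) = algebraMap 𝕜 _ c :=
  (algebraMap_eq_mk c).symm

theorem const_sq_eq_one {ε : 𝕜} (hε : ε ^ 2 = 1) : (const ε : SmoothGerm q₀) ^ 2 = 1 := by
  rw [const_eq_algebraMap, ← map_pow, hε, map_one]

theorem eventually_contDiffAt_deriv_log {x₀ : 𝕜} (hx : x₀ ≠ 0) :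
    ∀ᶠ x in 𝓝 x₀, ContDiffAt 𝕜 ∞ (fun x : 𝕜 => x⁻¹) x := by
  filter_upwards [isOpen_ne.eventually_mem hx] with z hz using contDiffAt_inv 𝕜 hz

/-- Covers all four one-parameter cases: `F` is a multiple of `(x y ^ ε) ^ n`. The generators keep
the unsimplified shape of `Frame.toField` with `v = 0`, so that they agree with it by `rfl`. -/
theorem symmetryAlgebra_PIII_eq_span_pair (hx : q₀.1 ≠ 0) (hy : q₀.2 ≠ 0) {a b c d : 𝕜} {n : ℕ}
    (hn : n ≠ 0) {m ε : 𝕜} (hm : n * m = 2) (hε : ε ^ 2 = 1) {F : SmoothGerm q₀} (hF : IsUnit F)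
    (hFD : F = x ^ 2 * invY hy * constPIII hx hy a b c d)
    (hdx : x * dx F = (n : SmoothGerm q₀) * F)
    (hdy : y * dy F = const ε * (n : SmoothGerm q₀) * F) :
    Module.finrank 𝕜 (symmetryAlgebra (PIII a b c d) q₀) = 2 ∧
    ∀ ln : 𝕜 → 𝕜, IsLocalLog ln q₀.1 → symmetryAlgebra (PIII a b c d) q₀ = Submodule.span 𝕜
      {fieldGerm q₀ (fun x _ => x * 1) (fun x y => y * (-ε - 0 * (x * 1))),
        fieldGerm q₀ (fun x _ => x * (ln x - m))
          (fun x y => y * (-(ε * ln x) - 0 * (x * (ln x - m))))} := by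
  obtain ⟨φ, hφ⟩ : ∃ φ, φ = (isCoordinates hx hy).logFrame hFD := ⟨_, rfl⟩
  have hX : ∀ g, φ.X g = x * dx g := by
    rw [hφ]; exact (isCoordinates hx hy).logFrame_X hFD
  have hY : ∀ g, φ.Y g = y * dy g := by
    rw [hφ]; exact (isCoordinates hx hy).logFrame_Y hFD
  have hXc : ∀ c, φ.X (const c) = 0 := fun c => by rw [hX, dir_const, mul_zero]
  have hYc : ∀ c, φ.Y (const c) = 0 := fun c => by rw [hY, dir_const, mul_zero]
  have hm' : (n : SmoothGerm q₀) * const m = 2 := by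
    rw [const_eq_algebraMap, ← map_natCast (algebraMap 𝕜 (SmoothGerm q₀)), ← map_mul, hm, map_ofNat]
  have key : ∀ ln : 𝕜 → 𝕜, ∀ h : IsLocalLog ln q₀.1,
      φ.X (ofX ln (eventually_contDiffAt_log hx h)) = 1 ∧
      symmetryAlgebra (PIII a b c d) q₀ = Submodule.span 𝕜 {pair (φ.toField (1, -const ε)),
        pair (φ.toField (ofX ln (eventually_contDiffAt_log hx h) - const m,
          -(const ε * ofX ln (eventually_contDiffAt_log hx h))))} := by
    intro ln h
    have hT := dir_ofX (hf := eventually_contDiffAt_log hx h) h (eventually_contDiffAt_deriv_log hx)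
    have hXT : φ.X (ofX ln (eventually_contDiffAt_log hx h)) = 1 := by
      rw [hX, hT.1]
      exact (isCoordinates hx hy).mul_x
    refine ⟨hXT, φ.symmetryAlgebra_eq_span_pair (isQuadratic_PIII hx hy a b c d) hn hm' (hXc m) (hYc m) hF
      (const_sq_eq_one hε) (hYc ε) (hXc ε) (by rw [hX, hdx]) (by rw [hY, hdy]) hXT
      (by rw [hY, hT.2, mul_zero])⟩
  constructor
  · obtain ⟨ln, h⟩ := exists_isLocalLog hx
    rw [(key ln h).2]
    exact φ.finrank_span_pair (hXc m) (key ln h).1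
  · intro ln h
    rw [(key ln h).2, hφ]
    rfl

theorem symmetryAlgebra_PIII_eq_span_singleton (hx : q₀.1 ≠ 0) (hy : q₀.2 ≠ 0) {a b c d : 𝕜}
    {ε : 𝕜} (hε : ε ^ 2 = 1) {F₁ F₂ : SmoothGerm q₀} (hF₁ : IsUnit F₁) (hF₂ : IsUnit F₂)
    (hFD : F₁ + F₂ = x ^ 2 * invY hy * constPIII hx hy a b c d)
    (hdx₁ : x * dx F₁ = F₁) (hdy₁ : y * dy F₁ = const ε * F₁)
    (hdx₂ : x * dx F₂ = 2 * F₂) (hdy₂ : y * dy F₂ = 2 * const ε * F₂) :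
    Module.finrank 𝕜 (symmetryAlgebra (PIII a b c d) q₀) = 1 ∧
    symmetryAlgebra (PIII a b c d) q₀ = Submodule.span 𝕜
      {fieldGerm q₀ (fun x _ => x * 1) (fun x y => y * (-ε - 0 * (x * 1)))} := by
  obtain ⟨φ, hφ⟩ : ∃ φ, φ = (isCoordinates hx hy).logFrame hFD := ⟨_, rfl⟩
  have hX : ∀ g, φ.X g = x * dx g := by
    rw [hφ]; exact (isCoordinates hx hy).logFrame_X hFD
  have hY : ∀ g, φ.Y g = y * dy g := by
    rw [hφ]; exact (isCoordinates hx hy).logFrame_Y hFD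
  have h := φ.symmetryAlgebra_eq_span_singleton (isQuadratic_PIII hx hy a b c d)
    (flat_two_exp_iff (φ.XY_comm dy_dx) hF₁ hF₂ (const_sq_eq_one hε)
      (by rw [hY, dir_const, mul_zero]) (by rw [hX, dir_const, mul_zero]) (by rw [hX, hdx₁])
      (by rw [hY, hdy₁]) (by rw [hX, hdx₂]) (by rw [hY, hdy₂]))
  constructor
  · rw [h]
    exact φ.finrank_span_singleton fun h0 => one_ne_zero (congrArg Prod.fst h0)
  · rw [h, hφ]
    rfl

end SmoothGerm

namespace SmoothGerm

variable {q₀ : 𝕜 × 𝕜}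

theorem fieldGerm_congr {ξ η ξ' η' : 𝕜 → 𝕜 → 𝕜} (h₁ : ∀ x y, ξ x y = ξ' x y)
    (h₂ : ∀ x y, η x y = η' x y) : fieldGerm q₀ ξ η = fieldGerm q₀ ξ' η' := by
  rw [funext₂ h₁, funext₂ h₂]

theorem isUnit_x (hx : q₀.1 ≠ 0) : IsUnit (x : SmoothGerm q₀) := isUnit_mk hx

theorem isUnit_y (hy : q₀.2 ≠ 0) : IsUnit (y : SmoothGerm q₀) := isUnit_mk hy

theorem isUnit_invY (hy : q₀.2 ≠ 0) : IsUnit (invY hy) :=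
  isUnit_mk (hf := eventually_contDiffAt_inv (Eventually.of_forall fun _ => contDiffAt_snd) hy)
    (inv_ne_zero hy)

/-- In `F = x² D / y` the parameters `b`, `a`, `d`, `c` contribute multiples of `x / y`, `x y`, `x²
/ y²`, `x² y²`. These are eigenvectors of `x ∂/∂x = ∂/∂T` and `y ∂/∂y = ∂/∂U`, that is, exponentials
in `T` and `U`. -/
theorem x_mul_dx_b (hx : q₀.1 ≠ 0) (hy : q₀.2 ≠ 0) (k : 𝕜) :
     x * dx (const k * (x * invY hy)) = const k * (x * invY hy) := by
  simp only [Derivation.leibniz, dir_const, dx_x, (isCoordinates hx hy).dx_iy, smul_eq_mul]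
  ring

theorem y_mul_dy_b (hx : q₀.1 ≠ 0) (hy : q₀.2 ≠ 0) (k : 𝕜) :
     y * dy (const k * (x * invY hy)) = const (-1) * (const k * (x * invY hy)) := by
  simp only [Derivation.leibniz, dir_const, dy_x, (isCoordinates hx hy).dy_iy, smul_eq_mul,
    const_neg_one]
  linear_combination -(const k * x * invY hy) * (isCoordinates hx hy).mul_y

theorem x_mul_dx_a (k : 𝕜) : x * dx (const k * (x * y)) = (const k * (x * y) : SmoothGerm q₀) := by
  simp only [Derivation.leibniz, dir_const, dx_x, dx_y, smul_eq_mul]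
  ring

theorem y_mul_dy_a (k : 𝕜) :
    y * dy (const k * (x * y)) = const 1 * (const k * (x * y) : SmoothGerm q₀) := by
  simp only [Derivation.leibniz, dir_const, dy_x, dy_y, smul_eq_mul, const_one]
  ring

theorem x_mul_dx_d (hx : q₀.1 ≠ 0) (hy : q₀.2 ≠ 0) (k : 𝕜) :
     x * dx (const k * (x * x * (invY hy * invY hy))) =
    2 * (const k * (x * x * (invY hy * invY hy))) := by
  simp only [Derivation.leibniz, dir_const, dx_x, (isCoordinates hx hy).dx_iy, smul_eq_mul]
  ring

theorem y_mul_dy_d (hx : q₀.1 ≠ 0) (hy : q₀.2 ≠ 0) (k : 𝕜) :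
     y * dy (const k * (x * x * (invY hy * invY hy))) =
    2 * const (-1) * (const k * (x * x * (invY hy * invY hy))) := by
  simp only [Derivation.leibniz, dir_const, dy_x, (isCoordinates hx hy).dy_iy, smul_eq_mul,
    const_neg_one]
  linear_combination -2 * (const k * x * x * invY hy * invY hy) * (isCoordinates hx hy).mul_y

theorem x_mul_dx_c (k : 𝕜) : x * dx (const k * (x * x * (y * y))) =
    2 * (const k * (x * x * (y * y)) : SmoothGerm q₀) := by
  simp only [Derivation.leibniz, dir_const, dx_x, dx_y, smul_eq_mul]
  ring

theorem y_mul_dy_c (k : 𝕜) : y * dy (const k * (x * x * (y * y))) =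
    2 * const 1 * (const k * (x * x * (y * y)) : SmoothGerm q₀) := by
  simp only [Derivation.leibniz, dir_const, dy_x, dy_y, smul_eq_mul, const_one]
  ring

theorem sum_b_d (hx : q₀.1 ≠ 0) (hy : q₀.2 ≠ 0) (b d : 𝕜) : const b * (x * invY hy) + const d * (x * x * (invY hy * invY hy)) =
    x ^ 2 * invY hy * constPIII hx hy 0 b 0 d := by
  rw [constPIII, const_zero]
  linear_combination -const b * x * invY hy * (isCoordinates hx hy).mul_x

theorem sum_a_c (hx : q₀.1 ≠ 0) (hy : q₀.2 ≠ 0) (a c : 𝕜) : const a * (x * y) + const c * (x * x * (y * y)) =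
    x ^ 2 * invY hy * constPIII hx hy a 0 c 0 := by
  rw [constPIII, const_zero]
  linear_combination (-const c * x ^ 2 * y ^ 2 - const a * x * y) * (isCoordinates hx hy).mul_y
    - const a * x * y ^ 2 * invY hy * (isCoordinates hx hy).mul_x

theorem symmetryAlgebra_PIII_b (hx : q₀.1 ≠ 0) (hy : q₀.2 ≠ 0) {k : 𝕜} (hk : k ≠ 0) :
    Module.finrank 𝕜 (symmetryAlgebra (PIII 0 k 0 0) q₀) = 2 ∧
    ∀ ln : 𝕜 → 𝕜, IsLocalLog ln q₀.1 → symmetryAlgebra (PIII 0 k 0 0) q₀ = Submodule.span 𝕜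
      {fieldGerm q₀ (fun x _ => x) (fun _ y => y),
        fieldGerm q₀ (fun x _ => x * ln x - 2 * x) (fun x y => y * ln x)} := by
  have h := symmetryAlgebra_PIII_eq_span_pair hx hy (a := 0) (b := k) (c := 0) (d := 0)
    (n := 1) one_ne_zero (m := 2) (ε := -1)
    (by norm_num) (by norm_num) (F := const k * (x * invY hy))
    ((isUnit_const hk).mul ((isUnit_x hx).mul (isUnit_invY hy)))
    (by rw [← sum_b_d, const_zero, zero_mul, add_zero])
    (by rw [x_mul_dx_b hx hy, Nat.cast_one, one_mul]) (by rw [y_mul_dy_b hx hy, Nat.cast_one, mul_one])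
  refine ⟨h.1, fun ln hln => (h.2 ln hln).trans ?_⟩
  refine congrArg _ (congrArg₂ insert (fieldGerm_congr ?_ ?_)
    (congrArg singleton (fieldGerm_congr ?_ ?_))) <;> intros <;> ring

theorem symmetryAlgebra_PIII_a (hx : q₀.1 ≠ 0) (hy : q₀.2 ≠ 0) {k : 𝕜} (hk : k ≠ 0) :
    Module.finrank 𝕜 (symmetryAlgebra (PIII k 0 0 0) q₀) = 2 ∧
    ∀ ln : 𝕜 → 𝕜, IsLocalLog ln q₀.1 → symmetryAlgebra (PIII k 0 0 0) q₀ = Submodule.span 𝕜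
      {fieldGerm q₀ (fun x _ => x) (fun _ y => -y),
        fieldGerm q₀ (fun x _ => x * ln x - 2 * x) (fun x y => -(y * ln x))} := by
  have h := symmetryAlgebra_PIII_eq_span_pair hx hy (a := k) (b := 0) (c := 0) (d := 0)
    (n := 1) one_ne_zero (m := 2) (ε := 1)
    (by norm_num) (by norm_num) (F := const k * (x * y))
    ((isUnit_const hk).mul ((isUnit_x hx).mul (isUnit_y hy)))
    (by rw [← sum_a_c, const_zero, zero_mul, add_zero])
    (by rw [x_mul_dx_a, Nat.cast_one, one_mul]) (by rw [y_mul_dy_a, Nat.cast_one, mul_one])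
  refine ⟨h.1, fun ln hln => (h.2 ln hln).trans ?_⟩
  refine congrArg _ (congrArg₂ insert (fieldGerm_congr ?_ ?_)
    (congrArg singleton (fieldGerm_congr ?_ ?_))) <;> intros <;> ring

theorem symmetryAlgebra_PIII_c (hx : q₀.1 ≠ 0) (hy : q₀.2 ≠ 0) {k : 𝕜} (hk : k ≠ 0) :
    Module.finrank 𝕜 (symmetryAlgebra (PIII 0 0 k 0) q₀) = 2 ∧
    ∀ ln : 𝕜 → 𝕜, IsLocalLog ln q₀.1 → symmetryAlgebra (PIII 0 0 k 0) q₀ = Submodule.span 𝕜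
      {fieldGerm q₀ (fun x _ => x) (fun _ y => -y),
        fieldGerm q₀ (fun x _ => x * ln x - x) (fun x y => -(y * ln x))} := by
  have h := symmetryAlgebra_PIII_eq_span_pair hx hy (a := 0) (b := 0) (c := k) (d := 0)
    (n := 2) two_ne_zero (m := 1) (ε := 1)
    (by norm_num) (by norm_num) (F := const k * (x * x * (y * y)))
    ((isUnit_const hk).mul (((isUnit_x hx).mul (isUnit_x hx)).mul
      ((isUnit_y hy).mul (isUnit_y hy))))
    (by rw [← sum_a_c, const_zero, zero_mul, zero_add])
    (by rw [x_mul_dx_c, Nat.cast_ofNat]) (by rw [y_mul_dy_c, Nat.cast_ofNat, mul_comm 2])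
  refine ⟨h.1, fun ln hln => (h.2 ln hln).trans ?_⟩
  refine congrArg _ (congrArg₂ insert (fieldGerm_congr ?_ ?_)
    (congrArg singleton (fieldGerm_congr ?_ ?_))) <;> intros <;> ring

theorem symmetryAlgebra_PIII_d (hx : q₀.1 ≠ 0) (hy : q₀.2 ≠ 0) {k : 𝕜} (hk : k ≠ 0) :
    Module.finrank 𝕜 (symmetryAlgebra (PIII 0 0 0 k) q₀) = 2 ∧
    ∀ ln : 𝕜 → 𝕜, IsLocalLog ln q₀.1 → symmetryAlgebra (PIII 0 0 0 k) q₀ = Submodule.span 𝕜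
      {fieldGerm q₀ (fun x _ => x) (fun _ y => y),
        fieldGerm q₀ (fun x _ => x * ln x - x) (fun x y => y * ln x)} := by
  have h := symmetryAlgebra_PIII_eq_span_pair hx hy (a := 0) (b := 0) (c := 0) (d := k)
    (n := 2) two_ne_zero (m := 1) (ε := -1)
    (by norm_num) (by norm_num) (F := const k * (x * x * (invY hy * invY hy)))
    ((isUnit_const hk).mul (((isUnit_x hx).mul (isUnit_x hx)).mul
      ((isUnit_invY hy).mul (isUnit_invY hy))))
    (by rw [← sum_b_d, const_zero, zero_mul, zero_add])
    (by rw [x_mul_dx_d hx hy, Nat.cast_ofNat]) (by rw [y_mul_dy_d hx hy, Nat.cast_ofNat, mul_comm 2])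
  refine ⟨h.1, fun ln hln => (h.2 ln hln).trans ?_⟩
  refine congrArg _ (congrArg₂ insert (fieldGerm_congr ?_ ?_)
    (congrArg singleton (fieldGerm_congr ?_ ?_))) <;> intros <;> ring

theorem symmetryAlgebra_PIII_b_d (hx : q₀.1 ≠ 0) (hy : q₀.2 ≠ 0) {b d : 𝕜} (hb : b ≠ 0) (hd : d ≠ 0) :
    Module.finrank 𝕜 (symmetryAlgebra (PIII 0 b 0 d) q₀) = 1 ∧
    symmetryAlgebra (PIII 0 b 0 d) q₀ = Submodule.span 𝕜
      {fieldGerm q₀ (fun x _ => x) (fun _ y => y)} := by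
  have h := symmetryAlgebra_PIII_eq_span_singleton hx hy (ε := -1) (by norm_num)
    ((isUnit_const hb).mul ((isUnit_x hx).mul (isUnit_invY hy)))
    ((isUnit_const hd).mul (((isUnit_x hx).mul (isUnit_x hx)).mul
      ((isUnit_invY hy).mul (isUnit_invY hy))))
    (sum_b_d hx hy b d) (x_mul_dx_b hx hy b) (y_mul_dy_b hx hy b) (x_mul_dx_d hx hy d)
    (y_mul_dy_d hx hy d)
  refine ⟨h.1, h.2.trans ?_⟩
  refine congrArg _ (congrArg singleton (fieldGerm_congr ?_ ?_)) <;> intros <;> ring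

theorem symmetryAlgebra_PIII_a_c (hx : q₀.1 ≠ 0) (hy : q₀.2 ≠ 0) {a c : 𝕜} (ha : a ≠ 0) (hc : c ≠ 0) :
    Module.finrank 𝕜 (symmetryAlgebra (PIII a 0 c 0) q₀) = 1 ∧
    symmetryAlgebra (PIII a 0 c 0) q₀ = Submodule.span 𝕜
      {fieldGerm q₀ (fun x _ => x) (fun _ y => -y)} := by
  have h := symmetryAlgebra_PIII_eq_span_singleton hx hy (ε := 1) (by norm_num)
    ((isUnit_const ha).mul ((isUnit_x hx).mul (isUnit_y hy)))
    ((isUnit_const hc).mul (((isUnit_x hx).mul (isUnit_x hx)).mul ((isUnit_y hy).mul (isUnit_y hy))))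
    (sum_a_c hx hy a c) (x_mul_dx_a a) (y_mul_dy_a a) (x_mul_dx_c c) (y_mul_dy_c c)
  refine ⟨h.1, h.2.trans ?_⟩
  refine congrArg _ (congrArg singleton (fieldGerm_congr ?_ ?_)) <;> intros <;> ring

end SmoothGerm

/-- The independent variable is unchanged, so `Dx = 1`. The new slope is `-p / y²` and the new
second derivative is `2 p² / y³ - y'' / y²`. -/
theorem isEquivalenceAt_PIII (b d : 𝕜) {q₀ : 𝕜 × 𝕜} (hy : q₀.2 ≠ 0) :
    IsEquivalenceAt (PIII 0 b 0 d) (PIII (-b) 0 (-d) 0) (fun q => (q.1, 1 / q.2)) q₀ := by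
  have hne : ∀ᶠ q in 𝓝 q₀, q.2 ≠ 0 := continuous_snd.continuousAt.eventually_ne hy
  have hd : ∀ q : 𝕜 × 𝕜, q.2 ≠ 0 → HasFDerivAt (fun q : 𝕜 × 𝕜 => 1 / q.2)
      ((-(q.2 ^ 2)⁻¹) • ContinuousLinearMap.snd 𝕜 𝕜 𝕜) q := by
    intro q hq
    simp only [one_div]
    exact (hasDerivAt_inv hq).comp_hasFDerivAt q hasFDerivAt_snd
  refine ⟨?_, ?_, ?_⟩
  · filter_upwards [hne] with q hq
    exact contDiffAt_fst.prodMk (contDiffAt_const.div contDiffAt_snd hq)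
  · have h := (hasFDerivAt_fst (𝕜 := 𝕜) (p := q₀)).prodMk (hd q₀ hy)
    rw [h.fderiv]
    constructor
    · rintro ⟨a, b⟩ ⟨a', b'⟩ e
      simpa [hy] using e
    · rintro ⟨a, b⟩
      refine ⟨(a, -q₀.2 ^ 2 * b), ?_⟩
      simp
      field_simp
  · filter_upwards [hne.eventually_nhds] with q hq p
    have hDx : ∀ r s, totalDeriv (fun r : 𝕜 × 𝕜 => (r.1, 1 / r.2).1) r s = 1 := by
      intro r s
      simp [totalDeriv, fderiv_fst]
    have hslope : ∀ r : 𝕜 × 𝕜, r.2 ≠ 0 → ∀ s, totalDeriv (fun t : 𝕜 × 𝕜 => (t.1, 1 / t.2).2) r s =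
        -(r.2 ^ 2)⁻¹ * s := by
      intro r hr s
      unfold totalDeriv
      rw [(hd r hr).fderiv]
      simp
    have hq0 := hq.self_of_nhds
    have e : (fun j : (𝕜 × 𝕜) × 𝕜 => totalDeriv (fun t : 𝕜 × 𝕜 => (t.1, 1 / t.2).2) j.1 j.2 /
        totalDeriv (fun r : 𝕜 × 𝕜 => (r.1, 1 / r.2).1) j.1 j.2) =ᶠ[𝓝 (q, p)]
        fun j => -(j.1.2 ^ 2)⁻¹ * j.2 := by
      have ht : Tendsto (Prod.fst : (𝕜 × 𝕜) × 𝕜 → 𝕜 × 𝕜) (𝓝 (q, p)) (𝓝 q) :=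
        continuous_fst.tendsto (q, p)
      filter_upwards [ht.eventually hq] with j hj
      rw [hDx, hslope _ hj, div_one]
    have hs : HasFDerivAt (fun j : (𝕜 × 𝕜) × 𝕜 => j.1.2)
        ((ContinuousLinearMap.snd 𝕜 𝕜 𝕜).comp (ContinuousLinearMap.fst 𝕜 (𝕜 × 𝕜) 𝕜)) (q, p) :=
      hasFDerivAt_snd.comp (q, p) hasFDerivAt_fst
    have hi : HasDerivAt (fun z : 𝕜 => -(z ^ 2)⁻¹) _ q.2 :=
      ((hasDerivAt_pow 2 q.2).fun_inv (pow_ne_zero 2 hq0)).fun_neg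
    have hc := hi.comp_hasFDerivAt (q, p) hs
    have hder : HasFDerivAt (fun j : (𝕜 × 𝕜) × 𝕜 => -(j.1.2 ^ 2)⁻¹ * j.2) _ (q, p) :=
      HasFDerivAt.fun_mul (c := fun j : (𝕜 × 𝕜) × 𝕜 => -(j.1.2 ^ 2)⁻¹) hc
        (hasFDerivAt_snd (𝕜 := 𝕜) (p := ((q, p) : (𝕜 × 𝕜) × 𝕜)))
    intro Dx slope _
    have h1 : ∀ s, totalDerivTwo slope q p s = 2 * p ^ 2 / q.2 ^ 3 - s / q.2 ^ 2 := by
      intro s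
      unfold totalDerivTwo
      rw [e.fderiv_eq, hder.fderiv]
      simp
      field_simp
      ring
    have h2 : Dx q p = 1 := hDx q p
    have h3 : slope q p = -(q.2 ^ 2)⁻¹ * p := e.eq_of_nhds
    rw [h1, h2, h3]
    simp [PIII]
    field_simp
    ring

/-! ### The equations `PV(a, b, 0, 0)` -/

section

variable {R : Type*} [CommRing R] [Algebra 𝕜 R] {dx dy : Derivation 𝕜 R R}
  {x y ix iy iz h r ir D F : R}

/-- The change of variables `T = ln x`, `U_y = 1 / (r y (y - 1))`, where `r = y ^ (-1/2)`. -/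
def sqrtFrame (hc : IsCoordinates dx dy x y ix iy) (hz : iz * (y - 1) = 1) (hh : 2 * h = 1)
    (hr : ir * r = 1) (dx_r : dx r = 0) (dy_r : dy r = -(h * r * iy))
    (hF : F = x ^ 2 * (ir * iy * iz) * D) : Frame dx dy (h * iy + iz) (-ix) D F where
  τ := ix
  ρ := x
  w := ir * iy * iz
  σ := r * y * (y - 1)
  v := 0
  κ := -ix
  mul_τ := hc.mul_x
  mul_w := by
    linear_combination (y * iy * iz * (y - 1)) * hr + iz * (y - 1) * hc.mul_y + hz
  dx_τ := by rw [hc.dx_ix]; ring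
  dy_τ := hc.dy_ix
  closed := by
    have hiz : dx iz = -(0 * iz) := deriv_inv hz (by
      rw [map_sub, hc.dx_y, Derivation.map_one_eq_zero]; ring)
    have hir : dx ir = -(0 * ir) := deriv_inv hr (by rw [dx_r, zero_mul])
    simp only [Derivation.leibniz, hc.dx_iy, hiz, hir, smul_eq_mul, map_zero]
    ring
  dy_w := by
    have hiz : dy iz = -(iz * iz) := deriv_inv hz (by
      rw [map_sub, hc.dy_y, Derivation.map_one_eq_zero]
      linear_combination -hz)
    have hir : dy ir = -(-(h * iy) * ir) := deriv_inv hr (by rw [dy_r]; ring)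
    simp only [Derivation.leibniz, hc.dy_iy, hiz, hir, smul_eq_mul]
    linear_combination iy ^ 2 * iz * ir * hh
  dy_v := by rw [map_zero]; ring
  dx_v := by
    rw [map_zero, hF]
    linear_combination (-ir * iy * iz * D) * (x * ix + 1) * hc.mul_x

/-- The factor `(r ^ 2 * y) ^ 2`, a constant for the given `r`, is split off the parameters so that
`F` becomes exactly `r ^ 3 * (y - 1) * (a * y ^ 2 + b)`, free of inverses. -/
theorem flat_sqrtFrame_iff (hc : IsCoordinates dx dy x y ix iy) (hz : iz * (y - 1) = 1)
    (hh : 2 * h = 1) (hr : ir * r = 1) (dx_r : dx r = 0) (dy_r : dy r = -(h * r * iy)) {a b : R}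
    (hF : F = x ^ 2 * (ir * iy * iz) * D)
    (hD : D = ix * ix * ((y - 1) * (y - 1)) *
      (a * (r ^ 2 * y) ^ 2 * y + b * (r ^ 2 * y) ^ 2 * iy))
    (hxa : dx a = 0) (hya : dy a = 0) (hxb : dx b = 0) (hyb : dy b = 0)
    (hab : IsUnit a ∨ a = 0 ∧ IsUnit b) (hdc : ∀ g, dy (dx g) = dx (dy g)) (A E : R) :
    Flat (sqrtFrame hc hz hh hr dx_r dy_r hF).X (sqrtFrame hc hz hh hr dx_r dy_r hF).Y F A E ↔
      (sqrtFrame hc hz hh hr dx_r dy_r hF).X A = 0 ∧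
      (sqrtFrame hc hz hh hr dx_r dy_r hF).Y A = 0 ∧ E = -(0 * A) := by
  have hX : ∀ g, (sqrtFrame hc hz hh hr dx_r dy_r hF).X g = x * dx g := fun g => by
    change x * (dx g - 0 * (r * y * (y - 1)) * dy g) = _
    ring
  have hY : ∀ g, (sqrtFrame hc hz hh hr dx_r dy_r hF).Y g = r * y * (y - 1) * dy g := fun g => rfl
  have hFe : F = r ^ 3 * (y - 1) * (a * y ^ 2 + b) := by
    have e1 := hc.mul_x
    have e2 := hc.mul_y
    have e3 : (x * ix) ^ 2 = 1 := by rw [e1, one_pow]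
    have e4 : (y * iy) ^ 2 = 1 := by rw [e2, one_pow]
    rw [hF, hD]
    calc _ = (x * ix) ^ 2 * (iz * (y - 1)) * (ir * r) * (y - 1) * r ^ 3 *
          (a * y ^ 2 * (y * iy) + b * (y * iy) ^ 2) := by ring
      _ = _ := by
        rw [e3, e4, e2, hz, hr]
        ring
  have hxy := (sqrtFrame hc hz hh hr dx_r dy_r hF).XY_comm hdc
  generalize (sqrtFrame hc hz hh hr dx_r dy_r hF).X = X,
    (sqrtFrame hc hz hh hr dx_r dy_r hF).Y = Y at *
  rw [zero_mul, neg_zero, hFe]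
  refine flat_sqrt_iff hxy (IsUnit.of_mul_eq_one ir (by rw [mul_comm, hr]))
    (IsUnit.of_mul_eq_one iy hc.mul_y) (IsUnit.of_mul_eq_one iz (by rw [mul_comm, hz])) ?_ ?_ ?_ ?_
    ?_ ?_ ?_ ?_ hab A E
  · rw [hX, dx_r, mul_zero]
  · rw [hX, hc.dx_y, mul_zero]
  · rw [hY, dy_r]
    linear_combination (-r ^ 2 * (y - 1) * 2 * h) * hc.mul_y - r ^ 2 * (y - 1) * hh
  · rw [hY, hc.dy_y, mul_one]
  · rw [hY, hya, mul_zero]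
  · rw [hY, hyb, mul_zero]
  · rw [hX, hxa, mul_zero]
  · rw [hX, hxb, mul_zero]

end

namespace SmoothGerm

variable {q₀ : 𝕜 × 𝕜}

/-- The germ of `1/(y - 1)`. -/
def invYSubOne (hy1 : q₀.2 ≠ 1) : SmoothGerm q₀ :=
  invMk (fun q => q.2 - 1) (Eventually.of_forall fun _ => contDiffAt_snd.sub contDiffAt_const)
    (sub_ne_zero.2 hy1)

theorem invYSubOne_mul (hy1 : q₀.2 ≠ 1) : invYSubOne hy1 * (y - 1) = 1 := invMk_mul _ _ _

theorem two_mul_const_half : 2 * (const 2⁻¹ : SmoothGerm q₀) = 1 := by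
  rw [const_eq_algebraMap, ← map_ofNat (algebraMap 𝕜 (SmoothGerm q₀)) 2, ← map_mul,
    mul_inv_cancel₀ two_ne_zero, map_one]

/-- The part of `PV(a, b, 0, 0)` that does not depend on `y'`. -/
def constPV (hx : q₀.1 ≠ 0) (hy : q₀.2 ≠ 0) (a b : 𝕜) : SmoothGerm q₀ :=
  invX hx * invX hx * ((y - 1) * (y - 1)) * (const a * y + const b * invY hy)

theorem isQuadratic_PV (hx : q₀.1 ≠ 0) (hy : q₀.2 ≠ 0) (hy1 : q₀.2 ≠ 1) (a b : 𝕜) :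
    IsQuadratic (PV a b 0 0) (const 2⁻¹ * invY hy + invYSubOne hy1) (-invX hx)
      (constPV hx hy a b) :=
  ⟨fun q => 2⁻¹ * q.2⁻¹ + (q.2 - 1)⁻¹, fun q => -q.1⁻¹,
    fun q => q.1⁻¹ * q.1⁻¹ * ((q.2 - 1) * (q.2 - 1)) * (a * q.2 + b * q.2⁻¹), rfl, rfl, rfl,
    Eventually.of_forall fun q p => by simp only [PV, div_eq_mul_inv, mul_inv]; ring⟩

/-- `r = exp(-g / 2)` with `g` a primitive of `dy / y`; this also exists over `ℝ` at `y₀ < 0`. -/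
theorem exists_inv_sqrt (hx : q₀.1 ≠ 0) (hy : q₀.2 ≠ 0) :
    ∃ r ir : SmoothGerm q₀, ir * r = 1 ∧ dx r = 0 ∧ dy r = -(const 2⁻¹ * r * invY hy) := by
  obtain ⟨g, hg1, hg2⟩ := exists_primitive (a := 0) (b := invY hy)
    (by rw [map_zero, (isCoordinates hx hy).dx_iy])
  obtain ⟨e, he, hd⟩ := exists_exp (-(const 2⁻¹ * g))
  obtain ⟨ir, hir⟩ := he.exists_left_inv
  refine ⟨e, ir, hir, ?_, ?_⟩
  · rw [hd, map_neg, Derivation.leibniz, hg1, dir_const, smul_zero, smul_zero]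
    ring
  · rw [hd, map_neg, Derivation.leibniz, hg2, dir_const, smul_zero, smul_eq_mul]
    ring

theorem finrank_PV (hx : q₀.1 ≠ 0) (hy : q₀.2 ≠ 0) (hy1 : q₀.2 ≠ 1) :
    Module.finrank 𝕜 (symmetryAlgebra (PV 0 0 0 0) q₀) = 8 := by
  obtain ⟨r, ir, hr, hr1, hr2⟩ := exists_inv_sqrt hx hy
  refine (sqrtFrame (isCoordinates hx hy) (invYSubOne_mul hy1) two_mul_const_half hr hr1 hr2
    ?_).finrank_eq_eight (isQuadratic_PV hx hy hy1 0 0)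
  rw [constPV, const_zero]
  ring

theorem symmetryAlgebra_PV (hx : q₀.1 ≠ 0) (hy : q₀.2 ≠ 0) (hy1 : q₀.2 ≠ 1) {a b : 𝕜}
    (hab : a ≠ 0 ∨ b ≠ 0) :
    Module.finrank 𝕜 (symmetryAlgebra (PV a b 0 0) q₀) = 1 ∧
    symmetryAlgebra (PV a b 0 0) q₀ = Submodule.span 𝕜
      {fieldGerm q₀ (fun x _ => x) (fun _ _ => 0)} := by
  obtain ⟨r, ir, hr, hr1, hr2⟩ := exists_inv_sqrt hx hy
  have hc := isCoordinates hx hy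
  -- `r` is `y ^ (-1/2)` only up to a constant factor, so `r² y` is some constant `c ≠ 0`, and `a`,
  -- `b` are replaced by `a / c²`, `b / c²`.
  obtain ⟨c, hc'⟩ : ∃ c : 𝕜, r ^ 2 * y = algebraMap 𝕜 (SmoothGerm q₀) c := by
    refine exists_eq_algebraMap ?_ ?_
    · rw [pow_two]
      simp only [Derivation.leibniz, hr1, dx_y, smul_zero, add_zero]
    · rw [pow_two]
      simp only [Derivation.leibniz, hr2, dy_y, smul_eq_mul]
      linear_combination (-2 * const 2⁻¹ * r ^ 2) * hc.mul_y - r ^ 2 * two_mul_const_half (q₀ := q₀)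
  have hc0 : c ≠ 0 := by
    rintro rfl
    have hu : IsUnit (r ^ 2 * y) :=
      ((IsUnit.of_mul_eq_one ir (by rw [mul_comm, hr])).pow 2).mul (isUnit_y hy)
    rw [hc', map_zero] at hu
    exact not_isUnit_zero hu
  have hca : ∀ a : 𝕜, const a = const (a / c ^ 2) * (r ^ 2 * y) ^ 2 := fun a => by
    rw [hc', const_eq_algebraMap, const_eq_algebraMap, ← map_pow, ← map_mul,
      div_mul_cancel₀ _ (pow_ne_zero 2 hc0)]
  have hunit : ∀ a : 𝕜, a ≠ 0 → IsUnit (const (a / c ^ 2) : SmoothGerm q₀) := fun a ha =>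
    isUnit_const (div_ne_zero ha (pow_ne_zero 2 hc0))
  obtain ⟨φ, hφ⟩ : ∃ φ, φ = sqrtFrame (D := constPV hx hy a b) hc (invYSubOne_mul hy1)
    two_mul_const_half hr hr1 hr2 rfl := ⟨_, rfl⟩
  have h := φ.symmetryAlgebra_eq_span_singleton (ε := 0) (isQuadratic_PV hx hy hy1 a b) (by
    rw [hφ]
    refine flat_sqrtFrame_iff (a := const (a / c ^ 2)) (b := const (b / c ^ 2)) hc _ _ hr _ _ _ ?_
      (dir_const _ _) (dir_const _ _) (dir_const _ _) (dir_const _ _) ?_ dy_dx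
    · rw [← hca, ← hca, constPV]
    · by_cases ha : a = 0
      · exact .inr ⟨by rw [ha, zero_div, const_zero], hunit b (hab.resolve_left (not_not.2 ha))⟩
      · exact .inl (hunit a ha))
  constructor
  · rw [h]
    exact φ.finrank_span_singleton fun h0 => one_ne_zero (congrArg Prod.fst h0)
  · have e : φ.toField (1, -0) = (x, 0) := by
      rw [φ.toField_apply, hφ]
      change (x * 1, r * y * (y - 1) * (-0 - 0 * (x * 1))) = _
      ext1
      · exact mul_one _
      · ring
    rw [h, e]
    rfl

end SmoothGerm

/-! ### The equation `PVI(0, 0, 0, 1/2)` and elliptic integrals -/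

section

variable {R : Type*} [CommRing R] [Algebra 𝕜 R] {dx dy : Derivation 𝕜 R R}
  {x y ix iy ix1 iy1 q h w iw f f₁ f₂ ψ c : R}

theorem deriv_half {d : Derivation 𝕜 R R} (hh : 2 * h = 1) : d h = 0 := by
  have e := congrArg d hh
  rw [Derivation.leibniz, deriv_two, Derivation.map_one_eq_zero, smul_zero, add_zero,
    smul_eq_mul] at e
  linear_combination h * e - d h * hh

theorem dx_inv_y_sub_x (hc : IsCoordinates dx dy x y ix iy) (hq : q * (y - x) = 1) :
    dx q = q * q :=
  (deriv_inv (c := -q) hq (by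
    rw [map_sub, hc.dx_x, hc.dx_y]
    linear_combination hq)).trans (by ring)

theorem dy_inv_y_sub_x (hc : IsCoordinates dx dy x y ix iy) (hq : q * (y - x) = 1) :
    dy q = -(q * q) :=
  deriv_inv hq (by
    rw [map_sub, hc.dy_x, hc.dy_y]
    linear_combination -hq)

/-- The two sides come from the logarithmic derivatives of `(y (y - 1) (y - x)) ^ (-1/2)`;
closedness yields this function as an exponential of a primitive. -/
theorem closed_PVI_y (hc : IsCoordinates dx dy x y ix iy) (hq : q * (y - x) = 1) (hh : 2 * h = 1)
    (hy1 : iy1 * (y - 1) = 1) : dy (h * q) = dx (-(h * (iy + iy1 + q))) := by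
  have hiy1 : dx iy1 = -(0 * iy1) := deriv_inv hy1 (by
    rw [map_sub, hc.dx_y, Derivation.map_one_eq_zero]; ring)
  simp only [map_neg, map_add, Derivation.leibniz, deriv_half hh, dx_inv_y_sub_x hc hq,
    dy_inv_y_sub_x hc hq, hc.dx_iy, hiy1, smul_eq_mul]
  ring

/-- The primitive `c` stands for `x (x - 1) (f u_x - f₁ u)`, where `u_y = w`. Since `f` solves the
hypergeometric equation, `c_x = f ((x (x - 1) u_x)_x + u / 4)`. The same operator applied to the
integrand `w` is the `y`-derivative of `-w y (y - 1) / (2 (y - x))`, the Picard-Fuchs relation, and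
this makes the pair closed. -/
theorem closed_PVI_x (hc : IsCoordinates dx dy x y ix iy) (hq : q * (y - x) = 1) (hh : 2 * h = 1)
    (hy1 : iy1 * (y - 1) = 1) (dx_w : dx w = h * w * q) (dy_w : dy w = -(w * (h * (iy + iy1 + q))))
    (dx_f : dx f = f₁) (dy_f : dy f = 0) (dx_f₁ : dx f₁ = f₂)
    (hode : 4 * x * (1 - x) * f₂ + 4 * (1 - 2 * x) * f₁ - f = 0) :
    dy (-(f * w * (h * y * (y - 1) * q))) = dx ((-(f₁ * w) + h * f * w * q) * (x * (x - 1))) := by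
  simp only [map_neg, map_add, map_sub, Derivation.leibniz, deriv_half hh, dx_inv_y_sub_x hc hq,
    dy_inv_y_sub_x hc hq, hc.dx_x, hc.dy_y, dx_w, dy_w, dx_f, dy_f, dx_f₁, smul_eq_mul,
    Derivation.map_one_eq_zero]
  linear_combination (-h ^ 2 * w) * hode
    - (w * (f₂ * (x * (x - 1)) + (2 * x - 1) * f₁) * (2 * h + 1)) * hh
    - f * w * h * (-((2 * y - 1) * q - y * (y - 1) * q ^ 2) - q ^ 2 * (x * (x - 1))
      - (2 * x - 1) * q) * hh
    + f * w * h ^ 2 * (1 + 3 * q * (y + x - 1)) * hq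
    + f * w * h ^ 2 * q * ((y - 1) * hc.mul_y + y * hy1)

theorem dx_ellipticPeriod (hc : IsCoordinates dx dy x y ix iy) (hx1 : ix1 * (x - 1) = 1)
    (hf : ψ * f = 1) (dx_f : dx f = f₁) :
    dx (ix * ix1 * (ψ * ψ)) = (-(ix + ix1) - 2 * f₁ * ψ) * (ix * ix1 * (ψ * ψ)) := by
  have hix1 : dx ix1 = -(ix1 * ix1) := deriv_inv hx1 (by
    rw [map_sub, hc.dx_x, Derivation.map_one_eq_zero]
    linear_combination -hx1)
  have hψ : dx ψ = -(f₁ * ψ * ψ) := deriv_inv hf (by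
    rw [dx_f]
    linear_combination -f₁ * hf)
  simp only [Derivation.leibniz, hc.dx_ix, hix1, hψ, smul_eq_mul]
  ring

theorem dy_ellipticPeriod (hc : IsCoordinates dx dy x y ix iy) (hx1 : ix1 * (x - 1) = 1)
    (hf : ψ * f = 1) (dy_f : dy f = 0) : dy (ix * ix1 * (ψ * ψ)) = 0 := by
  have hix1 : dy ix1 = -(0 * ix1) := deriv_inv hx1 (by
    rw [map_sub, hc.dy_x, Derivation.map_one_eq_zero]
    ring)
  have hψ : dy ψ = -(0 * ψ) := deriv_inv hf (by rw [dy_f, zero_mul])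
  simp only [Derivation.leibniz, hc.dy_ix, hix1, hψ, smul_eq_mul]
  ring

theorem dy_mul_ellipticPeriod (hc : IsCoordinates dx dy x y ix iy) (hx1 : ix1 * (x - 1) = 1)
    (hf : ψ * f = 1) (dy_f : dy f = 0)
    (dy_c : dy c = (-(f₁ * w) + h * f * w * q) * (x * (x - 1))) :
    dy (c * (ix * ix1 * (ψ * ψ))) = h * w * q * ψ - w * f₁ * ψ ^ 2 := by
  rw [Derivation.leibniz, dy_ellipticPeriod hc hx1 hf dy_f, dy_c, smul_zero, zero_add, smul_eq_mul]
  linear_combination (-(f₁ * w) + h * f * w * q) * ψ ^ 2 * (x * ix * hx1 + hc.mul_x)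
    + h * w * q * ψ * hf

/-- The linearization of `PVI(0, 0, 0, 1/2)`: `T = g / f` and `U = u / f`, where `f` and `g` solve
the hypergeometric equation and `u = ∫ dy / √(y (y - 1) (y - x))` is the elliptic integral. -/
def ellipticFrame (hc : IsCoordinates dx dy x y ix iy) (hh : 2 * h = 1)
    (hx1 : ix1 * (x - 1) = 1)
    (hw : iw * w = 1) (dx_w : dx w = h * w * q) (dy_w : dy w = -(w * (h * (iy + iy1 + q))))
    (hf : ψ * f = 1) (dx_f : dx f = f₁) (dy_f : dy f = 0)
    (dx_c : dx c = -(f * w * (h * y * (y - 1) * q)))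
    (dy_c : dy c = (-(f₁ * w) + h * f * w * q) * (x * (x - 1))) :
    Frame dx dy (h * (iy + iy1 + q)) (-(ix + ix1 + q)) (h * y * (y - 1) * ix * ix1 * q) 0 where
  -- `T = g / f` has derivative Wronskian over `f²`, and the Wronskian of the hypergeometric
  -- equation is a multiple of `1 / (x (x - 1))`. Only `f` enters; the second solution `g` is not
  -- needed.
  τ := ix * ix1 * (ψ * ψ)
  ρ := x * (x - 1) * f ^ 2
  w := w * ψ
  σ := iw * f
  v := c * (ix * ix1 * (ψ * ψ))
  κ := -(ix + ix1) - 2 * f₁ * ψ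
  mul_τ := by
    have e : (ψ * f) ^ 2 = 1 := by rw [hf, one_pow]
    calc _ = (x * ix) * (ix1 * (x - 1)) * (ψ * f) ^ 2 := by ring
      _ = 1 := by rw [e, hx1, hc.mul_x, one_mul, one_mul]
  mul_w := by linear_combination ψ * f * hw + hf
  dx_τ := dx_ellipticPeriod hc hx1 hf dx_f
  dy_τ := dy_ellipticPeriod hc hx1 hf dy_f
  closed := by
    have hψ : dx ψ = -(f₁ * ψ * ψ) := deriv_inv hf (by
      rw [dx_f]
      linear_combination -f₁ * hf)
    rw [dy_mul_ellipticPeriod hc hx1 hf dy_f dy_c, Derivation.leibniz, hψ, dx_w, smul_eq_mul,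
      smul_eq_mul]
    ring
  dy_w := by
    have hψ : dy ψ = -(0 * ψ) := deriv_inv hf (by rw [dy_f, zero_mul])
    rw [Derivation.leibniz, hψ, dy_w, smul_eq_mul, smul_eq_mul]
    ring
  dy_v := by
    rw [dy_mul_ellipticPeriod hc hx1 hf dy_f dy_c]
    linear_combination w * q * ψ * hh
  dx_v := by
    rw [Derivation.leibniz, dx_ellipticPeriod hc hx1 hf dx_f, dx_c, smul_eq_mul, smul_eq_mul]
    linear_combination -(w * ψ * ix * ix1 * (h * y * (y - 1) * q)) * hf

end

namespace SmoothGerm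

variable {q₀ : 𝕜 × 𝕜}

/-- The germ of `1/(x - 1)`. -/
def invXSubOne (hx1 : q₀.1 ≠ 1) : SmoothGerm q₀ :=
  invMk (fun q => q.1 - 1) (Eventually.of_forall fun _ => contDiffAt_fst.sub contDiffAt_const)
    (sub_ne_zero.2 hx1)

theorem invXSubOne_mul (hx1 : q₀.1 ≠ 1) : invXSubOne hx1 * (x - 1) = 1 := invMk_mul _ _ _

/-- The germ of `1/(y - x)`. -/
def invYSubX (hyx : q₀.2 ≠ q₀.1) : SmoothGerm q₀ :=
  invMk (fun q => q.2 - q.1) (Eventually.of_forall fun _ => contDiffAt_snd.sub contDiffAt_fst)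
    (sub_ne_zero.2 hyx)

theorem invYSubX_mul (hyx : q₀.2 ≠ q₀.1) : invYSubX hyx * (y - x) = 1 := invMk_mul _ _ _

theorem isQuadratic_PVI (hx : q₀.1 ≠ 0) (hx1 : q₀.1 ≠ 1) (hy : q₀.2 ≠ 0) (hy1 : q₀.2 ≠ 1)
    (hyx : q₀.2 ≠ q₀.1) :
    IsQuadratic (PVI 0 0 0 (1 / 2)) (const 2⁻¹ * (invY hy + invYSubOne hy1 + invYSubX hyx))
      (-(invX hx + invXSubOne hx1 + invYSubX hyx))
      (const 2⁻¹ * y * (y - 1) * invX hx * invXSubOne hx1 * invYSubX hyx) := by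
  refine ⟨fun q => 2⁻¹ * (q.2⁻¹ + (q.2 - 1)⁻¹ + (q.2 - q.1)⁻¹),
    fun q => -(q.1⁻¹ + (q.1 - 1)⁻¹ + (q.2 - q.1)⁻¹),
    fun q => 2⁻¹ * q.2 * (q.2 - 1) * q.1⁻¹ * (q.1 - 1)⁻¹ * (q.2 - q.1)⁻¹, rfl, rfl, rfl, ?_⟩
  filter_upwards [continuous_fst.continuousAt.eventually_ne hx,
    continuous_fst.continuousAt.eventually_ne hx1,
    (continuous_snd.sub continuous_fst).continuousAt.eventually_ne (sub_ne_zero.2 hyx)]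
    with q h0 h1 h2 p
  have h3 : q.1 - 1 ≠ 0 := sub_ne_zero.2 h1
  have h4 : q.2 - q.1 ≠ 0 := h2
  -- The parameter `1/2` gives `D = y (y - 1) / (2 x (x - 1) (y - x))`, exactly the term that the
  -- Picard-Fuchs relation absorbs.
  have e : q.2 * (q.2 - 1) * (q.2 - q.1) / (q.1 ^ 2 * (q.1 - 1) ^ 2) *
      (1 / 2 * q.1 * (q.1 - 1) / (q.2 - q.1) ^ 2) =
      2⁻¹ * q.2 * (q.2 - 1) * q.1⁻¹ * (q.1 - 1)⁻¹ * (q.2 - q.1)⁻¹ := by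
    field_simp
  simp only [PVI, zero_mul, zero_div, zero_add, e]
  ring

theorem eventually_contDiffAt_of_hasDerivAt {u v : 𝕜 → 𝕜} {x₀ : 𝕜}
    (hu : ∀ᶠ x in 𝓝 x₀, ContDiffAt 𝕜 ∞ u x) (huv : ∀ᶠ x in 𝓝 x₀, HasDerivAt u (v x) x) :
    ∀ᶠ x in 𝓝 x₀, ContDiffAt 𝕜 ∞ v x := by
  filter_upwards [hu, huv.eventually_nhds] with z h1 h2
  refine ContDiffAt.congr_of_eventuallyEq (f := deriv u) ?_ (h2.mono fun r hr => hr.deriv.symm)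
  exact (h1.fderiv_right (m := ∞) (by simp)).clm_apply contDiffAt_const

theorem ode_ofX {f f₁ f₂ : 𝕜 → 𝕜} {hf : ∀ᶠ x in 𝓝 q₀.1, ContDiffAt 𝕜 ∞ f x}
    {hf₁ : ∀ᶠ x in 𝓝 q₀.1, ContDiffAt 𝕜 ∞ f₁ x} {hf₂ : ∀ᶠ x in 𝓝 q₀.1, ContDiffAt 𝕜 ∞ f₂ x}
    (h : ∀ᶠ x in 𝓝 q₀.1, 4 * x * (1 - x) * f₂ x + 4 * (1 - 2 * x) * f₁ x - f x = 0) :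
    4 * x * (1 - x) * ofX f₂ hf₂ + 4 * (1 - 2 * x) * ofX f₁ hf₁ - ofX f hf = 0 := by
  rw [← const_ofNat 4, ← const_ofNat 2]
  apply Subtype.ext
  apply Germ.coe_eq.2
  filter_upwards [continuous_fst.continuousAt.eventually h] with q hq using hq

theorem exists_hypergeometric_germ (hx : q₀.1 ≠ 0) (hx1 : q₀.1 ≠ 1) :
    ∃ f f₁ f₂ ψ : SmoothGerm q₀, ψ * f = 1 ∧ dx f = f₁ ∧ dy f = 0 ∧ dx f₁ = f₂ ∧
      4 * x * (1 - x) * f₂ + 4 * (1 - 2 * x) * f₁ - f = 0 := by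
  obtain ⟨f, f₁, f₂, hf0, hf⟩ := exists_hypergeometric hx hx1
  have hf₀ : ∀ᶠ x in 𝓝 q₀.1, ContDiffAt 𝕜 ∞ f x := hf.mono fun _ h => h.1
  have hd₀ : ∀ᶠ x in 𝓝 q₀.1, HasDerivAt f (f₁ x) x := hf.mono fun _ h => h.2.1
  have hd₁ : ∀ᶠ x in 𝓝 q₀.1, HasDerivAt f₁ (f₂ x) x := hf.mono fun _ h => h.2.2.1
  have hf₁ := eventually_contDiffAt_of_hasDerivAt hf₀ hd₀
  have hf₂ := eventually_contDiffAt_of_hasDerivAt hf₁ hd₁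
  have hD₀ := dir_ofX (hf := hf₀) hd₀ hf₁
  have hD₁ := dir_ofX (hf := hf₁) hd₁ hf₂
  have hode := ode_ofX (hf := hf₀) (hf₁ := hf₁) (hf₂ := hf₂) (hf.mono fun _ h => h.2.2.2)
  have hfu : IsUnit (ofX f hf₀) := isUnit_mk (hf := eventually_contDiffAt_comp_fst hf₀) hf0
  obtain ⟨ψ, hψ⟩ := hfu.exists_left_inv
  exact ⟨ofX f hf₀, ofX f₁ hf₁, ofX f₂ hf₂, ψ, hψ, hD₀.1, hD₀.2, hD₁.1, hode⟩

theorem nonempty_ellipticFrame (hx : q₀.1 ≠ 0) (hx1 : q₀.1 ≠ 1)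
    {ix iy ix1 iy1 q h : SmoothGerm q₀} (hc : IsCoordinates (dx (q₀ := q₀)) (dy (q₀ := q₀)) x y ix iy)
    (hq : q * (y - x) = 1) (hh : 2 * h = 1) (hix1 : ix1 * (x - 1) = 1) (hiy1 : iy1 * (y - 1) = 1) :
    Nonempty (Frame (dx (q₀ := q₀)) (dy (q₀ := q₀)) (h * (iy + iy1 + q)) (-(ix + ix1 + q))
      (h * y * (y - 1) * ix * ix1 * q) 0) := by
  have hcy := closed_PVI_y hc hq hh hiy1
  obtain ⟨g, hg1, hg2⟩ := exists_primitive hcy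
  obtain ⟨w, hwu, hw⟩ := exists_exp g
  obtain ⟨iw, hiw⟩ := hwu.exists_left_inv
  have dx_w : dx w = h * w * q := by
    rw [hw, hg1]
    ring
  have dy_w : dy w = -(w * (h * (iy + iy1 + q))) := by
    rw [hw, hg2]
    ring
  obtain ⟨f, f₁, f₂, ψ, hψ, dx_f, dy_f, dx_f₁, hode⟩ := exists_hypergeometric_germ hx hx1
  have hcx := closed_PVI_x hc hq hh hiy1 dx_w dy_w dx_f dy_f dx_f₁ hode
  obtain ⟨c, hc1, hc2⟩ := exists_primitive hcx
  exact ⟨ellipticFrame hc hh hix1 hiw dx_w dy_w hψ dx_f dy_f hc1 hc2⟩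

theorem finrank_PVI (hx : q₀.1 ≠ 0) (hx1 : q₀.1 ≠ 1) (hy : q₀.2 ≠ 0) (hy1 : q₀.2 ≠ 1)
    (hyx : q₀.2 ≠ q₀.1) :
    Module.finrank 𝕜 (symmetryAlgebra (PVI 0 0 0 (1 / 2)) q₀) = 8 := by
  obtain ⟨φ⟩ := nonempty_ellipticFrame hx hx1 (isCoordinates hx hy) (invYSubX_mul hyx)
    two_mul_const_half (invXSubOne_mul hx1) (invYSubOne_mul hy1)
  exact φ.finrank_eq_eight (isQuadratic_PVI hx hx1 hy hy1 hyx)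

end SmoothGerm

end PointSymmetry

end

theorem mainTheorem6 {𝕜 : Type*} [RCLike 𝕜] :
    -- dimension 8
    (∀ x₀ y₀ : 𝕜, x₀ ≠ 0 → y₀ ≠ 0 →
      Module.finrank 𝕜
        (PointSymmetry.symmetryAlgebra (PointSymmetry.PIII 0 0 0 0) (x₀, y₀)) = 8) ∧
    (∀ x₀ y₀ : 𝕜, x₀ ≠ 0 → y₀ ≠ 0 → y₀ ≠ 1 →
      Module.finrank 𝕜
        (PointSymmetry.symmetryAlgebra (PointSymmetry.PV 0 0 0 0) (x₀, y₀)) = 8) ∧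
    (∀ x₀ y₀ : 𝕜, x₀ ≠ 0 → x₀ ≠ 1 → y₀ ≠ 0 → y₀ ≠ 1 → y₀ ≠ x₀ →
      Module.finrank 𝕜
        (PointSymmetry.symmetryAlgebra (PointSymmetry.PVI 0 0 0 (1 / 2)) (x₀, y₀)) = 8) ∧
    -- dimension 2: one non-zero parameter
    (∀ k x₀ y₀ : 𝕜, k ≠ 0 → x₀ ≠ 0 → y₀ ≠ 0 →
      Module.finrank 𝕜
        (PointSymmetry.symmetryAlgebra (PointSymmetry.PIII 0 k 0 0) (x₀, y₀)) = 2 ∧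
      Module.finrank 𝕜
        (PointSymmetry.symmetryAlgebra (PointSymmetry.PIII k 0 0 0) (x₀, y₀)) = 2 ∧
      Module.finrank 𝕜
        (PointSymmetry.symmetryAlgebra (PointSymmetry.PIII 0 0 k 0) (x₀, y₀)) = 2 ∧
      Module.finrank 𝕜
        (PointSymmetry.symmetryAlgebra (PointSymmetry.PIII 0 0 0 k) (x₀, y₀)) = 2 ∧
      (∃ ln : 𝕜 → 𝕜, PointSymmetry.IsLocalLog ln x₀) ∧
      ∀ ln : 𝕜 → 𝕜, PointSymmetry.IsLocalLog ln x₀ →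
        PointSymmetry.symmetryAlgebra (PointSymmetry.PIII 0 k 0 0) (x₀, y₀) =
          Submodule.span 𝕜
            {PointSymmetry.fieldGerm (x₀, y₀) (fun x _ => x) (fun _ y => y),
              PointSymmetry.fieldGerm (x₀, y₀)
                (fun x _ => x * ln x - 2 * x) (fun x y => y * ln x)} ∧
        PointSymmetry.symmetryAlgebra (PointSymmetry.PIII k 0 0 0) (x₀, y₀) =
          Submodule.span 𝕜
            {PointSymmetry.fieldGerm (x₀, y₀) (fun x _ => x) (fun _ y => -y),
              PointSymmetry.fieldGerm (x₀, y₀)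
                (fun x _ => x * ln x - 2 * x) (fun x y => -(y * ln x))} ∧
        PointSymmetry.symmetryAlgebra (PointSymmetry.PIII 0 0 k 0) (x₀, y₀) =
          Submodule.span 𝕜
            {PointSymmetry.fieldGerm (x₀, y₀) (fun x _ => x) (fun _ y => -y),
              PointSymmetry.fieldGerm (x₀, y₀)
                (fun x _ => x * ln x - x) (fun x y => -(y * ln x))} ∧
        PointSymmetry.symmetryAlgebra (PointSymmetry.PIII 0 0 0 k) (x₀, y₀) =
          Submodule.span 𝕜
            {PointSymmetry.fieldGerm (x₀, y₀) (fun x _ => x) (fun _ y => y),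
              PointSymmetry.fieldGerm (x₀, y₀)
                (fun x _ => x * ln x - x) (fun x y => y * ln x)}) ∧
    -- dimension 1
    (∀ b d x₀ y₀ : 𝕜, b ≠ 0 → d ≠ 0 → x₀ ≠ 0 → y₀ ≠ 0 →
      Module.finrank 𝕜
        (PointSymmetry.symmetryAlgebra (PointSymmetry.PIII 0 b 0 d) (x₀, y₀)) = 1 ∧
      PointSymmetry.symmetryAlgebra (PointSymmetry.PIII 0 b 0 d) (x₀, y₀) =
        Submodule.span 𝕜
          {PointSymmetry.fieldGerm (x₀, y₀) (fun x _ => x) (fun _ y => y)} ∧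
      Module.finrank 𝕜
        (PointSymmetry.symmetryAlgebra (PointSymmetry.PIII (-b) 0 (-d) 0) (x₀, y₀)) = 1 ∧
      PointSymmetry.symmetryAlgebra (PointSymmetry.PIII (-b) 0 (-d) 0) (x₀, y₀) =
        Submodule.span 𝕜
          {PointSymmetry.fieldGerm (x₀, y₀) (fun x _ => x) (fun _ y => -y)} ∧
      PointSymmetry.IsEquivalenceAt (PointSymmetry.PIII 0 b 0 d)
        (PointSymmetry.PIII (-b) 0 (-d) 0) (fun q => (q.1, 1 / q.2)) (x₀, y₀)) ∧
    (∀ a b x₀ y₀ : 𝕜, (a ≠ 0 ∨ b ≠ 0) → x₀ ≠ 0 → y₀ ≠ 0 → y₀ ≠ 1 →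
      Module.finrank 𝕜
        (PointSymmetry.symmetryAlgebra (PointSymmetry.PV a b 0 0) (x₀, y₀)) = 1 ∧
      PointSymmetry.symmetryAlgebra (PointSymmetry.PV a b 0 0) (x₀, y₀) =
        Submodule.span 𝕜
          {PointSymmetry.fieldGerm (x₀, y₀) (fun x _ => x) (fun _ _ => 0)}) := by
  refine ⟨fun x₀ y₀ hx hy => ?_, fun x₀ y₀ hx hy hy1 => ?_, fun x₀ y₀ hx hx1 hy hy1 hyx => ?_,
    fun k x₀ y₀ hk hx hy => ?_, fun b d x₀ y₀ hb hd hx hy => ?_,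
    fun a b x₀ y₀ hab hx hy hy1 => ?_⟩
  · exact PointSymmetry.SmoothGerm.finrank_PIII (q₀ := (x₀, y₀)) hx hy
  · exact PointSymmetry.SmoothGerm.finrank_PV (q₀ := (x₀, y₀)) hx hy hy1
  · exact PointSymmetry.SmoothGerm.finrank_PVI (q₀ := (x₀, y₀)) hx hx1 hy hy1 hyx
  · have hb := PointSymmetry.SmoothGerm.symmetryAlgebra_PIII_b (q₀ := (x₀, y₀)) hx hy hk
    have ha := PointSymmetry.SmoothGerm.symmetryAlgebra_PIII_a (q₀ := (x₀, y₀)) hx hy hk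
    have hc := PointSymmetry.SmoothGerm.symmetryAlgebra_PIII_c (q₀ := (x₀, y₀)) hx hy hk
    have hd := PointSymmetry.SmoothGerm.symmetryAlgebra_PIII_d (q₀ := (x₀, y₀)) hx hy hk
    exact ⟨hb.1, ha.1, hc.1, hd.1, PointSymmetry.SmoothGerm.exists_isLocalLog hx, fun ln hln =>
      ⟨hb.2 ln hln, ha.2 ln hln, hc.2 ln hln, hd.2 ln hln⟩⟩
  · have h := PointSymmetry.SmoothGerm.symmetryAlgebra_PIII_b_d (q₀ := (x₀, y₀)) hx hy hb hd
    have h' := PointSymmetry.SmoothGerm.symmetryAlgebra_PIII_a_c (q₀ := (x₀, y₀)) hx hy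
      (neg_ne_zero.2 hb) (neg_ne_zero.2 hd)
    exact ⟨h.1, h.2, h'.1, h'.2, PointSymmetry.isEquivalenceAt_PIII b d hy⟩
  · exact PointSymmetry.SmoothGerm.symmetryAlgebra_PV (q₀ := (x₀, y₀)) hx hy hy1 hab
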